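/- Let $F$ be a non-archimedean local field of characteristic $0$, with ring of integers $\mathcal O$, residue field of cardinality $q$, normalized absolute value $|\cdot|$ and a uniformizer $\varpi$. Let $k\ge 1$, $0<l<c$, and let $\tau_1,\dots,\tau_k$ be unramified quasi-characters of $F^*$. For a composition $\beta$ of $n$ let $P_\beta=M_\beta\ltimes V_\beta$ be the standard (block upper triangular) parabolic subgroup of $\mathrm{GL}_n=\mathrm{GL}_n(F)$, $\delta_{P_\beta}$ its modulus character, and let $\mathrm{Ind}$ be normalized smooth induction. For $a\ge1$ and $\zeta\in\mathbb C^k$ put $$\rho_a(\tau_\zeta)=\mathrm{Ind}_{P_{(a^k)}}^{\mathrm{GL}_{ka}}\Big(\bigotimes_{i=1}^k|\cdot|^{\zeta_i}\tau_i\circ\det\Big).$$ Let $\xi^0(\zeta,\cdot)$ be the normalized unramified vector of $\rho_c(\tau_\zeta)$, i.e. the right $\mathrm{GL}_{kc}(\mathcal O)$-invariant function in its space with $\xi^0(\zeta,1)=1$ (such a function exists for every $\zeta$). Let $\kappa\in\mathrm{GL}_{kc}$ be the permutation matrix whose first $k$ block rows (of height $l$) have $I_l$ in the first $l$ columns of the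 successive column blocks of size $c$, and whose last $k$ block rows (of height $c-l$) have $I_{c-l}$ in the last $c-l$ columns of the successive column blocks of size $c$. For $a\ge 1$ let $w_{(a^k)}\in\mathrm{GL}_{ka}$ be the block permutation matrix with blocks $I_a$ on the anti-diagonal. Let $V^2$ be the subgroup of those $v=(v_{i,j})_{1\le i,j\le k}\in V_{(c^k)}$, $v_{i,j}\in\mathrm{Mat}_c$, whose blocks $v_{i,j}$ with $i<j$ vanish outside the upper right $l\times(c-l)$ corner, and let $Z=xV^2x^{-1}$ with $x=\mathrm{diag}(w_{(l^k)},w_{((c-l)^k)})\kappa$, with a Haar measure $dz$. Define $m(\zeta,\kappa)\xi^0(\zeta,g)$ by the meromorphic continuation, i.e. as an element of $\mathbb C(q^{-\zeta_1},\dots,q^{-\zeta_k})$ for each $g\in\mathrm{GL}_{kc}$, of the integral $$m(\zeta,\kappa)\xi^0(\zeta,g)=\int_Z\xi^0(\zeta,\kappa^{-1}zg)\,dz ,$$ which converges absolutely for all $g$ when $\mathrm{Re}(\zeta)$ lies in a cone $\mathrm{Re}(\zeta_1)\gg\dots\gg\mathrm{Re}(\zeta_k)$ independent of $g$. Assume that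 $1-q^{-s}\tau_i(\varpi)\tau_j^{-1}(\varpi)\ne0$ for all $i<j$ and all $s\in\mathbb C$ with $\mathrm{Re}(s)\ge1$. Then this integral converges absolutely in such a cone and has such a continuation, and for every $\zeta\in\mathbb C^k$ with $\mathrm{Re}(\zeta_1)\ge\dots\ge\mathrm{Re}(\zeta_k)$ the function $m(\zeta,\kappa)\xi^0(\zeta,\cdot)$ on $\mathrm{GL}_{kc}$ is well defined (for each $g$ the continuation has no pole at $\zeta$), is not identically zero, and belongs to the space of $$\mathrm{Ind}_{P_{(kl,k(c-l))}}^{\mathrm{GL}_{kc}}\Big(\big(\rho_l(\tau_\zeta)\otimes\rho_{c-l}(\tau_\zeta)\big)\,\delta_{P_{(kl,k(c-l))}}^{-1/(2k)}\Big),$$ whose vectors $\varphi$ are regarded as the complex-valued functions $g\mapsto\varphi(g)(1,1)$. -/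

import Mathlib

open ValuativeRel
open scoped TensorProduct

noncomputable section

namespace UnramifiedInd

/-! ### The local field -/

section Field

variable (F : Type*) [Field F] [ValuativeRel F] [TopologicalSpace F]
  [IsNonarchimedeanLocalField F]

/-- The cardinality `q` of the residue field. -/
def q : ℕ := Nat.card 𝓀[F]

variable {F}

/-- The normalized additive valuation on `Fˣ` (value `1` on uniformizers). -/
def ord (x : Fˣ) : ℤ :=
  - WithZero.log (IsNonarchimedeanLocalField.valueGroupWithZeroIsoInt F (valuation F (x : F)))

theorem ord_one : ord (1 : Fˣ) = 0 := by simp [ord]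

theorem ord_mul (x y : Fˣ) : ord (x * y) = ord x + ord y := by
  unfold ord
  rw [Units.val_mul, map_mul, map_mul, WithZero.log_mul (by simp) (by simp)]
  ring

/-- The normalized absolute value on `Fˣ`, `|x| = q ^ (-ord x)`. -/
def nabs (x : Fˣ) : ℝ := (q F : ℝ) ^ (-ord x)

instance : NeZero (q F) := ⟨Nat.card_pos.ne'⟩

theorem q_pos : (0 : ℝ) < q F := by
  exact_mod_cast Nat.pos_of_ne_zero (NeZero.ne (q F))

theorem nabs_pos (x : Fˣ) : 0 < nabs x := zpow_pos q_pos _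

theorem nabs_one : nabs (1 : Fˣ) = 1 := by simp [nabs, ord_one]

theorem nabs_mul (x y : Fˣ) : nabs (x * y) = nabs x * nabs y := by
  unfold nabs
  rw [ord_mul, neg_add, zpow_add₀ q_pos.ne']

/-- The quasi-character `x ↦ |x| ^ s` of `Fˣ`. -/
def absChar (s : ℂ) : Fˣ →* ℂ where
  toFun x := (nabs x : ℂ) ^ s
  map_one' := by simp [nabs_one]
  map_mul' x y := by
    rw [nabs_mul, Complex.ofReal_mul,
      Complex.mul_cpow_ofReal_nonneg (nabs_pos x).le (nabs_pos y).le]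

/-- A quasi-character of `Fˣ` is unramified if it is trivial on the units of the ring of integers
(such a homomorphism is automatically continuous). -/
def IsUnramified (χ : Fˣ →* ℂˣ) : Prop := ∀ u : Fˣ, ord u = 0 → χ u = 1

end Field

/-! ### Standard parabolic subgroups of `GL_n` and normalized parabolic induction -/

section Parabolic

/-- For a composition `β` of `n`, the `x`-th index of the `i`-th block (in the usual order). -/
def blockEquiv {d n : ℕ} (β : Fin d → ℕ) (h : ∑ i, β i = n) : (Σ i, Fin (β i)) ≃ Fin n :=
  finSigmaFinEquiv.trans (finCongr h)

variable (F : Type*) [Field F]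

/-- The standard parabolic subgroup `P_β` of `GL_n` of block upper triangular matrices. -/
def parabolic {d n : ℕ} (β : Fin d → ℕ) (h : ∑ i, β i = n) : Subgroup (GL (Fin n) F) where
  carrier := {g | (g : Matrix (Fin n) (Fin n) F).BlockTriangular
    fun x => ((blockEquiv β h).symm x).1}
  one_mem' := Matrix.blockTriangular_one
  mul_mem' ha hb := by
    simpa using Matrix.BlockTriangular.mul ha hb
  inv_mem' {g} hg := by
    have := (g : Matrix (Fin n) (Fin n) F).invertibleOfIsUnitDet
      ((Matrix.isUnit_iff_isUnit_det _).1 g.isUnit)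
    simpa using Matrix.blockTriangular_inv_of_blockTriangular hg

/-- The Levi subgroup `M_β`, as the product of the groups `GL_{β_i}`. -/
abbrev Levi {d : ℕ} (β : Fin d → ℕ) : Type _ := ∀ i, GL (Fin (β i)) F

variable {F} {d n : ℕ} (β : Fin d → ℕ) (h : ∑ i, β i = n)

/-- The `i`-th diagonal block of an element of `P_β`. -/
def diagBlock (i : Fin d) : parabolic F β h →* Matrix (Fin (β i)) (Fin (β i)) F where
  toFun p := Matrix.of fun x y =>
    (p : GL (Fin n) F) (blockEquiv β h ⟨i, x⟩) (blockEquiv β h ⟨i, y⟩)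
  map_one' := by
    ext x y
    simp [Matrix.one_apply]
  map_mul' p p' := by
    ext x z
    have hp : ∀ a b, ((blockEquiv β h).symm b).1 < ((blockEquiv β h).symm a).1 →
      (p : GL (Fin n) F) a b = 0 := fun a b hab => p.2 hab
    have hp' : ∀ a b, ((blockEquiv β h).symm b).1 < ((blockEquiv β h).symm a).1 →
      (p' : GL (Fin n) F) a b = 0 := fun a b hab => p'.2 hab
    simp only [Matrix.of_apply, Subgroup.coe_mul, Units.val_mul, Matrix.mul_apply]
    rw [← (blockEquiv β h).sum_comp, Fintype.sum_sigma, Finset.sum_eq_single i]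
    · intro j _ hj
      refine Finset.sum_eq_zero fun y _ => ?_
      rcases lt_or_gt_of_ne hj with hlt | hlt
      · rw [hp _ _ (by simpa using hlt), zero_mul]
      · rw [hp' _ _ (by simpa using hlt), mul_zero]
    · simp

/-- The projection `P_β → M_β`. -/
def toLevi : parabolic F β h →* Levi F β :=
  MonoidHom.pi fun i => (diagBlock β h i).toHomUnits

end Parabolic

section Induction

variable {F : Type*} [Field F] [ValuativeRel F] [TopologicalSpace F]
  [IsNonarchimedeanLocalField F]
variable {d n : ℕ} (β : Fin d → ℕ) (h : ∑ i, β i = n)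

/-- The modulus character of `P_β`, as a function on `M_β`:
`δ(m) = ∏_{i<j} |det m_i| ^ β_j * |det m_j| ^ (-β_i)`. -/
def modulus (m : Levi F β) : ℝ :=
  ∏ i, ∏ j, if i < j then
    nabs (Matrix.GeneralLinearGroup.det (m i)) ^ (β j : ℤ) *
      nabs (Matrix.GeneralLinearGroup.det (m j)) ^ (-(β i : ℤ))
  else 1

theorem modulus_pos (m : Levi F β) : 0 < modulus β m := by
  refine Finset.prod_pos fun i _ => Finset.prod_pos fun j _ => ?_
  split_ifs
  · exact mul_pos (zpow_pos (nabs_pos _) _) (zpow_pos (nabs_pos _) _)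
  · exact one_pos

theorem modulus_one : modulus β (1 : Levi F β) = 1 := by
  simp [modulus, nabs_one]

theorem modulus_mul (m m' : Levi F β) :
    modulus β (m * m') = modulus β m * modulus β m' := by
  simp only [modulus, ← Finset.prod_mul_distrib]
  refine Finset.prod_congr rfl fun i _ => Finset.prod_congr rfl fun j _ => ?_
  split_ifs
  · simp only [Pi.mul_apply, map_mul, nabs_mul, mul_zpow]
    ring
  · simp

/-- The character `δ_{P_β} ^ s` of `M_β`. -/
def modulusPow (s : ℂ) : Levi F β →* ℂ where
  toFun m := (modulus β m : ℂ) ^ s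
  map_one' := by simp [modulus_one]
  map_mul' m m' := by
    rw [modulus_mul, Complex.ofReal_mul,
      Complex.mul_cpow_ofReal_nonneg (modulus_pos β m).le (modulus_pos β m').le]

/-- The twist of a representation by a character. -/
def twist {G V : Type*} [Monoid G] [AddCommMonoid V] [Module ℂ V] (χ : G →* ℂ)
    (σ : Representation ℂ G V) : Representation ℂ G V where
  toFun g := χ g • σ g
  map_one' := by simp
  map_mul' a b := by
    ext v
    simp [mul_smul, smul_comm (χ b)]

/-- The one-dimensional representation attached to a character. -/
def charRep {G : Type*} [Monoid G] (χ : G →* ℂ) : Representation ℂ G ℂ :=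
  twist χ (Representation.trivial ℂ G ℂ)

/-- The space of the normalized smooth induction `Ind_{P_β}^{GL_n}(σ)`: functions
`φ : GL_n → V` with `φ(pg) = δ(p)^{1/2} σ(p) φ(g)` for `p ∈ P_β` (`σ` inflated from `M_β`) which are
right-invariant under an open subgroup. -/
def parabolicInd {V : Type*} [AddCommMonoid V] [Module ℂ V]
    (σ : Representation ℂ (Levi F β) V) : Submodule ℂ (GL (Fin n) F → V) where
  carrier := {φ |
    (∀ (p : parabolic F β h) (g : GL (Fin n) F),
      φ (p * g) = modulusPow β (1 / 2) (toLevi β h p) • σ (toLevi β h p) (φ g)) ∧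
    ∃ U : Subgroup (GL (Fin n) F), IsOpen (U : Set (GL (Fin n) F)) ∧
      ∀ g, ∀ u ∈ U, φ (g * u) = φ g}
  zero_mem' := ⟨by simp, ⊤, by simp, by simp⟩
  add_mem' := by
    rintro φ φ' ⟨h1, U, hU, h2⟩ ⟨h1', U', hU', h2'⟩
    refine ⟨fun p g => ?_, U ⊓ U', by simpa using hU.inter hU', fun g u hu => ?_⟩
    · simp [h1, h1']
    · simp [h2 g u hu.1, h2' g u hu.2]
  smul_mem' := by
    rintro a φ ⟨h1, U, hU, h2⟩
    refine ⟨fun p g => ?_, U, hU, fun g u hu => ?_⟩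
    · simp [h1, smul_comm a]
    · simp [h2 g u hu]

/-- The action of `GL_n` on `Ind_{P_β}^{GL_n}(σ)` by right translations. -/
def parabolicIndRep {V : Type*} [AddCommMonoid V] [Module ℂ V]
    (σ : Representation ℂ (Levi F β) V) :
    Representation ℂ (GL (Fin n) F) (parabolicInd β h σ) where
  toFun x :=
    { toFun := fun φ => ⟨fun g => φ.1 (g * x), fun p g => by
          simpa [mul_assoc] using φ.2.1 p (g * x), by
        obtain ⟨U, hU, h2⟩ := φ.2.2
        refine ⟨U.comap (MulAut.conj x⁻¹).toMonoidHom, ?_, fun g u hu => ?_⟩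
        · have hc : Continuous fun u : GL (Fin n) F => x⁻¹ * u * x := by fun_prop
          simpa [Set.preimage] using hU.preimage hc
        · have := h2 (g * x) _ hu
          simpa [mul_assoc] using this⟩
      map_add' := fun _ _ => rfl
      map_smul' := fun _ _ => rfl }
  map_one' := by ext; simp
  map_mul' a b := by ext; simp [mul_assoc]

end Induction

/-! ### The representations `ρ_c(τ_ζ)` -/

section Rho

variable {F : Type*} [Field F] [ValuativeRel F] [TopologicalSpace F]
  [IsNonarchimedeanLocalField F]
variable {k : ℕ} (τ : Fin k → Fˣ →* ℂˣ) (ζ : Fin k → ℂ)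

/-- The composition `(c^k)` of `kc`. -/
abbrev constComp (k c : ℕ) : Fin k → ℕ := fun _ => c

theorem sum_constComp (k c : ℕ) : ∑ i, constComp k c i = k * c := by simp

/-- The character `⊗_i |det|^{ζ_i} τ_i(det)` of `M_{(c^k)}`. -/
def indChar (c : ℕ) : Levi F (constComp k c) →* ℂ where
  toFun m := ∏ i, absChar (ζ i) (Matrix.GeneralLinearGroup.det (m i)) *
    (τ i (Matrix.GeneralLinearGroup.det (m i)) : ℂ)
  map_one' := by simp
  map_mul' m m' := by
    rw [← Finset.prod_mul_distrib]
    refine Finset.prod_congr rfl fun i _ => ?_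
    simp only [Pi.mul_apply, map_mul, Units.val_mul]
    ring

/-- The space `V(ζ, τ, c)` of `ρ_c(τ_ζ) = Ind_{P_{(c^k)}}^{GL_{kc}}(⊗_i |.|^{ζ_i} τ_i ∘ det)`. -/
def rhoSpace (c : ℕ) : Submodule ℂ (GL (Fin (k * c)) F → ℂ) :=
  parabolicInd (constComp k c) (sum_constComp k c) (charRep (indChar τ ζ c))

/-- The representation `ρ_c(τ_ζ)` of `GL_{kc}`. -/
def rho (c : ℕ) : Representation ℂ (GL (Fin (k * c)) F) (rhoSpace τ ζ c) :=
  parabolicIndRep (constComp k c) (sum_constComp k c) (charRep (indChar τ ζ c))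

variable (F) in
/-- The maximal compact subgroup `GL_n(𝒪)`. -/
def maxCompact (n : ℕ) : Subgroup (GL (Fin n) F) :=
  (Matrix.GeneralLinearGroup.map (n := Fin n) (𝒪[F]).subtype).range

/-- `f` is the normalized unramified vector of `ρ_c(τ_ζ)`. -/
def IsNormalizedUnramifiedVector (c : ℕ) (f : GL (Fin (k * c)) F → ℂ) : Prop :=
  f ∈ rhoSpace τ ζ c ∧ (∀ g, ∀ y ∈ maxCompact F (k * c), f (g * y) = f g) ∧ f 1 = 1

open Classical in
/-- The normalized unramified section `ξ⁰(ζ, g)`, through a decomposition `g = p y` with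
`p ∈ P_{(c^k)}` and `y ∈ GL_{kc}(𝒪)`. -/
def unramifiedSection (c : ℕ) (ζ : Fin k → ℂ) (g : GL (Fin (k * c)) F) : ℂ :=
  if hg : ∃ p : parabolic F (constComp k c) (sum_constComp k c),
      ∃ y ∈ maxCompact F (k * c), g = p * y then
    modulusPow (constComp k c) (1 / 2) (toLevi _ _ hg.choose) *
      indChar τ ζ c (toLevi _ _ hg.choose)
  else 0

end Rho

/-! ### The element `κ` and the group `Z` -/

section Kappa

variable (F : Type*) [Field F]

/-- The permutation matrix with entry `1` at `(x, σ x)` for each `x`. -/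
def permGL {n : ℕ} (σ : Equiv.Perm (Fin n)) : GL (Fin n) F where
  val := σ.permMatrix F
  inv := (σ⁻¹).permMatrix F
  val_inv := by rw [← Matrix.permMatrix_mul]; simp
  inv_val := by rw [← Matrix.permMatrix_mul]; simp

/-- Indices of `GL_{k(l+r)}` in the block order of the composition `(l+r, …, l+r)`:
the pair `(i, x)` goes to `(l+r) i + x`. -/
def wideIdx (k l r : ℕ) : Fin k × (Fin l ⊕ Fin r) ≃ Fin (k * (l + r)) :=
  ((Equiv.refl _).prodCongr finSumFinEquiv).trans finProdFinEquiv

/-- Indices of `GL_{k(l+r)}` in the block order of the composition `(l, …, l, r, …, r)`: `(i, x)` in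
the first summand goes to `l i + x`, and `(i, x)` in the second one to `k l + r i + x`. -/
def tallIdx (k l r : ℕ) : (Fin k × Fin l) ⊕ (Fin k × Fin r) ≃ Fin (k * (l + r)) :=
  ((finProdFinEquiv.sumCongr finProdFinEquiv).trans finSumFinEquiv).trans
    (finCongr (Nat.mul_add k l r).symm)

/-- `κ = κ_{l,r}` in `GL_{k(l+r)}`: the block row `i` of height `l` (resp. `r`) has an identity matrix
in the first `l` (resp. last `r`) columns of the `i`-th block of `l+r` columns. -/
def kappa (k l r : ℕ) : GL (Fin (k * (l + r))) F :=
  permGL F ((tallIdx k l r).symm.trans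
    ((Equiv.prodSumDistrib (Fin k) (Fin l) (Fin r)).symm.trans (wideIdx k l r)))

/-- `diag(w_{(l^k)}, w_{(r^k)})`, where `w_{(a^k)}` has blocks `I_a` on its anti-diagonal. -/
def wDiag (k l r : ℕ) : GL (Fin (k * (l + r))) F :=
  permGL F ((tallIdx k l r).symm.trans
    (((Fin.revPerm.prodCongr (Equiv.refl _)).sumCongr
      (Fin.revPerm.prodCongr (Equiv.refl _))).trans (tallIdx k l r)))

theorem off_mul {m : Type*} [Fintype m] [DecidableEq m] {P : m → m → Prop}
    (hP : ∀ x y z, P x y → ¬ P y z) {a b : Matrix m m F}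
    (ha : ∀ x y, ¬ P x y → a x y = (1 : Matrix m m F) x y)
    (hb : ∀ x y, ¬ P x y → b x y = (1 : Matrix m m F) x y) :
    a * b = a + b - 1 := by
  have h0 : (a - 1) * (b - 1) = 0 := by
    ext x z
    rw [Matrix.mul_apply]
    refine Finset.sum_eq_zero fun y _ => ?_
    by_cases h : P x y
    · simp [hb y z (hP x y z h)]
    · simp [ha x y h]
  have h1 : a * b = (a - 1) * (b - 1) + (a + b - 1) := by noncomm_ring
  rw [h1, h0, zero_add]

/-- The position `(p, p')` lies in the upper right `l × r` corner of a block `(i, j)` of size `l+r`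
with `i < j`. -/
def IsV2Position (k l r : ℕ) (p p' : Fin (k * (l + r))) : Prop :=
  ((wideIdx k l r).symm p).1 < ((wideIdx k l r).symm p').1 ∧
    ((wideIdx k l r).symm p).2.isLeft ∧ ((wideIdx k l r).symm p').2.isRight

theorem IsV2Position.not_trans {k l r : ℕ} (x y z : Fin (k * (l + r)))
    (hxy : IsV2Position k l r x y) : ¬ IsV2Position k l r y z := by
  rintro ⟨-, h2, -⟩
  have h3 := hxy.2.2
  cases h : ((wideIdx k l r).symm y).2 <;> simp_all

/-- The subgroup `V²` of `V_{((l+r)^k)}`: the diagonal blocks of size `l+r` are identity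
matrices, and a block `(i, j)` of size `l+r` with `i < j` is zero outside its upper right `l × r`
corner. -/
def V2 (k l r : ℕ) : Subgroup (GL (Fin (k * (l + r))) F) where
  carrier := {v | ∀ p p', ¬ IsV2Position k l r p p' →
    (v : Matrix (Fin (k * (l + r))) (Fin (k * (l + r))) F) p p' =
      (1 : Matrix (Fin (k * (l + r))) (Fin (k * (l + r))) F) p p'}
  one_mem' := fun _ _ _ => rfl
  mul_mem' := by
    intro a b ha hb p p' hp
    rw [Units.val_mul, off_mul F IsV2Position.not_trans ha hb]
    simp [ha p p' hp, hb p p' hp]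
  inv_mem' := by
    intro a ha
    have hb : ∀ p p', ¬ IsV2Position k l r p p' →
        (2 - (a : Matrix (Fin (k * (l + r))) (Fin (k * (l + r))) F)) p p' =
        (1 : Matrix (Fin (k * (l + r))) (Fin (k * (l + r))) F) p p' := by
      intro p p' hp
      rw [← one_add_one_eq_two]
      simp [ha p p' hp]
    have h1 := off_mul F IsV2Position.not_trans ha hb
    have h2 : (a : Matrix (Fin (k * (l + r))) (Fin (k * (l + r))) F) *
        (2 - (a : Matrix (Fin (k * (l + r))) (Fin (k * (l + r))) F)) = 1 := by
      rw [h1, ← one_add_one_eq_two]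
      abel
    have h3 : ((a⁻¹ : GL (Fin (k * (l + r))) F) : Matrix _ _ F) = 2 - a.val :=
      (Units.inv_eq_of_mul_eq_one_right h2)
    intro p p' hp
    rw [h3]
    exact hb p p' hp

/-- `Z`, the conjugate of `V²` by `diag(w_{(l^k)}, w_{(r^k)}) κ`. -/
def Z (k l r : ℕ) : Subgroup (GL (Fin (k * (l + r))) F) :=
  (V2 F k l r).map (MulAut.conj (wDiag F k l r * kappa F k l r)).toMonoidHom

end Kappa

/-! ### The intertwining operator -/

section Intertwining

open MeasureTheory

variable {F : Type*} [Field F] [ValuativeRel F] [TopologicalSpace F]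
  [IsNonarchimedeanLocalField F] {k l r : ℕ}

/-- The field `ℂ(q^{-ζ_1}, …, q^{-ζ_k})` of meromorphic functions of `ζ`; the variable `X_i` stands for
`q^{-ζ_i}`. -/
abbrev MerFun (k : ℕ) : Type := FractionRing (MvPolynomial (Fin k) ℂ)

variable (F) in
/-- The meromorphic function `R` is defined at `ζ` and takes the value `v` there. -/
def HasValueAt (R : MerFun k) (ζ : Fin k → ℂ) (v : ℂ) : Prop :=
  ∃ A B : MvPolynomial (Fin k) ℂ,
    R * algebraMap _ (MerFun k) B = algebraMap _ (MerFun k) A ∧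
    B.eval (fun i => (q F : ℂ) ^ (-ζ i)) ≠ 0 ∧
    v * B.eval (fun i => (q F : ℂ) ^ (-ζ i)) = A.eval (fun i => (q F : ℂ) ^ (-ζ i))

/-- `M g ∈ ℂ(q^{-ζ_1}, …, q^{-ζ_k})` is the meromorphic continuation of
`ζ ↦ m(ζ, κ)ξ(ζ, g) = ∫_Z ξ(ζ, κ⁻¹ z g) dz` for each `g`: in a cone
`Re ζ_1 ≫ … ≫ Re ζ_k` (independent of `g`) the integral converges absolutely, and is the value
of `M g`. -/
def IsIntertwiningContinuation [MeasurableSpace (Z F k l r)] (μ : Measure (Z F k l r))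
    (ξ : (Fin k → ℂ) → GL (Fin (k * (l + r))) F → ℂ)
    (M : GL (Fin (k * (l + r))) F → MerFun k) : Prop :=
  ∃ C : ℝ, ∀ ζ : Fin k → ℂ, (∀ i j, i < j → C ≤ (ζ i).re - (ζ j).re) →
    ∀ g : GL (Fin (k * (l + r))) F,
      Integrable (fun z : Z F k l r => ξ ζ ((kappa F k l r)⁻¹ * z * g)) μ ∧
      HasValueAt F (M g) ζ (∫ z : Z F k l r, ξ ζ ((kappa F k l r)⁻¹ * z * g) ∂μ)

end Intertwining

/-! ### The target representation -/

section Target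

variable {F : Type*} [Field F] [ValuativeRel F] [TopologicalSpace F]
  [IsNonarchimedeanLocalField F]
variable {k : ℕ} (τ : Fin k → Fˣ →* ℂˣ) (ζ : Fin k → ℂ) (l r : ℕ)

/-- The composition `(kl, kr)` of `k(l+r)`. -/
abbrev twoComp (k l r : ℕ) : Fin 2 → ℕ := ![k * l, k * r]

theorem sum_twoComp (k l r : ℕ) : ∑ i, twoComp k l r i = k * (l + r) := by
  simp [mul_add]

/-- The representation `(ρ_l(τ_ζ) ⊗ ρ_r(τ_ζ)) δ_{P_{(kl,kr)}}^{-1/(2k)}` of `M_{(kl,kr)}`. -/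
def targetLeviRep :
    Representation ℂ (Levi F (twoComp k l r)) (rhoSpace τ ζ l ⊗[ℂ] rhoSpace τ ζ r) :=
  twist (modulusPow (twoComp k l r) (-(1 / (2 * (k : ℂ)))))
    (Representation.tprod
      ((rho τ ζ l).comp (Pi.evalMonoidHom (fun i => GL (Fin (twoComp k l r i)) F) 0))
      ((rho τ ζ r).comp (Pi.evalMonoidHom (fun i => GL (Fin (twoComp k l r i)) F) 1)))

/-- The functional `f₁ ⊗ f₂ ↦ f₁(1) f₂(1)` on `ρ_l(τ_ζ) ⊗ ρ_r(τ_ζ)`. -/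
def evalOne : rhoSpace τ ζ l ⊗[ℂ] rhoSpace τ ζ r →ₗ[ℂ] ℂ :=
  LinearMap.mul' ℂ ℂ ∘ₗ TensorProduct.map
    ((LinearMap.proj 1).comp (rhoSpace τ ζ l).subtype)
    ((LinearMap.proj 1).comp (rhoSpace τ ζ r).subtype)

/-- The space of `Ind_{P_{(kl,kr)}}^{GL_{k(l+r)}}((ρ_l(τ_ζ) ⊗ ρ_r(τ_ζ)) δ^{-1/(2k)})`, whose vectors
are regarded as complex-valued functions on `GL_{k(l+r)}` in the usual way (a vector `φ`, with
values in the space of `ρ_l(τ_ζ) ⊗ ρ_r(τ_ζ)`, is identified with `g ↦ φ(g)(1, 1)`). -/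
def targetSpace : Submodule ℂ (GL (Fin (k * (l + r))) F → ℂ) :=
  (parabolicInd (twoComp k l r) (sum_twoComp k l r) (targetLeviRep τ ζ l r)).map
    ((evalOne τ ζ l r).compLeft (GL (Fin (k * (l + r))) F))

end Target

end UnramifiedInd

end

open UnramifiedInd

/-! The unramified vector of `ρ_c(τ_ζ)` is also the spherical function of a principal series induced
from the upper triangular Borel subgroup: the inducing data involve only determinants of diagonal
blocks, and the determinant of a triangular block is the product of its diagonal entries
(`unramifiedSection_eq_spherical_normParam`). Since `κ⁻¹ z g = (κ⁻¹ z κ)(κ⁻¹ g)`, the integral runs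
over `κ⁻¹ Z κ`, which is the product of the lower triangular root subgroups attached to the pairs of
indices whose order is reversed by `κ⁻¹` (`mem_Z_iff`). It is therefore a standard intertwining
integral, computed by the Gindikin–Karpelevich formula (`gindikin_karpelevich`).

In that formula the Borel subgroup moves, not the group element. Every order `e` of the indices has
its Borel subgroup `borelOf F e`, and the parameters are written as `T i * q ^ (e i)` with `T`
independent of `e`. If `a`, `b` are adjacent for `e`, integration over the root subgroup `(b, a)`
exchanges them in `e`, keeps `T`, and multiplies by `(1 - w / q) / (1 - w)` with `w = T a / T b`
(`rank_one_integral`, a computation in `GL₂`). Each exchange removes one inversion; by Fubini the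
whole integral becomes a product of such factors times the spherical function for the order `κ⁻¹`,
evaluated at `κ⁻¹ g`. Absolute convergence comes from the same formula with `T` replaced by its
absolute values.

The result is rational in the `q ^ (-ζ i)`. The ratios `w` are `q ^ (-(ζ i - ζ j + m)) τ_i(ϖ)
τ_j(ϖ)⁻¹` with `i < j` and an integer `m ≥ 1` (`normParam_div`). In the closed chamber, denominator
and numerator are thus instances of the assumed nonvanishing at `s = ζ i - ζ j + m` and at `s + 1`:
there is no pole, and the value at `g = κ`, where the spherical function is `1`, is nonzero.
Finally, conjugation by `κ` takes the order `κ⁻¹` to the standard order, and its parameters become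
those of the unramified vector of the target representation, the twist by `δ ^ (-1/(2k))` being the
discrepancy between the moduli (`spherical_mem_targetSpace`). -/

noncomputable section

namespace UnramifiedInd

/-! ### The valuation of a local field -/

section Valuation

variable {F : Type*} [Field F] [ValuativeRel F] [TopologicalSpace F]
  [IsNonarchimedeanLocalField F]

/-- The normalized valuation on `F`, with the junk value `0` at `0`. -/
def ordF (x : F) : ℤ :=
  - WithZero.log (IsNonarchimedeanLocalField.valueGroupWithZeroIsoInt F (valuation F x))

theorem ord_eq_ordF (x : Fˣ) : ord x = ordF (x : F) := rfl

@[simp] theorem ordF_zero : ordF (0 : F) = 0 := by simp [ordF]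

@[simp] theorem ordF_one : ordF (1 : F) = 0 := by simp [ordF]

theorem ordF_mul {x y : F} (hx : x ≠ 0) (hy : y ≠ 0) : ordF (x * y) = ordF x + ordF y := by
  simpa [ord_eq_ordF] using ord_mul (Units.mk0 x hx) (Units.mk0 y hy)

@[simp] theorem ordF_inv (x : F) : ordF x⁻¹ = -ordF x := by
  simp [ordF]

theorem ordF_div {x y : F} (hx : x ≠ 0) (hy : y ≠ 0) : ordF (x / y) = ordF x - ordF y := by
  rw [div_eq_mul_inv, ordF_mul hx (inv_ne_zero hy), ordF_inv, sub_eq_add_neg]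

@[simp] theorem ordF_neg (x : F) : ordF (-x) = ordF x := by
  simp [ordF, Valuation.map_neg]

theorem valuation_le_iff {x y : F} (hx : x ≠ 0) (hy : y ≠ 0) :
    valuation F x ≤ valuation F y ↔ ordF y ≤ ordF x := by
  rw [ordF, ordF, neg_le_neg_iff, WithZero.log_le_log (by simpa) (by simpa),
    OrderIsoClass.map_le_map_iff]

/-- Zero needs no exception, because the default value of `ordF` at `0` is nonnegative. -/
theorem mem_integer_iff {x : F} : x ∈ 𝒪[F] ↔ 0 ≤ ordF x := by
  rcases eq_or_ne x 0 with rfl | hx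
  · simp [zero_mem]
  · have := valuation_le_iff hx (one_ne_zero (α := F))
    rw [map_one, ordF_one] at this
    exact this

/-- The ultrametric inequality. The default value `ordF 0 = 0` is wrong for a bound `m > 0`, hence
the separate alternatives for zero, here and in `fracIdeal`. -/
theorem ordF_sub_ge {x y : F} {m : ℤ} (hxy : x - y ≠ 0) (hx : x = 0 ∨ m ≤ ordF x)
    (hy : y = 0 ∨ m ≤ ordF y) : m ≤ ordF (x - y) := by
  rcases eq_or_ne x 0 with rfl | hx0
  · rcases eq_or_ne y 0 with rfl | hy0
    · simp at hxy
    · rw [zero_sub, ordF_neg]; simpa [hy0] using hy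
  rcases eq_or_ne y 0 with rfl | hy0
  · simpa [hx0] using hx
  rcases le_total (valuation F x) (valuation F y) with h | h
  · have h1 : valuation F (x - y) ≤ valuation F y :=
      (Valuation.map_sub _ _ _).trans (max_le h le_rfl)
    exact (by simpa [hy0] using hy : m ≤ ordF y).trans ((valuation_le_iff hxy hy0).1 h1)
  · have h1 : valuation F (x - y) ≤ valuation F x :=
      (Valuation.map_sub _ _ _).trans (max_le le_rfl h)
    exact (by simpa [hx0] using hx : m ≤ ordF x).trans ((valuation_le_iff hxy hx0).1 h1)

variable (F) in
/-- The fractional ideal of elements of valuation at least `m`. -/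
def fracIdeal (m : ℤ) : AddSubgroup F :=
  AddSubgroup.ofSub {x | x = 0 ∨ m ≤ ordF x} ⟨0, Or.inl rfl⟩ fun x hx y hy => by
    rw [← sub_eq_add_neg]
    rcases eq_or_ne (x - y) 0 with h | h
    · exact Or.inl h
    · exact Or.inr (ordF_sub_ge h hx hy)

theorem mem_fracIdeal {m : ℤ} {x : F} : x ∈ fracIdeal F m ↔ x = 0 ∨ m ≤ ordF x := Iff.rfl

theorem mem_fracIdeal_zero {x : F} : x ∈ fracIdeal F 0 ↔ x ∈ 𝒪[F] := by
  rw [mem_fracIdeal, mem_integer_iff]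
  constructor
  · rintro (rfl | h)
    · simp
    · exact h
  · exact Or.inr

variable (F) in
theorem exists_ordF_eq_one : ∃ ϖ : F, ϖ ≠ 0 ∧ ordF ϖ = 1 := by
  obtain ⟨y, hy⟩ := (IsNonarchimedeanLocalField.valueGroupWithZeroIsoInt F).surjective
    (WithZero.exp (-1))
  obtain ⟨x, rfl⟩ := ValuativeRel.valuation_surjective y
  change IsNonarchimedeanLocalField.valueGroupWithZeroIsoInt F (valuation F x) = _ at hy
  refine ⟨x, ?_, ?_⟩
  · rintro rfl
    rw [map_zero, map_zero] at hy
    exact WithZero.zero_ne_coe hy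
  · rw [ordF, hy, WithZero.log_exp, neg_neg]

theorem exists_ordF_eq (m : ℤ) : ∃ x : F, x ≠ 0 ∧ ordF x = m := by
  obtain ⟨ϖ, h0, h1⟩ := exists_ordF_eq_one F
  refine ⟨ϖ ^ m, zpow_ne_zero _ h0, ?_⟩
  rw [ordF, map_zpow₀, map_zpow₀, WithZero.log_zpow, smul_eq_mul]
  rw [ordF] at h1
  linear_combination m * h1

theorem fracIdeal_eq_smul {m : ℤ} {x : F} (hx : x ≠ 0) (hm : ordF x = m) :
    (fracIdeal F m : Set F) = (x * ·) '' (𝒪[F] : Set F) := by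
  ext y
  simp only [SetLike.mem_coe, mem_fracIdeal, Set.mem_image, mem_integer_iff]
  constructor
  · intro hy
    refine ⟨x⁻¹ * y, ?_, by field_simp⟩
    rcases eq_or_ne y 0 with rfl | hy0
    · simp
    · rw [ordF_mul (inv_ne_zero hx) hy0, ordF_inv]
      have := hy.resolve_left hy0
      omega
  · rintro ⟨z, hz, rfl⟩
    rcases eq_or_ne z 0 with rfl | hz0
    · simp
    · right
      rw [ordF_mul hx hz0]; omega

variable (F) in
theorem isOpen_integer : IsOpen (𝒪[F] : Set F) := by
  refine AddSubgroup.isOpen_of_mem_nhds (𝒪[F]).toAddSubgroup (g := 0) ?_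
  refine Filter.mem_of_superset ((IsValuativeTopology.hasBasis_nhds_zero' F).mem_of_mem
    (one_ne_zero (α := ValueGroupWithZero F))) fun x hx => ?_
  exact le_of_lt (a := valuation F x) (b := 1) hx

variable (F) in
theorem isCompact_integer : IsCompact (𝒪[F] : Set F) :=
  IsNonarchimedeanLocalField.isCompact_closedBall F 1

instance : T2Space F := by
  let := IsTopologicalAddGroup.rightUniformSpace F
  have := isUniformAddGroup_of_addCommGroup (G := F)
  infer_instance

theorem isOpen_fracIdeal (m : ℤ) : IsOpen (fracIdeal F m : Set F) := by
  obtain ⟨x, hx, hm⟩ := exists_ordF_eq (F := F) m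
  rw [fracIdeal_eq_smul hx hm]
  exact (Homeomorph.mulLeft₀ x hx).isOpenMap _ (isOpen_integer F)

theorem isCompact_fracIdeal (m : ℤ) : IsCompact (fracIdeal F m : Set F) := by
  obtain ⟨x, hx, hm⟩ := exists_ordF_eq (F := F) m
  rw [fracIdeal_eq_smul hx hm]
  exact (isCompact_integer F).image (Homeomorph.mulLeft₀ x hx).continuous

theorem exists_mem_fracIdeal (x : F) : ∃ m : ℕ, x ∈ fracIdeal F (-m) :=
  ⟨(-ordF x).toNat, Or.inr (by omega)⟩

instance : SigmaCompactSpace F :=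
  ⟨⟨fun m => fracIdeal F (-m), fun m => isCompact_fracIdeal _, by
    ext x
    simpa using exists_mem_fracIdeal x⟩⟩

theorem hasBasis_nhds_zero_fracIdeal :
    (nhds (0 : F)).HasBasis (fun _ : ℕ => True) fun m => (fracIdeal F m : Set F) := by
  refine ⟨fun s => ⟨fun hs => ?_, fun ⟨m, _, hm⟩ =>
    Filter.mem_of_superset ((isOpen_fracIdeal _).mem_nhds (zero_mem _)) hm⟩⟩
  obtain ⟨γ, hγ, h⟩ := (IsValuativeTopology.hasBasis_nhds_zero' F).mem_iff.1 hs
  obtain ⟨y, rfl⟩ := ValuativeRel.valuation_surjective γ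
  have hy : y ≠ 0 := by simpa using hγ
  refine ⟨(ordF y + 1).toNat, trivial, fun x hx => h ?_⟩
  rcases eq_or_ne x 0 with rfl | hx0
  · simpa [zero_lt_iff] using hy
  · have := (mem_fracIdeal.1 hx).resolve_left hx0
    change valuation F x < valuation F y
    rw [← not_le, valuation_le_iff hy hx0]
    omega

/-- Lets Borel structures be compatible with finite products of copies of `F`, as Fubini requires.
The ideals `fracIdeal F m` give a countable basis at `0`, so `F` is pseudometrizable, and it is
σ-compact. -/
instance : SecondCountableTopology F := by
  let := IsTopologicalAddGroup.rightUniformSpace F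
  have := isUniformAddGroup_of_addCommGroup (G := F)
  have : (nhds (0 : F)).IsCountablyGenerated :=
    hasBasis_nhds_zero_fracIdeal.isCountablyGenerated
  have := IsUniformAddGroup.uniformity_countably_generated (α := F)
  let := UniformSpace.pseudoMetricSpace F
  exact EMetric.secondCountable_of_sigmaCompact F

end Valuation

/-! ### Haar measure on a local field -/

section Haar

open MeasureTheory
open scoped Pointwise NNReal ENNReal

variable {F : Type*} [Field F] [ValuativeRel F] [TopologicalSpace F]
  [IsNonarchimedeanLocalField F]

theorem one_lt_q : 1 < q F := Finite.one_lt_card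

theorem residue_eq_iff (x y : 𝒪[F]) :
    IsLocalRing.residue 𝒪[F] x = IsLocalRing.residue 𝒪[F] y ↔ (x - y : F) ∈ fracIdeal F 1 := by
  have hsurj : ∀ z : 𝒪[F], z ∈ IsLocalRing.maximalIdeal 𝒪[F] ↔ (z : F) ∈ fracIdeal F 1 := by
    intro z
    rw [IsLocalRing.mem_maximalIdeal, mem_nonunits_iff, mem_fracIdeal]
    constructor
    · intro h
      by_contra! h2
      have h0 : ordF (z : F) = 0 := by
        have := mem_integer_iff.1 z.2
        omega
      refine h (IsUnit.of_mul_eq_one ⟨(z : F)⁻¹, mem_integer_iff.2 (by simp [h0])⟩ ?_)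
      ext
      simpa using mul_inv_cancel₀ h2.1
    · rintro h ⟨u, rfl⟩
      have h1 : ((u : 𝒪[F]) : F) * ((u⁻¹ : 𝒪[F]ˣ) : 𝒪[F]) = 1 := by
        rw [← Subring.coe_mul, Units.mul_inv, Subring.coe_one]
      have h2 : ((u : 𝒪[F]) : F) ≠ 0 := left_ne_zero_of_mul_eq_one h1
      have h3 := ordF_mul h2 (right_ne_zero_of_mul_eq_one h1)
      have h4 := mem_integer_iff.1 ((u⁻¹ : 𝒪[F]ˣ) : 𝒪[F]).2
      have h5 := h.resolve_left h2
      rw [h1, ordF_one] at h3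
      omega
  rw [← sub_eq_zero, ← map_sub, IsLocalRing.residue_eq_zero_iff, hsurj]
  simp

open Classical in
/-- The restriction to a root subgroup of a spherical function on `GL₂`. -/
def poleFun (w : ℂ) (x : F) : ℂ := if x ∈ 𝒪[F] then 1 else w ^ (-ordF x)

theorem poleFun_of_mem {w : ℂ} {x : F} (h : x ∈ 𝒪[F]) : poleFun w x = 1 := if_pos h

theorem poleFun_of_notMem {w : ℂ} {x : F} (h : x ∉ 𝒪[F]) : poleFun w x = w ^ (-ordF x) := if_neg h

theorem ordF_add_of_notMem {x y : F} (hx : x ∉ 𝒪[F]) (hy : y ∈ 𝒪[F]) :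
    ordF (x + y) = ordF x ∧ x + y ∉ 𝒪[F] := by
  have h1 : x + y ∉ 𝒪[F] := fun h => hx (by simpa using sub_mem h hy)
  refine ⟨?_, h1⟩
  have h2 : valuation F (x + y) = valuation F x := by
    apply Valuation.map_add_eq_of_lt_left
    have h3 : ¬ valuation F x ≤ 1 := hx
    have h4 : valuation F y ≤ 1 := hy
    exact h4.trans_lt (not_le.1 h3)
  rw [ordF, h2, ordF]

theorem poleFun_add {w : ℂ} {x y : F} (hy : y ∈ 𝒪[F]) : poleFun w (x + y) = poleFun w x := by
  by_cases hx : x ∈ 𝒪[F]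
  · rw [poleFun_of_mem hx, poleFun_of_mem (add_mem hx hy)]
  · obtain ⟨h1, h2⟩ := ordF_add_of_notMem hx hy
    rw [poleFun_of_notMem hx, poleFun_of_notMem h2, h1]

theorem continuous_poleFun (w : ℂ) : Continuous (poleFun w : F → ℂ) := by
  refine IsLocallyConstant.continuous ((IsLocallyConstant.iff_exists_open _).2 fun x => ?_)
  refine ⟨(fun y => y - x) ⁻¹' 𝒪[F], (isOpen_integer F).preimage (by fun_prop),
    by simp [zero_mem], fun y hy => ?_⟩
  rw [← poleFun_add (x := x) (y := y - x) hy, add_sub_cancel]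

variable [MeasurableSpace F] [BorelSpace F] (ν : Measure F) [ν.IsAddHaarMeasure]

/-- The ring of integers is the disjoint union of `q` translates of its maximal ideal, one for each
residue class. -/
theorem measure_integer_eq_mul : ν 𝒪[F] = q F * ν (fracIdeal F 1) := by
  have hfin : Fintype 𝓀[F] := Fintype.ofFinite _
  choose lift hlift using IsLocalRing.residue_surjective (R := 𝒪[F])
  have hU : (𝒪[F] : Set F) = ⋃ c : 𝓀[F], ((lift c : F) + ·) '' (fracIdeal F 1 : Set F) := by
    ext x
    simp only [SetLike.mem_coe, Set.mem_iUnion, Set.mem_image]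
    constructor
    · intro hx
      refine ⟨IsLocalRing.residue _ ⟨x, hx⟩, x - lift (IsLocalRing.residue _ ⟨x, hx⟩), ?_, by ring⟩
      exact (residue_eq_iff ⟨x, hx⟩ _).1 (hlift _).symm
    · rintro ⟨c, y, hy, rfl⟩
      refine add_mem (lift c).2 (mem_integer_iff.2 ?_)
      rcases hy with rfl | hy
      · simp
      · omega
  rw [hU, measure_iUnion]
  · have h : ∀ c : 𝓀[F], ν (((lift c : F) + ·) '' (fracIdeal F 1 : Set F)) = ν (fracIdeal F 1) := by
      intro c
      rw [Set.image_add_left, measure_preimage_add]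
    simp [q, Nat.card_eq_fintype_card]
  · intro c d hcd
    rw [Function.onFun, Set.disjoint_left]
    rintro _ ⟨y, hy, rfl⟩ ⟨z, hz, hzy⟩
    apply hcd
    rw [← hlift c, ← hlift d, residue_eq_iff]
    have : (lift c - lift d : F) = z - y := by linear_combination hzy.symm
    rw [this]
    exact sub_mem hz hy
  · intro c
    rw [Set.image_add_left]
    exact ((isOpen_fracIdeal 1).preimage (by fun_prop)).measurableSet

omit [BorelSpace F] in
theorem measure_integer_ne_zero : ν 𝒪[F] ≠ 0 :=
  ((isOpen_integer F).measure_pos ν ⟨0, zero_mem _⟩).ne'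

omit [BorelSpace F] in
theorem measure_integer_ne_top : ν 𝒪[F] ≠ ∞ := (isCompact_integer F).measure_lt_top.ne

variable (F) in
-- A unit preserves `𝒪`, and a uniformizer maps it onto an ideal of index `q`. Every element is a
-- power of the uniformizer times a unit, so these two cases determine the character.
theorem distribHaarChar_eq (x : Fˣ) :
    (distribHaarChar F x : ℝ) = (q F : ℝ) ^ (-ordF (x : F)) := by
  let ν : Measure F := Measure.addHaar
  have hsmul : ∀ x : Fˣ, x • (𝒪[F] : Set F) = fracIdeal F (ordF (x : F)) := fun x =>
    (fracIdeal_eq_smul x.ne_zero rfl).symm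
  have hu : ∀ u : Fˣ, ordF (u : F) = 0 → distribHaarChar F u = 1 := by
    intro u hu
    refine distribHaarChar_eq_of_measure_smul_eq_mul (measure_integer_ne_zero ν)
      (measure_integer_ne_top ν) ?_
    rw [hsmul, hu, ENNReal.coe_one, one_mul]
    congr 1
    ext y
    exact mem_fracIdeal_zero
  obtain ⟨ϖ, h0, h1⟩ := exists_ordF_eq_one F
  have hq0 : (q F : ℝ≥0) ≠ 0 := by exact_mod_cast NeZero.ne (q F)
  have hϖ : distribHaarChar F (Units.mk0 ϖ h0) = (q F : ℝ≥0)⁻¹ := by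
    refine distribHaarChar_eq_of_measure_smul_eq_mul (measure_integer_ne_zero ν)
      (measure_integer_ne_top ν) ?_
    rw [hsmul, Units.val_mk0, h1, measure_integer_eq_mul, ENNReal.coe_inv hq0, ← mul_assoc,
      ENNReal.coe_natCast, ENNReal.inv_mul_cancel, one_mul]
    · exact_mod_cast NeZero.ne (q F)
    · simp
  set π := Units.mk0 ϖ h0
  have hπ : ord π = 1 := h1
  let ordHom : Fˣ →* Multiplicative ℤ :=
    { toFun := fun x => Multiplicative.ofAdd (ord x)
      map_one' := by rw [ord_one]; rfl
      map_mul' := fun x y => by rw [ord_mul]; rfl }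
  have hpow : ∀ m : ℤ, ord (π ^ m) = m := fun m => by
    have := map_zpow ordHom π m
    have h2 : ordHom π = Multiplicative.ofAdd 1 := by simp [ordHom, hπ]
    rw [h2, ← ofAdd_zsmul] at this
    simpa [ordHom] using this
  have hx : x = π ^ ord x * (π ^ (-ord x) * x) := by
    rw [← mul_assoc, ← zpow_add, add_neg_cancel, zpow_zero, one_mul]
  have h3 : ordF ((π ^ (-ord x) * x : Fˣ) : F) = 0 := by
    rw [← ord_eq_ordF, ord_mul, hpow]; ring
  rw [hx, map_mul, hu _ h3, mul_one, map_zpow, hϖ, ← hx, ← ord_eq_ordF]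
  simp

theorem map_mul_left_eq_smul {a : F} (ha : a ≠ 0) :
    ν.map (a * ·) = ENNReal.ofReal ((q F : ℝ) ^ ordF a) • ν := by
  ext s hs
  rw [Measure.map_apply (by fun_prop) hs, Measure.smul_apply]
  have h1 : (a * ·) ⁻¹' s = (Units.mk0 a ha)⁻¹ • s := by
    rw [← Set.preimage_smul]
    rfl
  rw [h1, ← distribHaarChar_mul, smul_eq_mul]
  congr 1
  rw [← ENNReal.ofReal_coe_nnreal, distribHaarChar_eq]
  simp

theorem integrable_comp_mul_add {f : F → ℂ} (hf : Integrable f ν) {a : F} (ha : a ≠ 0) (b : F) :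
    Integrable (fun x => f (a * x + b)) ν := by
  have h1 : Integrable (fun x => f (x + b)) ν := hf.comp_add_right b
  have h2 : Integrable (fun x => f (x + b)) (ν.map (a * ·)) := by
    rw [map_mul_left_eq_smul ν ha]
    exact h1.smul_measure (by simp)
  exact (integrable_map_equiv (Homeomorph.mulLeft₀ a ha).toMeasurableEquiv _).1 h2

theorem integral_comp_mul_add (f : F → ℂ) {a : F} (ha : a ≠ 0) (b : F) :
    ∫ x, f (a * x + b) ∂ν = (q F : ℂ) ^ ordF a * ∫ x, f x ∂ν := by
  have h1 := (Homeomorph.mulLeft₀ a ha).toMeasurableEquiv.measurableEmbedding.integral_map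
    (μ := ν) (fun x => f (x + b))
  have h2 : ⇑(Homeomorph.mulLeft₀ a ha).toMeasurableEquiv = (a * ·) := rfl
  rw [h2, map_mul_left_eq_smul ν ha, integral_smul_measure, integral_add_right_eq_self f b] at h1
  rw [← h1, ENNReal.toReal_ofReal (zpow_nonneg q_pos.le _), Complex.real_smul]
  push_cast
  rfl

theorem measure_fracIdeal (hν : ν 𝒪[F] = 1) (m : ℤ) :
    ν (fracIdeal F m) = ENNReal.ofReal ((q F : ℝ) ^ (-m)) := by
  obtain ⟨x, hx, rfl⟩ := exists_ordF_eq (F := F) m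
  have h : (fracIdeal F (ordF x) : Set F) = Units.mk0 x hx • (𝒪[F] : Set F) :=
    fracIdeal_eq_smul hx rfl
  rw [h, ← distribHaarChar_mul, hν, mul_one, ← ENNReal.ofReal_coe_nnreal, distribHaarChar_eq]
  rfl

/-- The shell `ordF x = -m` has measure at most `q ^ m`, and the function has size at most `‖w‖ ^ m`
there: a geometric series of ratio `q ‖w‖` dominates. -/
theorem integrable_poleFun (hν : ν 𝒪[F] = 1) {w : ℂ} (hw : q F * ‖w‖ < 1) :
    Integrable (poleFun w) ν := by
  have hU : (Set.univ : Set F) = ⋃ m : ℕ, {x | x ∈ fracIdeal F (-m) ∧ ∀ m' < m, x ∉ fracIdeal F (-m')} := by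
    ext x
    classical
    have h := exists_mem_fracIdeal x
    simp only [Set.mem_univ, Set.mem_iUnion, true_iff]
    exact ⟨Nat.find h, Nat.find_spec h, fun m' hm' => Nat.find_min h hm'⟩
  have hb : ∀ m : ℕ, ∀ x ∈ {x : F | x ∈ fracIdeal F (-m) ∧ ∀ m' < m, x ∉ fracIdeal F (-m')},
      ‖poleFun w x‖ ≤ ‖w‖ ^ m := by
    rintro m x ⟨h1, h2⟩
    rcases Nat.eq_zero_or_pos m with rfl | hm
    · rw [poleFun_of_mem (mem_fracIdeal_zero.1 (by simpa using h1))]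
      simp
    · have h3 := h2 (m - 1) (by omega)
      have h4 := h2 0 hm
      rw [Nat.cast_zero, neg_zero, mem_fracIdeal_zero] at h4
      have h5 : x ≠ 0 := fun h => h4 (by simp [h])
      have h6 : ordF x = -m := by
        have := h1.resolve_left h5
        rw [mem_fracIdeal] at h3
        push Not at h3
        have := h3.2
        omega
      rw [poleFun_of_notMem h4, h6]
      simp
  have hmeas : ∀ m : ℕ, ν {x : F | x ∈ fracIdeal F (-m) ∧ ∀ m' < m, x ∉ fracIdeal F (-m')} ≤
      ENNReal.ofReal ((q F : ℝ) ^ m) := by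
    intro m
    refine (measure_mono (t := (fracIdeal F (-m) : Set F)) fun x hx => hx.1).trans ?_
    rw [measure_fracIdeal ν hν]
    simp
  have hfin : ∀ m : ℕ, ν {x : F | x ∈ fracIdeal F (-m) ∧ ∀ m' < m, x ∉ fracIdeal F (-m')} < ∞ :=
    fun m => (hmeas m).trans_lt ENNReal.ofReal_lt_top
  rw [← integrableOn_univ, hU]
  refine integrableOn_iUnion_of_summable_integral_norm (fun m => ?_) ?_
  · refine Measure.integrableOn_of_bounded (M := ‖w‖ ^ m) (hfin m).ne
      (continuous_poleFun w).aestronglyMeasurable ?_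
    refine ae_restrict_of_forall_mem ?_ (hb m)
    refine ((isOpen_fracIdeal _).measurableSet).inter ?_
    have : {x : F | ∀ m' < m, x ∉ fracIdeal F (-(m' : ℤ))} =
        ⋂ m' : ℕ, ⋂ _ : m' < m, (fracIdeal F (-(m' : ℤ)) : Set F)ᶜ := by
      ext; simp
    change MeasurableSet {x : F | ∀ m' < m, x ∉ fracIdeal F (-(m' : ℤ))}
    rw [this]
    exact MeasurableSet.iInter fun m' => MeasurableSet.iInter fun _ =>
      (isOpen_fracIdeal _).measurableSet.compl
  · refine Summable.of_nonneg_of_le (fun m => integral_nonneg fun x => norm_nonneg _) (fun m => ?_)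
      (summable_geometric_of_lt_one (mul_nonneg q_pos.le (norm_nonneg w)) hw)
    rw [mul_pow]
    have h1 := norm_setIntegral_le_of_norm_le_const (μ := ν) (f := fun x => ‖poleFun w x‖)
      (C := ‖w‖ ^ m) (hfin m) (fun x hx => by simpa using hb m x hx)
    refine (le_abs_self _).trans (h1.trans ?_)
    rw [mul_comm]
    gcongr
    exact ENNReal.toReal_le_of_le_ofReal (pow_nonneg q_pos.le _) (hmeas m)

/-- Instead of summing over shells, substitute `x ↦ ϖ⁻¹ x`. This divides the integral `I` by `q`,
while pointwise it multiplies the function by `w`, up to a correction supported on the maximal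
ideal; so `I / q = w I + (1 - w) / q`. -/
theorem integral_poleFun (hν : ν 𝒪[F] = 1) {w : ℂ} (hw0 : w ≠ 0) (hw : q F * ‖w‖ < 1) :
    ∫ x, poleFun w x ∂ν = (1 - w) / (1 - q F * w) := by
  obtain ⟨ϖ, h0, h1⟩ := exists_ordF_eq_one F
  have hi := integrable_poleFun ν hν hw
  have hI : MeasurableSet (fracIdeal F 1 : Set F) := (isOpen_fracIdeal _).measurableSet
  have hfin : ν (fracIdeal F 1 : Set F) ≠ ∞ := (isCompact_fracIdeal 1).measure_lt_top.ne
  have hpt : ∀ x : F, poleFun w (ϖ⁻¹ * x) =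
      w * poleFun w x + (1 - w) * (fracIdeal F 1 : Set F).indicator (fun _ => (1 : ℂ)) x := by
    intro x
    by_cases hx : x ∈ fracIdeal F 1
    · have hx' : x ∈ 𝒪[F] := mem_integer_iff.2 (by rcases hx with rfl | hx <;> [simp; omega])
      have hx2 : ϖ⁻¹ * x ∈ 𝒪[F] := mem_integer_iff.2 (by
        rcases eq_or_ne x 0 with rfl | hx0
        · simp
        · have := hx.resolve_left hx0
          rw [ordF_mul (inv_ne_zero h0) hx0, ordF_inv]; omega)
      rw [poleFun_of_mem hx', poleFun_of_mem hx2,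
        Set.indicator_of_mem (show x ∈ (fracIdeal F 1 : Set F) from hx)]
      ring
    · rw [Set.indicator_of_notMem (show x ∉ (fracIdeal F 1 : Set F) from hx), mul_zero, add_zero]
      have hx0 : x ≠ 0 := fun h => hx (Or.inl h)
      have hx1 : ordF x ≤ 0 := by
        by_contra! h
        exact hx (Or.inr (by omega))
      have hx2 : ordF (ϖ⁻¹ * x) = ordF x - 1 := by
        rw [ordF_mul (inv_ne_zero h0) hx0, ordF_inv]; omega
      have hx3 : ϖ⁻¹ * x ∉ 𝒪[F] := by rw [mem_integer_iff]; omega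
      rw [poleFun_of_notMem hx3, hx2]
      have h4 : -(ordF x - 1) = 1 + -ordF x := by ring
      rw [h4, zpow_add₀ hw0, zpow_one]
      congr 1
      -- On units both branches of `poleFun` give `1`.
      by_cases hx4 : x ∈ 𝒪[F]
      · have : ordF x = 0 := le_antisymm hx1 (mem_integer_iff.1 hx4)
        rw [poleFun_of_mem hx4, this]; simp
      · rw [poleFun_of_notMem hx4]
  have hq0 : (q F : ℂ) ≠ 0 := by exact_mod_cast NeZero.ne (q F)
  have h5 := integral_comp_mul_add ν (poleFun w) (inv_ne_zero h0) 0
  simp only [add_zero, hpt, ordF_inv, h1] at h5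
  have h6 : ∫ x, (fracIdeal F 1 : Set F).indicator (fun _ => (1 : ℂ)) x ∂ν = (q F : ℂ)⁻¹ := by
    rw [integral_indicator_const _ hI, Measure.real, measure_fracIdeal ν hν,
      ENNReal.toReal_ofReal (zpow_nonneg q_pos.le _)]
    simp
  rw [integral_add (hi.const_mul _)
    (((integrable_indicator_iff hI).2 (integrableOn_const hfin)).const_mul _),
    integral_const_mul, integral_const_mul, h6, zpow_neg_one] at h5
  have h7 : 1 - q F * w ≠ 0 := by
    intro h
    have : ‖(q F * w : ℂ)‖ = 1 := by rw [← sub_eq_zero.1 h]; simp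
    rw [norm_mul, Complex.norm_natCast] at this
    linarith
  rw [eq_div_iff h7]
  field_simp at h5
  linear_combination h5.symm

end Haar

/-! ### The maximal compact subgroup and root subgroups -/

section Matrices

variable {F : Type*} [Field F] {n : ℕ}

theorem permGL_mul_apply (σ : Equiv.Perm (Fin n)) (g : GL (Fin n) F) (i j : Fin n) :
    (permGL F σ * g : GL (Fin n) F) i j = g (σ i) j := by
  simp [permGL, Matrix.mul_apply, Equiv.Perm.permMatrix, PEquiv.toMatrix_apply]

theorem mul_permGL_apply (σ : Equiv.Perm (Fin n)) (g : GL (Fin n) F) (i j : Fin n) :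
    (g * permGL F σ : GL (Fin n) F) i j = g i (σ.symm j) := by
  simp [permGL, Matrix.mul_apply, Equiv.Perm.permMatrix, PEquiv.toMatrix_apply,
    ← Equiv.eq_symm_apply]

theorem permGL_apply (σ : Equiv.Perm (Fin n)) (i j : Fin n) :
    (permGL F σ) i j = if σ i = j then 1 else 0 := by
  simp [permGL, Equiv.Perm.permMatrix, PEquiv.toMatrix_apply, eq_comm]

theorem inv_permGL (σ : Equiv.Perm (Fin n)) : (permGL F σ)⁻¹ = permGL F σ⁻¹ := by
  ext; rfl

theorem permGL_mul_permGL (σ π : Equiv.Perm (Fin n)) :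
    permGL F σ * permGL F π = permGL F (σ.trans π) := by
  ext i j
  rw [permGL_mul_apply, permGL_apply, permGL_apply]; rfl

/-- The element `1 + x E_{ij}` of a root subgroup (for `i ≠ j`). -/
def root (i j : Fin n) (x : F) : GL (Fin n) F :=
  if h : i = j then 1 else
    { val := Matrix.transvection i j x
      inv := Matrix.transvection i j (-x)
      val_inv := by rw [Matrix.transvection_mul_transvection_same i j h]; simp
      inv_val := by rw [Matrix.transvection_mul_transvection_same i j h]; simp }

theorem coe_root {i j : Fin n} (h : i ≠ j) (x : F) :
    (root i j x : Matrix (Fin n) (Fin n) F) = Matrix.transvection i j x := by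
  rw [root, dif_neg h]

theorem inv_root (i j : Fin n) (x : F) : (root i j x)⁻¹ = root i j (-x) := by
  by_cases h : i = j
  · simp [root, h]
  · rw [root, root, dif_neg h, dif_neg h]
    ext; rfl

theorem root_mul_apply {i j : Fin n} (h : i ≠ j) (x : F) (g : GL (Fin n) F) (p r : Fin n) :
    (root i j x * g : GL (Fin n) F) p r = g p r + if p = i then x * g j r else 0 := by
  rw [Units.val_mul, coe_root h]
  split_ifs with hp
  · rw [hp, Matrix.transvection_mul_apply_same]
  · rw [Matrix.transvection_mul_apply_of_ne _ _ _ _ hp, add_zero]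

theorem mul_root_apply {i j : Fin n} (h : i ≠ j) (x : F) (g : GL (Fin n) F) (p r : Fin n) :
    (g * root i j x : GL (Fin n) F) p r = g p r + if r = j then x * g p i else 0 := by
  rw [Units.val_mul, coe_root h]
  split_ifs with hp
  · rw [hp, Matrix.mul_transvection_apply_same]
  · rw [Matrix.mul_transvection_apply_of_ne _ _ _ _ hp, add_zero]

theorem root_apply {i j : Fin n} (h : i ≠ j) (x : F) (p r : Fin n) :
    (root i j x) p r = (1 : Matrix (Fin n) (Fin n) F) p r + if p = i ∧ r = j then x else 0 := by
  have := root_mul_apply h x 1 p r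
  rw [mul_one] at this
  rw [this, Units.val_one]
  congr 1
  by_cases hp : p = i <;> by_cases hr : r = j <;> simp [hp, hr, Matrix.one_apply, Ne.symm]
theorem continuous_root [TopologicalSpace F] [IsTopologicalRing F] (i j : Fin n) :
    Continuous (root i j : F → GL (Fin n) F) := by
  by_cases h : i = j
  · have : (root i j : F → GL (Fin n) F) = fun _ => 1 := by ext1 x; simp [root, h]
    rw [this]; fun_prop
  · have hc : Continuous fun x : F => Matrix.transvection i j x := by
      refine continuous_matrix fun p r => ?_
      simp only [Matrix.transvection, Matrix.add_apply, Matrix.single_apply]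
      split_ifs <;> fun_prop
    refine Units.continuous_iff.2 ⟨?_, ?_⟩
    · exact hc.congr fun x => (coe_root h x).symm
    · refine (hc.comp continuous_neg).congr fun x => ?_
      rw [inv_root, coe_root h]; rfl

end Matrices

/-! ### Integrality and openness of the maximal compact subgroup. -/

section MaxCompact

variable {F : Type*} [Field F] [ValuativeRel F] [TopologicalSpace F]
  [IsNonarchimedeanLocalField F] {n : ℕ}

omit [TopologicalSpace F] [IsNonarchimedeanLocalField F] in
theorem mem_maxCompact {g : GL (Fin n) F} :
    g ∈ maxCompact F n ↔ (∀ i j, g i j ∈ 𝒪[F]) ∧ ∀ i j, (g⁻¹ : GL (Fin n) F) i j ∈ 𝒪[F] := by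
  constructor
  · rintro ⟨u, rfl⟩
    refine ⟨fun i j => (u i j).2, fun i j => ?_⟩
    rw [← map_inv]
    exact ((u⁻¹ : GL (Fin n) 𝒪[F]) i j).2
  · rintro ⟨h1, h2⟩
    refine ⟨⟨Matrix.of fun i j => ⟨g i j, h1 i j⟩,
      Matrix.of fun i j => ⟨(g⁻¹ : GL (Fin n) F) i j, h2 i j⟩, ?_, ?_⟩, ?_⟩
    · refine Matrix.map_injective (f := (𝒪[F]).subtype) Subtype.val_injective ?_
      exact Matrix.map_mul.trans ((congrArg Units.val (mul_inv_cancel g)).trans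
        (Matrix.map_one _ (map_zero _) (map_one _)).symm)
    · refine Matrix.map_injective (f := (𝒪[F]).subtype) Subtype.val_injective ?_
      exact Matrix.map_mul.trans ((congrArg Units.val (inv_mul_cancel g)).trans
        (Matrix.map_one _ (map_zero _) (map_one _)).symm)
    · ext i j
      rfl

theorem isOpen_maxCompact : IsOpen (maxCompact F n : Set (GL (Fin n) F)) := by
  have : (maxCompact F n : Set (GL (Fin n) F)) =
      (⋂ i, ⋂ j, (fun g : GL (Fin n) F => g i j) ⁻¹' (𝒪[F] : Set F)) ∩
      ⋂ i, ⋂ j, (fun g : GL (Fin n) F => (g⁻¹ : GL (Fin n) F) i j) ⁻¹' (𝒪[F] : Set F) := by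
    ext g
    simp [mem_maxCompact]
  rw [this]
  refine IsOpen.inter ?_ ?_ <;> refine isOpen_iInter_of_finite fun i =>
    isOpen_iInter_of_finite fun j => (isOpen_integer F).preimage ?_
  · exact Units.continuous_val.matrix_elem i j
  · exact Units.continuous_coe_inv.matrix_elem i j

omit [TopologicalSpace F] [IsNonarchimedeanLocalField F] in
theorem permGL_mem_maxCompact (σ : Equiv.Perm (Fin n)) : permGL F σ ∈ maxCompact F n := by
  rw [mem_maxCompact, inv_permGL]
  constructor <;> intro i j <;> rw [permGL_apply] <;> split_ifs <;> simp [one_mem, zero_mem]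

omit [TopologicalSpace F] [IsNonarchimedeanLocalField F] in
theorem root_mem_maxCompact (i j : Fin n) {x : F} (hx : x ∈ 𝒪[F]) :
    root i j x ∈ maxCompact F n := by
  by_cases h : i = j
  · simp [root, h, one_mem]
  have : ∀ y ∈ 𝒪[F], ∀ p r, (root i j y) p r ∈ 𝒪[F] := by
    intro y hy p r
    rw [root_apply h, Matrix.one_apply]
    refine add_mem ?_ ?_ <;> split_ifs <;> simp [one_mem, zero_mem, hy]
  rw [mem_maxCompact, inv_root]
  exact ⟨this x hx, this _ (neg_mem hx)⟩

theorem continuous_of_right_invariant {X : Type*} [TopologicalSpace X] {f : GL (Fin n) F → X}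
    (hf : ∀ g, ∀ y ∈ maxCompact F n, f (g * y) = f g) : Continuous f := by
  refine IsLocallyConstant.continuous ((IsLocallyConstant.iff_exists_open _).2 fun g => ?_)
  refine ⟨(fun x => g⁻¹ * x) ⁻¹' maxCompact F n, isOpen_maxCompact.preimage (by fun_prop),
    by simp [one_mem], fun x hx => ?_⟩
  rw [← hf g _ hx, mul_inv_cancel_left]

theorem ordF_det_of_mem_maxCompact {g : GL (Fin n) F} (hg : g ∈ maxCompact F n) :
    ordF (g : Matrix (Fin n) (Fin n) F).det = 0 := by
  have h : ∀ g ∈ maxCompact F n, 0 ≤ ordF (g : Matrix (Fin n) (Fin n) F).det := by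
    rintro _ ⟨u, rfl⟩
    rw [← mem_integer_iff]
    have : ((Matrix.GeneralLinearGroup.map (n := Fin n) (𝒪[F]).subtype u : GL (Fin n) F) :
        Matrix (Fin n) (Fin n) F) = (𝒪[F]).subtype.mapMatrix (u : Matrix (Fin n) (Fin n) 𝒪[F]) :=
      rfl
    rw [this, ← RingHom.map_det]
    exact Subtype.prop _
  have h1 := h g hg
  have h2 := h _ (inv_mem hg)
  have h3 : (g : Matrix (Fin n) (Fin n) F).det *
      ((g⁻¹ : GL (Fin n) F) : Matrix (Fin n) (Fin n) F).det = 1 := by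
    rw [← Matrix.det_mul, ← Units.val_mul, mul_inv_cancel, Units.val_one, Matrix.det_one]
  have h4 := ordF_mul (left_ne_zero_of_mul_eq_one h3) (right_ne_zero_of_mul_eq_one h3)
  rw [h3, ordF_one] at h4
  omega

end MaxCompact

/-! ### Borel subgroups and the Iwasawa decomposition -/

section Iwasawa

variable {F : Type*} [Field F] {n : ℕ}

variable (F) in
/-- The group of matrices which are upper triangular for the order of the indices given by `e`. -/
def borelOf (e : Equiv.Perm (Fin n)) : Subgroup (GL (Fin n) F) where
  carrier := {g | (g : Matrix (Fin n) (Fin n) F).BlockTriangular e}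
  one_mem' := Matrix.blockTriangular_one
  mul_mem' ha hb := by
    simpa using Matrix.BlockTriangular.mul ha hb
  inv_mem' {g} hg := by
    have := (g : Matrix (Fin n) (Fin n) F).invertibleOfIsUnitDet
      ((Matrix.isUnit_iff_isUnit_det _).1 g.isUnit)
    simpa using Matrix.blockTriangular_inv_of_blockTriangular hg

theorem mem_borelOf {e : Equiv.Perm (Fin n)} {g : GL (Fin n) F} :
    g ∈ borelOf F e ↔ ∀ i j, e j < e i → g i j = 0 := Iff.rfl

theorem borelOf_mul_apply_self {e : Equiv.Perm (Fin n)} {b b' : GL (Fin n) F}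
    (hb : b ∈ borelOf F e) (hb' : b' ∈ borelOf F e) (i : Fin n) :
    (b * b' : GL (Fin n) F) i i = b i i * b' i i := by
  rw [Units.val_mul, Matrix.mul_apply]
  refine Finset.sum_eq_single i (fun j _ hj => ?_) (by simp)
  rcases lt_or_gt_of_ne (e.injective.ne hj) with h | h
  · rw [hb h, zero_mul]
  · rw [hb' h, mul_zero]

theorem borelOf_apply_self_ne_zero {e : Equiv.Perm (Fin n)} {b : GL (Fin n) F}
    (hb : b ∈ borelOf F e) (i : Fin n) : b i i ≠ 0 := by
  have := borelOf_mul_apply_self hb (inv_mem hb) i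
  rw [mul_inv_cancel, Units.val_one, Matrix.one_apply_eq] at this
  exact left_ne_zero_of_mul_eq_one this.symm

variable [ValuativeRel F] [TopologicalSpace F] [IsNonarchimedeanLocalField F]

/-- Among the entries of row `i₀` up to the diagonal, one of largest valuation is brought to the
diagonal; its quotients into the others are integral and clear the row by column operations in the
maximal compact subgroup. These operations involve only columns up to `e i₀`, where the rows already
treated vanish. -/
theorem exists_clear_row (e : Equiv.Perm (Fin n)) (i₀ : Fin n) (g : GL (Fin n) F)
    (hg : ∀ i, e i₀ < e i → ∀ j, e j < e i → g i j = 0) :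
    ∃ y ∈ maxCompact F n, ∀ i, e i₀ ≤ e i → ∀ j, e j < e i → (g * y : GL (Fin n) F) i j = 0 := by
  classical
  obtain ⟨j₀, hj₀, hmax⟩ := Finset.exists_max_image
    (Finset.univ.filter fun j => e j ≤ e i₀) (fun j => valuation F (g i₀ j)) ⟨i₀, by simp⟩
  simp only [Finset.mem_filter, Finset.mem_univ, true_and] at hj₀ hmax
  by_cases h0 : g i₀ j₀ = 0
  · refine ⟨1, one_mem _, fun i hi j hj => ?_⟩
    rw [mul_one]
    rcases hi.lt_or_eq with h | h
    · exact hg i h j hj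
    · rw [← e.injective h] at hj ⊢
      have := hmax j hj.le
      rw [h0, map_zero] at this
      simpa using this
  set h := g * permGL F (Equiv.swap i₀ j₀) with hh
  have hap : ∀ p r, h p r = g p (Equiv.swap i₀ j₀ r) := fun p r => by
    rw [hh, mul_permGL_apply, Equiv.symm_swap]
  have hsw : ∀ j i, e i₀ ≤ e i → e j < e i → e (Equiv.swap i₀ j₀ j) ≤ e i₀ ∨
      e (Equiv.swap i₀ j₀ j) < e i := by
    intro j i hi hj
    by_cases h1 : j = i₀
    · left; rw [h1, Equiv.swap_apply_left]; exact hj₀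
    · by_cases h2 : j = j₀
      · left; rw [h2, Equiv.swap_apply_right]
      · right; rwa [Equiv.swap_apply_of_ne_of_ne h1 h2]
  have hii : h i₀ i₀ = g i₀ j₀ := by rw [hap, Equiv.swap_apply_left]
  let c : Fin n → F := fun j => if e j < e i₀ then h i₀ j / h i₀ i₀ else 0
  have hc : ∀ j, c j ∈ 𝒪[F] := by
    intro j
    simp only [c]
    split_ifs with hj
    · change valuation F _ ≤ 1
      rw [map_div₀]
      refine div_le_one_of_le₀ ?_ zero_le
      rw [hii, hap]
      refine hmax _ ?_
      rcases hsw j i₀ le_rfl hj with h | h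
      · exact h
      · exact h.le
    · exact zero_mem _
  have hci : c i₀ = 0 := by simp [c]
  let N : Matrix (Fin n) (Fin n) F := Matrix.of fun p r => if p = i₀ then c r else 0
  have hN : N * N = 0 := by
    ext p r
    simp [N, Matrix.mul_apply, hci]
  let y : GL (Fin n) F := ⟨1 - N, 1 + N, by noncomm_ring; simp [hN], by noncomm_ring; simp [hN]⟩
  have hy : y ∈ maxCompact F n := by
    rw [mem_maxCompact]
    constructor <;> intro i j
    · change (1 - N) i j ∈ _
      rw [Matrix.sub_apply, Matrix.one_apply]
      refine sub_mem ?_ ?_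
      · split_ifs <;> simp [one_mem, zero_mem]
      · simp only [N, Matrix.of_apply]
        split_ifs <;> simp [zero_mem, hc]
    · change (1 + N) i j ∈ _
      rw [Matrix.add_apply, Matrix.one_apply]
      refine add_mem ?_ ?_
      · split_ifs <;> simp [one_mem, zero_mem]
      · simp only [N, Matrix.of_apply]
        split_ifs <;> simp [zero_mem, hc]
  refine ⟨permGL F (Equiv.swap i₀ j₀) * y, mul_mem (permGL_mem_maxCompact _) hy,
    fun i hi j hj => ?_⟩
  rw [← mul_assoc, ← hh]
  have hval : (h * y : GL (Fin n) F) i j = h i j - h i i₀ * c j := by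
    change ((h : Matrix (Fin n) (Fin n) F) * (1 - N)) i j = _
    rw [mul_sub, mul_one, Matrix.sub_apply]
    congr 1
    simp [N, Matrix.mul_apply]
  rw [hval]
  rcases hi.lt_or_eq with h1 | h1
  · have h2 : ∀ j, e j < e i → h i j = 0 := by
      intro j hj
      rw [hap]
      refine hg i h1 _ ?_
      rcases hsw j i hi hj with h | h
      · exact h.trans_lt h1
      · exact h
    rw [h2 j hj, h2 i₀ h1, zero_mul, sub_zero]
  · rw [← e.injective h1] at hj ⊢
    simp only [c, if_pos hj]
    have : h i₀ i₀ ≠ 0 := by rwa [hii]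
    field_simp
    ring

theorem exists_iwasawa (e : Equiv.Perm (Fin n)) (g : GL (Fin n) F) :
    ∃ b ∈ borelOf F e, ∃ y ∈ maxCompact F n, g = b * y := by
  -- `m` counts the cleared rows, starting from the last one in the order `e`.
  have key : ∀ m : ℕ, m ≤ n → ∃ y ∈ maxCompact F n,
      ∀ i, n - m ≤ (e i : ℕ) → ∀ j, e j < e i → (g * y : GL (Fin n) F) i j = 0 := by
    intro m
    induction m with
    | zero => exact fun _ => ⟨1, one_mem _, fun i hi => absurd (e i).2 (by omega)⟩
    | succ m ih =>
      intro hm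
      obtain ⟨y, hy, h⟩ := ih (by omega)
      obtain ⟨y', hy', h'⟩ := exists_clear_row e (e.symm ⟨n - (m + 1), by omega⟩) (g * y)
        fun i hi j hj => h i (by simp [Fin.lt_def] at hi; omega) j hj
      refine ⟨y * y', mul_mem hy hy', fun i hi j hj => ?_⟩
      rw [← mul_assoc]
      exact h' i (by simpa [Fin.le_def] using hi) j hj
  obtain ⟨y, hy, h⟩ := key n le_rfl
  exact ⟨g * y, fun i j hij => h i (by omega) j hij, y⁻¹, inv_mem hy, by group⟩

theorem ordF_apply_self_of_mem {e : Equiv.Perm (Fin n)} {b : GL (Fin n) F} (hb : b ∈ borelOf F e)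
    (hb' : b ∈ maxCompact F n) (i : Fin n) : ordF (b i i) = 0 := by
  have h1 := borelOf_mul_apply_self hb (inv_mem hb) i
  have h2 := ordF_mul (borelOf_apply_self_ne_zero hb i)
    (borelOf_apply_self_ne_zero (inv_mem hb) i)
  rw [← h1, mul_inv_cancel, Units.val_one, Matrix.one_apply_eq, ordF_one] at h2
  have h3 := mem_integer_iff.1 ((mem_maxCompact.1 hb').1 i i)
  have h4 := mem_integer_iff.1 ((mem_maxCompact.1 hb').2 i i)
  omega

/-- The unramified character of the diagonal torus with parameters `t`, as a function of the
diagonal of a matrix. -/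
def diagChar (t : Fin n → ℂ) (b : GL (Fin n) F) : ℂ := ∏ i, t i ^ ordF (b i i)

theorem diagChar_mul {t : Fin n → ℂ} (ht : ∀ i, t i ≠ 0) {e : Equiv.Perm (Fin n)}
    {b b' : GL (Fin n) F} (hb : b ∈ borelOf F e) (hb' : b' ∈ borelOf F e) :
    diagChar t (b * b') = diagChar t b * diagChar t b' := by
  simp only [diagChar, ← Finset.prod_mul_distrib]
  refine Finset.prod_congr rfl fun i _ => ?_
  rw [borelOf_mul_apply_self hb hb', ordF_mul (borelOf_apply_self_ne_zero hb i)
    (borelOf_apply_self_ne_zero hb' i), zpow_add₀ (ht i)]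

theorem diagChar_of_mem {t : Fin n → ℂ} {e : Equiv.Perm (Fin n)} {b : GL (Fin n) F}
    (hb : b ∈ borelOf F e) (hb' : b ∈ maxCompact F n) : diagChar t b = 1 := by
  simp [diagChar, ordF_apply_self_of_mem hb hb']

/-- The spherical vector of the unnormalized principal series induced from the unramified character
with parameters `t` of the Borel subgroup attached to `e`. -/
def spherical (e : Equiv.Perm (Fin n)) (t : Fin n → ℂ) (g : GL (Fin n) F) : ℂ :=
  diagChar t (exists_iwasawa e g).choose

/-- The chosen decomposition does not matter: two Borel components differ by an element of the Borel
subgroup that is also in the maximal compact subgroup, and its diagonal entries are units. -/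
theorem spherical_mul {t : Fin n → ℂ} (ht : ∀ i, t i ≠ 0) {e : Equiv.Perm (Fin n)}
    {b y : GL (Fin n) F} (hb : b ∈ borelOf F e) (hy : y ∈ maxCompact F n) :
    spherical e t (b * y) = diagChar t b := by
  obtain ⟨hb', y', hy', h⟩ := (exists_iwasawa e (b * y)).choose_spec
  set b' := (exists_iwasawa e (b * y)).choose
  have h1 : b⁻¹ * b' = y * y'⁻¹ := by
    rw [inv_mul_eq_iff_eq_mul, ← mul_assoc, h]; group
  have h2 : b' = b * (b⁻¹ * b') := by group
  change diagChar t b' = _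
  rw [h2, diagChar_mul ht hb (mul_mem (inv_mem hb) hb'),
    diagChar_of_mem (e := e) (mul_mem (inv_mem hb) hb') (h1 ▸ mul_mem hy (inv_mem hy')), mul_one]

theorem spherical_left {t : Fin n → ℂ} (ht : ∀ i, t i ≠ 0) {e : Equiv.Perm (Fin n)}
    {b : GL (Fin n) F} (hb : b ∈ borelOf F e) (g : GL (Fin n) F) :
    spherical e t (b * g) = diagChar t b * spherical e t g := by
  obtain ⟨b', hb', y, hy, rfl⟩ := exists_iwasawa e g
  rw [← mul_assoc, spherical_mul ht (mul_mem hb hb') hy, spherical_mul ht hb' hy,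
    diagChar_mul ht hb hb']

theorem spherical_right {t : Fin n → ℂ} (ht : ∀ i, t i ≠ 0) {e : Equiv.Perm (Fin n)}
    (g : GL (Fin n) F) {y : GL (Fin n) F} (hy : y ∈ maxCompact F n) :
    spherical e t (g * y) = spherical e t g := by
  obtain ⟨b', hb', y', hy', rfl⟩ := exists_iwasawa e g
  rw [mul_assoc, spherical_mul ht hb' (mul_mem hy' hy), spherical_mul ht hb' hy']

theorem spherical_of_mem {t : Fin n → ℂ} (ht : ∀ i, t i ≠ 0) {e : Equiv.Perm (Fin n)}
    {y : GL (Fin n) F} (hy : y ∈ maxCompact F n) : spherical e t y = 1 := by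
  rw [← one_mul y, spherical_mul ht (one_mem _) hy]
  simp [diagChar]

theorem continuous_spherical {t : Fin n → ℂ} (ht : ∀ i, t i ≠ 0) (e : Equiv.Perm (Fin n)) :
    Continuous (spherical e t : GL (Fin n) F → ℂ) :=
  continuous_of_right_invariant fun g _ hy => spherical_right ht g hy

/-- Reduces absolute convergence to the integral formula for positive parameters. -/
theorem norm_spherical (e : Equiv.Perm (Fin n)) (t : Fin n → ℂ) (g : GL (Fin n) F) :
    (‖spherical e t g‖ : ℂ) = spherical e (fun i => (‖t i‖ : ℂ)) g := by
  simp [spherical, diagChar]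

end Iwasawa

/-! ### Rank one intertwining integrals -/

section RankOne

open MeasureTheory

variable {F : Type*} [Field F] {n : ℕ}

/-- Exchanging two adjacent positions changes the relative order of that pair only. -/
theorem swap_trans_lt_iff {e : Equiv.Perm (Fin n)} {a b : Fin n} (hab : (e b : ℕ) = e a + 1)
    {i j : Fin n} (h1 : ¬ (i = a ∧ j = b)) (h2 : ¬ (i = b ∧ j = a)) :
    (Equiv.swap a b).trans e i < (Equiv.swap a b).trans e j ↔ e i < e j := by
  have hv : ∀ x, ((Equiv.swap a b).trans e x : ℕ) =
      if x = a then (e b : ℕ) else if x = b then (e a : ℕ) else e x := by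
    intro x
    rw [Equiv.trans_apply, Equiv.swap_apply_def]
    split_ifs <;> rfl
  have hinj : ∀ x y, x ≠ y → (e x : ℕ) ≠ e y := fun x y h h' => h (e.injective (Fin.ext h'))
  rw [Fin.lt_def, Fin.lt_def, hv, hv]
  by_cases q1 : i = a
  · by_cases q3 : j = a
    · simp [q1, q3]
    · have q4 : j ≠ b := fun h => h1 ⟨q1, h⟩
      have := hinj j b q4
      have := hinj j a q3
      rw [if_pos q1, if_neg q3, if_neg q4, q1]
      omega
  by_cases q2 : i = b
  · by_cases q4 : j = b
    · simp [q2, q4]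
    · have q3 : j ≠ a := fun h => h2 ⟨q2, h⟩
      have := hinj j b q4
      have := hinj j a q3
      rw [if_neg q1, if_pos q2, if_neg q3, if_neg q4, q2]
      omega
  have := hinj i a q1
  have := hinj i b q2
  rw [if_neg q1, if_neg q2]
  split_ifs with q3 q4
  · rw [q3]; omega
  · rw [q4]; omega
  · rfl

theorem swap_trans_right_lt_left {e : Equiv.Perm (Fin n)} {a b : Fin n}
    (hab : (e b : ℕ) = e a + 1) :
    (Equiv.swap a b).trans e b < (Equiv.swap a b).trans e a := by
  simp [Fin.lt_def, hab]

theorem apply_eq_zero_of_mem_borelOf_swap {e : Equiv.Perm (Fin n)} {a b : Fin n}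
    (hab : (e b : ℕ) = e a + 1) {h : GL (Fin n) F}
    (hh : h ∈ borelOf F ((Equiv.swap a b).trans e)) {i j : Fin n} (hij : e j < e i)
    (hne : ¬ (i = b ∧ j = a)) : h i j = 0 := by
  refine hh ((swap_trans_lt_iff hab (fun h => hne h.symm) ?_).2 hij)
  rintro ⟨rfl, rfl⟩
  rw [Fin.lt_def] at hij
  omega

/-- The left root element leaves a single entry violating the order `e`, namely `h b a + x * h a a`
at `(b, a)`. The right factor cancels it by a column operation, and `h a b = 0` keeps the diagonal
unchanged. -/
theorem root_mul_mul_root {e : Equiv.Perm (Fin n)} {a b : Fin n} (hab : (e b : ℕ) = e a + 1)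
    {h : GL (Fin n) F} (hh : h ∈ borelOf F ((Equiv.swap a b).trans e)) (x : F) :
    root b a x * h * root b a (-(h a a / h b b * x + h b a / h b b)) ∈ borelOf F e ∧
    ∀ i, (root b a x * h * root b a (-(h a a / h b b * x + h b a / h b b)) : GL (Fin n) F) i i =
      h i i := by
  have hne : b ≠ a := by rintro rfl; omega
  have hb0 := borelOf_apply_self_ne_zero hh b
  have hz : h a b = 0 := hh (swap_trans_right_lt_left hab)
  have hzero := fun {i j : Fin n} => apply_eq_zero_of_mem_borelOf_swap hab hh (i := i) (j := j)
  have hinj : ∀ i j, (e i : ℕ) = e j → i = j := fun i j h => e.injective (Fin.ext h)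
  constructor
  · intro p r hpr
    rw [mul_root_apply hne, root_mul_apply hne, root_mul_apply hne, hz, mul_zero]
    by_cases hp : p = b
    · subst hp
      by_cases hr : r = a
      · subst hr
        simp only [if_true]
        field_simp
        ring
      · have h1 : e r < e a := by
          have := hinj r a
          simp only [Fin.lt_def] at hpr ⊢
          omega
        rw [hzero hpr (by tauto), hzero h1 (by tauto)]
        simp [hr]
    · rw [hzero hpr (by tauto)]
      by_cases hr : r = a
      · subst hr
        have h1 : e b < e p := by
          have := hinj p b
          simp only [Fin.lt_def] at hpr ⊢
          omega
        rw [hzero h1 (by tauto)]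
        simp [hp]
      · simp [hp, hr]
  · intro i
    rw [mul_root_apply hne, root_mul_apply hne, root_mul_apply hne, hz]
    by_cases hi : i = b
    · subst hi
      simp [hne, hz]
    · by_cases hi' : i = a
      · subst hi'
        simp [hi, hz]
      · simp [hi, hi']

/-- The explicit Iwasawa decomposition in `GL₂`: when `z` is not integral, `z⁻¹` is, so the factors
multiplied on the right lie in the maximal compact subgroup. -/
theorem root_mul_root_mul_swap {e : Equiv.Perm (Fin n)} {a b : Fin n} (hab : (e b : ℕ) = e a + 1)
    {z : F} (hz : z ≠ 0) :
    root b a z * root a b (-z⁻¹) * permGL F (Equiv.swap a b) ∈ borelOf F e ∧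
    ∀ i, (root b a z * root a b (-z⁻¹) * permGL F (Equiv.swap a b) : GL (Fin n) F) i i =
      if i = a then -z⁻¹ else if i = b then z else 1 := by
  have hne : b ≠ a := by rintro rfl; omega
  constructor
  · intro p r hpr
    rw [mul_permGL_apply, Equiv.symm_swap, mul_root_apply hne.symm, root_apply hne, root_apply hne,
      Equiv.swap_apply_def]
    simp only [Fin.lt_def] at hpr
    by_cases hra : r = a
    · subst hra
      by_cases hp : p = b
      · subst hp
        simp [Matrix.one_apply, hne, hz]
      · have : p ≠ r := by rintro rfl; omega
        simp [hp, this]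
    · by_cases hrb : r = b
      · subst hrb
        have h1 : p ≠ a := by rintro rfl; omega
        have h2 : p ≠ r := by rintro rfl; omega
        simp [hne, hne.symm, h1, h2]
      · have h1 : p ≠ r := by rintro rfl; omega
        simp [hra, hrb, h1]
  · intro i
    rw [mul_permGL_apply, Equiv.symm_swap, mul_root_apply hne.symm, root_apply hne, root_apply hne,
      Equiv.swap_apply_def]
    by_cases hra : i = a
    · subst hra
      simp [hne.symm]
    · by_cases hrb : i = b
      · subst hrb
        simp [hne, hne.symm]
      · simp [Matrix.one_apply, hra, hrb]

variable [ValuativeRel F] [TopologicalSpace F] [IsNonarchimedeanLocalField F]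

theorem spherical_root {e : Equiv.Perm (Fin n)} {a b : Fin n} (hab : (e b : ℕ) = e a + 1)
    {t : Fin n → ℂ} (ht : ∀ i, t i ≠ 0) (z : F) :
    spherical e t (root b a z) = poleFun (t a / t b) z := by
  have hne : a ≠ b := by rintro rfl; omega
  by_cases hz : z ∈ 𝒪[F]
  · rw [poleFun_of_mem hz, spherical_of_mem ht (root_mem_maxCompact _ _ hz)]
  · have hz0 : z ≠ 0 := fun h => hz (h ▸ zero_mem _)
    obtain ⟨h1, h2⟩ := root_mul_root_mul_swap hab hz0
    have hz1 : z⁻¹ ∈ 𝒪[F] := by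
      rw [mem_integer_iff] at hz ⊢
      rw [ordF_inv]; omega
    have h3 : root b a z = (root b a z * root a b (-z⁻¹) * permGL F (Equiv.swap a b)) *
        (root a b (-z⁻¹) * permGL F (Equiv.swap a b))⁻¹ := by group
    rw [poleFun_of_notMem hz, h3, spherical_mul ht h1 (inv_mem (mul_mem
      (root_mem_maxCompact _ _ (neg_mem hz1)) (permGL_mem_maxCompact _))), diagChar]
    simp only [h2]
    rw [Fintype.prod_eq_mul a b hne]
    · simp [hne.symm, div_eq_mul_inv, mul_zpow, mul_comm]
    · rintro i ⟨hi, hi'⟩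
      simp [hi, hi']

/-- The unnormalized parameters attached to the normalized parameters `T` and the order `e`. -/
def unnormalized (F : Type*) [Field F] [ValuativeRel F] [TopologicalSpace F]
    [IsNonarchimedeanLocalField F] (e : Equiv.Perm (Fin n))
    (T : Fin n → ℂ) (i : Fin n) : ℂ := T i * (q F : ℂ) ^ (e i : ℕ)

variable (F) in
theorem unnormalized_ne_zero (e : Equiv.Perm (Fin n)) {T : Fin n → ℂ}
    (hT : ∀ i, T i ≠ 0) (i : Fin n) : unnormalized F e T i ≠ 0 :=
  mul_ne_zero (hT i) (pow_ne_zero _ (by exact_mod_cast NeZero.ne (q F)))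

/-- All dependence on `x` is an affine substitution in `poleFun`, so the rank one integral becomes
an integral over `F`. -/
theorem spherical_root_mul {e : Equiv.Perm (Fin n)} {a b : Fin n} (hab : (e b : ℕ) = e a + 1)
    {t : Fin n → ℂ} (ht : ∀ i, t i ≠ 0) {h y : GL (Fin n) F}
    (hh : h ∈ borelOf F ((Equiv.swap a b).trans e)) (hy : y ∈ maxCompact F n) (x : F) :
    spherical e t (root b a x * (h * y)) =
      diagChar t h * poleFun (t a / t b) (h a a / h b b * x + h b a / h b b) := by
  obtain ⟨h1, h2⟩ := root_mul_mul_root hab hh x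
  set z := h a a / h b b * x + h b a / h b b
  have h3 : root b a x * (h * y) = (root b a x * h * root b a (-z)) * (root b a z * y) := by
    rw [← inv_root]; group
  rw [h3, spherical_left ht h1, spherical_right ht _ hy, spherical_root hab ht]
  simp [diagChar, h2]

/-- The factor of the Gindikin–Karpelevich formula attached to a root. -/
def gkFactor (F : Type*) [Field F] [ValuativeRel F] [TopologicalSpace F]
    [IsNonarchimedeanLocalField F] (w : ℂ) : ℂ := (1 - w / q F) / (1 - w)

/-- With `T` fixed, the exchange multiplies the parameter at `a` by `q` and divides the one at `b`
by `q`. This is exactly the Jacobian of the affine substitution in `spherical_root_mul`. -/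
theorem diagChar_swap {e : Equiv.Perm (Fin n)} {a b : Fin n} (hab : (e b : ℕ) = e a + 1)
    (T : Fin n → ℂ) {h : GL (Fin n) F}
    (hh : h ∈ borelOf F ((Equiv.swap a b).trans e)) :
    diagChar (unnormalized F ((Equiv.swap a b).trans e) T) h =
      diagChar (unnormalized F e T) h * (q F : ℂ) ^ ordF (h a a / h b b) := by
  have hne : a ≠ b := by rintro rfl; omega
  have hq0 : (q F : ℂ) ≠ 0 := by exact_mod_cast NeZero.ne (q F)
  have h1 : ∀ i, unnormalized F ((Equiv.swap a b).trans e) T i =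
      unnormalized F e T i * if i = a then (q F : ℂ) else if i = b then (q F : ℂ)⁻¹ else 1 := by
    intro i
    unfold unnormalized
    by_cases hi : i = a
    · subst hi
      simp [hab, pow_succ, mul_assoc]
    · by_cases hi' : i = b
      · subst hi'
        simp [hab, pow_succ, hi, mul_assoc, hq0]
      · simp [hi, hi', Equiv.swap_apply_of_ne_of_ne]
  simp only [diagChar, h1, mul_zpow, Finset.prod_mul_distrib]
  congr 1
  rw [Fintype.prod_eq_mul a b hne]
  · rw [ordF_div (borelOf_apply_self_ne_zero hh a) (borelOf_apply_self_ne_zero hh b),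
      zpow_sub₀ hq0]
    simp [hne.symm, div_eq_mul_inv]
  · rintro i ⟨hi, hi'⟩
    simp [hi, hi']

variable [MeasurableSpace F] [BorelSpace F] (ν : Measure F) [ν.IsAddHaarMeasure]

/-- Since `a` and `b` are adjacent, the unnormalized ratio is `T a / T b / q`; the condition `q ‖w‖
< 1` of `integral_poleFun` then reads `‖T a‖ < ‖T b‖`. -/
theorem rank_one_integral (hν : ν 𝒪[F] = 1) {e : Equiv.Perm (Fin n)} {a b : Fin n}
    (hab : (e b : ℕ) = e a + 1) {T : Fin n → ℂ} (hT : ∀ i, T i ≠ 0) (hlt : ‖T a‖ < ‖T b‖)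
    (g : GL (Fin n) F) :
    Integrable (fun x => spherical e (unnormalized F e T) (root b a x * g)) ν ∧
    ∫ x, spherical e (unnormalized F e T) (root b a x * g) ∂ν =
      gkFactor F (T a / T b) * spherical ((Equiv.swap a b).trans e)
        (unnormalized F ((Equiv.swap a b).trans e) T) g := by
  obtain ⟨h, hh, y, hy, rfl⟩ := exists_iwasawa ((Equiv.swap a b).trans e) g
  have ht := unnormalized_ne_zero F e hT
  have hq0 : (q F : ℂ) ≠ 0 := by exact_mod_cast NeZero.ne (q F)
  have hw : unnormalized F e T a / unnormalized F e T b = T a / T b / q F := by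
    unfold unnormalized
    rw [hab, pow_succ]
    have := hT b
    field_simp
  have hd : h a a / h b b ≠ 0 :=
    div_ne_zero (borelOf_apply_self_ne_zero hh a) (borelOf_apply_self_ne_zero hh b)
  have hlt' : q F * ‖T a / T b / q F‖ < 1 := by
    rw [norm_div, norm_div, Complex.norm_natCast, mul_div_cancel₀ _ q_pos.ne']
    exact (div_lt_one (norm_pos_iff.2 (hT b))).2 hlt
  simp only [spherical_root_mul hab ht hh hy, hw]
  rw [spherical_mul (unnormalized_ne_zero F _ hT) hh hy, diagChar_swap hab T hh]
  refine ⟨(integrable_comp_mul_add ν (integrable_poleFun ν hν hlt') hd _).const_mul _, ?_⟩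
  rw [integral_const_mul, integral_comp_mul_add ν _ hd, integral_poleFun ν hν
    (div_ne_zero (div_ne_zero (hT a) (hT b)) hq0) hlt', mul_div_cancel₀ _ hq0, gkFactor]
  ring

end RankOne

/-! ### The Gindikin–Karpelevich formula -/

section GindikinKarpelevich

open MeasureTheory

variable {F : Type*} [Field F] {n : ℕ}

/-- The pairs of indices which are in increasing order for `e` and in decreasing order for `f`. -/
def inversions (e f : Equiv.Perm (Fin n)) : Finset (Fin n × Fin n) :=
  Finset.univ.filter fun p => e p.1 < e p.2 ∧ f p.2 < f p.1

theorem mem_inversions {e f : Equiv.Perm (Fin n)} {p : Fin n × Fin n} :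
    p ∈ inversions e f ↔ e p.1 < e p.2 ∧ f p.2 < f p.1 := by
  simp [inversions]

theorem eq_of_inversions_eq_empty {e f : Equiv.Perm (Fin n)} (h : inversions e f = ∅) : e = f := by
  have h1 : ∀ a b, e a < e b → f a < f b := by
    intro a b hab
    by_contra! h2
    have h3 : f b < f a := lt_of_le_of_ne h2 fun h => hab.ne (congrArg e (f.injective h)).symm
    have : (a, b) ∈ inversions e f := mem_inversions.2 ⟨hab, h3⟩
    simp [h] at this
  have h2 : ∀ a b, f a < f b → e a < e b := by
    intro a b hab
    by_contra! h3
    have h3 : e b < e a := lt_of_le_of_ne h3 fun h => hab.ne (congrArg f (e.injective h)).symm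
    exact (h1 b a h3).not_gt hab
  have m1 : StrictMono (f ∘ e.symm) := fun i j hij => h1 _ _ (by simpa)
  have m2 : StrictMono (e ∘ f.symm) := fun i j hij => h2 _ _ (by simpa)
  ext a
  refine congrArg _ (le_antisymm ?_ ?_)
  · simpa using m1.le_apply (x := e a)
  · simpa using m2.le_apply (x := f a)

/-- Without an adjacent inversion, `f ∘ e⁻¹` increases at each successor, hence is strictly
increasing, and no inversion exists at all. -/
theorem exists_adjacent_inversion {e f : Equiv.Perm (Fin n)} (h : (inversions e f).Nonempty) :
    ∃ a b, (e b : ℕ) = e a + 1 ∧ (a, b) ∈ inversions e f := by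
  obtain ⟨⟨c, d⟩, hcd⟩ := h
  by_contra! hno
  rw [mem_inversions] at hcd
  cases n with
  | zero => exact c.elim0
  | succ n =>
    have : StrictMono (f ∘ e.symm) := by
      refine Fin.strictMono_iff_lt_succ.2 fun i => ?_
      have h1 := hno (e.symm i.castSucc) (e.symm i.succ) (by simp)
      rw [mem_inversions] at h1
      simp only [Equiv.apply_symm_apply, not_and, not_lt] at h1
      refine lt_of_le_of_ne (h1 (Fin.castSucc_lt_succ)) fun h2 => ?_
      have := e.symm.injective (f.injective h2)
      exact (Fin.castSucc_lt_succ (i := i)).ne this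
    have h3 := this hcd.1
    simp only [Function.comp_apply, Equiv.symm_apply_apply] at h3
    exact h3.not_gt hcd.2

theorem inversions_swap {e f : Equiv.Perm (Fin n)} {a b : Fin n} (hab : (e b : ℕ) = e a + 1)
    (h : (a, b) ∈ inversions e f) :
    inversions ((Equiv.swap a b).trans e) f = (inversions e f).erase (a, b) := by
  rw [mem_inversions] at h
  ext ⟨i, j⟩
  rw [Finset.mem_erase, mem_inversions, mem_inversions]
  by_cases h1 : i = a ∧ j = b
  · obtain ⟨rfl, rfl⟩ := h1
    exact iff_of_false (fun h => (swap_trans_right_lt_left hab).not_gt h.1) fun h => h.1 rfl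
  · by_cases h2 : i = b ∧ j = a
    · obtain ⟨rfl, rfl⟩ := h2
      simp [h.2.not_gt]
    · rw [swap_trans_lt_iff hab h1 h2]
      simp only [ne_eq, Prod.mk.injEq, h1, not_false_eq_true, true_and]

/-- The product of the root elements attached to `α`, in order. -/
def unip {N : ℕ} (α : Fin N → Fin n × Fin n) (u : Fin N → F) : GL (Fin n) F :=
  (List.ofFn fun i => root (α i).2 (α i).1 (u i)).prod

theorem unip_zero (α : Fin 0 → Fin n × Fin n) (u : Fin 0 → F) : unip α u = 1 := by
  simp [unip]

theorem unip_cons {N : ℕ} (p : Fin n × Fin n) (α : Fin N → Fin n × Fin n) (u : Fin (N + 1) → F) :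
    unip (Fin.cons p α) u = root p.2 p.1 (u 0) * unip α (Fin.tail u) := by
  simp [unip, List.ofFn_succ, Fin.tail]

theorem continuous_unip [TopologicalSpace F] [IsTopologicalRing F] {N : ℕ}
    (α : Fin N → Fin n × Fin n) : Continuous (unip α : (Fin N → F) → GL (Fin n) F) := by
  induction N with
  | zero => simp only [funext (unip_zero α)]; fun_prop
  | succ N ih =>
    rw [← Fin.cons_self_tail α]
    simp only [funext (unip_cons (α 0) (Fin.tail α))]
    exact ((continuous_root _ _).comp (continuous_apply 0)).mul ((ih _).comp (by
      unfold Fin.tail; fun_prop))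

variable [ValuativeRel F] [TopologicalSpace F] [IsNonarchimedeanLocalField F]
variable [MeasurableSpace F] [BorelSpace F] (ν : Measure F) [ν.IsAddHaarMeasure]

/-- By Tonelli: the inner integral of the norm is the rank one integral with parameters `‖T i‖`,
hence a constant times the norm of the spherical function for the exchanged order, which is
integrable by assumption. -/
theorem integrable_prod_spherical (hν : ν 𝒪[F] = 1) {e : Equiv.Perm (Fin n)} {a b : Fin n}
    (hab : (e b : ℕ) = e a + 1) {T : Fin n → ℂ} (hT : ∀ i, T i ≠ 0) (hlt : ‖T a‖ < ‖T b‖)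
    {Y : Type*} [TopologicalSpace Y] [SecondCountableTopology Y] [MeasurableSpace Y] [BorelSpace Y]
    (ρ : Measure Y) [SFinite ρ] {G : Y → GL (Fin n) F} (hG : Continuous G)
    (hint : Integrable (fun u => spherical ((Equiv.swap a b).trans e)
        (unnormalized F ((Equiv.swap a b).trans e) T) (G u)) ρ) :
    Integrable (fun z : F × Y => spherical e (unnormalized F e T) (root b a z.1 * G z.2))
      (ν.prod ρ) := by
  have hc : Continuous fun z : F × Y =>
      spherical e (unnormalized F e T) (root b a z.1 * G z.2) :=
    (continuous_spherical (unnormalized_ne_zero F e hT) e).comp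
      (((continuous_root _ _).comp continuous_fst).mul (hG.comp continuous_snd))
  rw [integrable_prod_iff' hc.aestronglyMeasurable]
  refine ⟨.of_forall fun u => (rank_one_integral ν hν hab hT hlt (G u)).1, ?_⟩
  have hT' : ∀ i, (‖T i‖ : ℂ) ≠ 0 := fun i => by simpa using hT i
  have hun : ∀ e : Equiv.Perm (Fin n), (fun i => (‖unnormalized F e T i‖ : ℂ)) =
      unnormalized F e fun i => (‖T i‖ : ℂ) := fun e => by
    ext i; simp [unnormalized]
  refine (hint.norm.const_mul ‖gkFactor F ((‖T a‖ : ℂ) / ‖T b‖)‖).congr (.of_forall fun u => ?_)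
  have h1 := (rank_one_integral ν hν hab hT' (by simpa using hlt) (G u)).2
  simp only [← hun, ← norm_spherical] at h1
  rw [integral_complex_ofReal] at h1
  have h2 := congrArg norm h1
  rw [norm_mul, Complex.norm_real, Complex.norm_real, norm_norm, Real.norm_of_nonneg
    (integral_nonneg fun _ => norm_nonneg _)] at h2
  exact h2.symm

/-- Induction on the number of inversions: an adjacent inversion supplies the outermost root
element, and its integral leaves the problem for the exchanged order. The enumeration `α` is chosen
before `T` and `g`, so that one system of coordinates on `Z` serves for all `ζ`. -/
theorem gindikin_karpelevich (hν : ν 𝒪[F] = 1) (N : ℕ) (e f : Equiv.Perm (Fin n))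
    (hN : (inversions e f).card = N) :
    ∃ α : Fin N → Fin n × Fin n, Function.Injective α ∧
      (∀ p, p ∈ inversions e f ↔ ∃ i, α i = p) ∧
      ∀ (T : Fin n → ℂ) (g : GL (Fin n) F), (∀ i, T i ≠ 0) →
        (∀ p ∈ inversions e f, ‖T p.1‖ < ‖T p.2‖) →
        Integrable (fun u => spherical e (unnormalized F e T) (unip α u * g))
          (Measure.pi fun _ => ν) ∧
        ∫ u, spherical e (unnormalized F e T) (unip α u * g) ∂(Measure.pi fun _ => ν) =
          (∏ p ∈ inversions e f, gkFactor F (T p.1 / T p.2)) *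
            spherical f (unnormalized F f T) g := by
  induction N generalizing e with
  | zero =>
    have h0 := Finset.card_eq_zero.1 hN
    obtain rfl := eq_of_inversions_eq_empty h0
    refine ⟨Fin.elim0, fun i => i.elim0, fun p => by simp [h0], fun T g hT hlt => ?_⟩
    simp only [unip_zero, one_mul, h0, Finset.prod_empty]
    rw [Measure.pi_of_empty]
    exact ⟨integrable_dirac (by simp), by simp⟩
  | succ N ih =>
    obtain ⟨a, b, hab, hinv⟩ := exists_adjacent_inversion (Finset.card_pos.1 (by omega) :
      (inversions e f).Nonempty)
    have hsw := inversions_swap hab hinv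
    obtain ⟨α, hα, hrange, hint⟩ := ih ((Equiv.swap a b).trans e) (by
      rw [hsw, Finset.card_erase_of_mem hinv, hN]; rfl)
    have hnot : ∀ i, α i ≠ (a, b) := fun i h => by
      have := (hrange (a, b)).2 ⟨i, h⟩
      simp [hsw] at this
    refine ⟨Fin.cons (a, b) α, ?_, fun p => ?_, fun T g hT hlt => ?_⟩
    · rw [Fin.cons_injective_iff]
      exact ⟨fun ⟨i, hi⟩ => hnot i hi, hα⟩
    · rw [Fin.exists_fin_succ]
      simp only [Fin.cons_zero, Fin.cons_succ, ← hrange, hsw, Finset.mem_erase]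
      constructor
      · intro hp
        by_cases h : p = (a, b)
        · exact Or.inl h.symm
        · exact Or.inr ⟨h, hp⟩
      · rintro (rfl | h)
        · exact hinv
        · exact h.2
    · have hlt' := hlt _ hinv
      obtain ⟨h1, h2⟩ := hint T g hT fun p hp => hlt p (by
        rw [hsw] at hp; exact Finset.mem_of_mem_erase hp)
      have hc : Continuous fun u : Fin N → F => unip α u * g :=
        (continuous_unip α).mul continuous_const
      have h3 := integrable_prod_spherical ν hν hab hT hlt' (Measure.pi fun _ => ν) hc h1
      have hmp := measurePreserving_piFinSuccAbove (fun _ : Fin (N + 1) => ν) 0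
      have hfun : (fun u : Fin (N + 1) → F => spherical e (unnormalized F e T)
          (unip (Fin.cons (a, b) α) u * g)) = (fun z : F × (Fin N → F) =>
            spherical e (unnormalized F e T) (root b a z.1 * (unip α z.2 * g))) ∘
            MeasurableEquiv.piFinSuccAbove (fun _ => F) 0 := by
        ext u
        simp only [Function.comp_apply, unip_cons, mul_assoc]
        rfl
      -- Fubini, with the variable of the outermost root as the inner one.
      have h4 : ∫ z, spherical e (unnormalized F e T) (root b a z.1 * (unip α z.2 * g))
          ∂(ν.prod (Measure.pi fun _ : Fin N => ν)) = _ := integral_prod_symm _ h3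
      simp only [(rank_one_integral ν hν hab hT hlt' _).2] at h4
      rw [integral_const_mul, h2, hsw, ← mul_assoc, Finset.mul_prod_erase _
        (fun p => gkFactor F (T p.1 / T p.2)) hinv] at h4
      refine ⟨?_, ?_⟩
      · rw [hfun, hmp.integrable_comp_emb (MeasurableEquiv.measurableEmbedding _)]
        exact h3
      · rw [hfun, ← h4]
        exact hmp.integral_comp (MeasurableEquiv.measurableEmbedding _) (fun z : F × (Fin N → F) =>
            spherical e (unnormalized F e T) (root b a z.1 * (unip α z.2 * g)))

end GindikinKarpelevich

/-! ### Characters of Levi subgroups -/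

section Blocks

theorem finSigmaFinEquiv_lt {d : ℕ} (β : Fin d → ℕ) {i j : Fin d} (hij : i < j) (x : Fin (β i))
    (y : Fin (β j)) :
    (finSigmaFinEquiv ⟨i, x⟩ : ℕ) < (finSigmaFinEquiv (⟨j, y⟩ : Σ i, Fin (β i)) : ℕ) := by
  rw [finSigmaFinEquiv_apply, finSigmaFinEquiv_apply]
  let β' : ℕ → ℕ := fun m => if h : m < d then β ⟨m, h⟩ else 0
  have h : ∀ i : Fin d, ∑ m : Fin i, β (Fin.castLE i.2.le m) = ∑ m ∈ Finset.range i, β' m := by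
    intro i
    rw [← Fin.sum_univ_eq_sum_range]
    refine Finset.sum_congr rfl fun m _ => ?_
    simp only [β']
    rw [dif_pos (m.2.trans i.2)]; rfl
  have h1 : ∑ m ∈ Finset.range (i + 1), β' m ≤ ∑ m ∈ Finset.range j, β' m :=
    Finset.sum_le_sum_of_subset (Finset.range_mono hij)
  rw [Finset.sum_range_succ] at h1
  have h2 : β' i = β i := by simp [β']
  dsimp only
  rw [h, h]
  have := x.2
  omega

variable {d n : ℕ} (β : Fin d → ℕ) (h : ∑ i, β i = n)

theorem blockEquiv_lt_of_lt {i j : Fin d} (hij : i < j) (x : Fin (β i)) (y : Fin (β j)) :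
    blockEquiv β h ⟨i, x⟩ < blockEquiv β h ⟨j, y⟩ :=
  Fin.lt_def.2 (finSigmaFinEquiv_lt β hij x y)

theorem blockEquiv_lt_iff {i : Fin d} {x y : Fin (β i)} :
    blockEquiv β h ⟨i, x⟩ < blockEquiv β h ⟨i, y⟩ ↔ x < y := by
  rw [Fin.lt_def, Fin.lt_def]
  simp [blockEquiv, finSigmaFinEquiv_apply]

theorem block_lt_imp_lt {x y : Fin n}
    (hxy : ((blockEquiv β h).symm x).1 < ((blockEquiv β h).symm y).1) : x < y := by
  have := blockEquiv_lt_of_lt β h hxy ((blockEquiv β h).symm x).2 ((blockEquiv β h).symm y).2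
  simpa using this

end Blocks

/-! ### Modulus and inducing characters as unramified characters; restriction to the Borel subgroup.
-/

section LeviChar

variable {F : Type*} [Field F] [ValuativeRel F] [TopologicalSpace F]
  [IsNonarchimedeanLocalField F] {d n : ℕ} (β : Fin d → ℕ) (h : ∑ i, β i = n)

omit [ValuativeRel F] [TopologicalSpace F] [IsNonarchimedeanLocalField F] in
theorem borelOf_one_le_parabolic : borelOf F (1 : Equiv.Perm (Fin n)) ≤ parabolic F β h :=
  fun _ hb _ _ hij => hb (block_lt_imp_lt β h hij)

omit [TopologicalSpace F] [IsNonarchimedeanLocalField F] in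
theorem toLevi_mem_maxCompact {p : parabolic F β h} (hp : (p : GL (Fin n) F) ∈ maxCompact F n)
    (i : Fin d) : toLevi β h p i ∈ maxCompact F (β i) := by
  rw [mem_maxCompact] at hp ⊢
  refine ⟨fun x y => hp.1 _ _, fun x y => ?_⟩
  rw [← Pi.inv_apply, ← map_inv]
  exact hp.2 _ _

omit [ValuativeRel F] [TopologicalSpace F] [IsNonarchimedeanLocalField F] in
theorem toLevi_mem_borelOf {p : parabolic F β h} (hp : (p : GL (Fin n) F) ∈ borelOf F 1)
    (i : Fin d) : toLevi β h p i ∈ borelOf F 1 := fun _ _ hxy =>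
  hp ((blockEquiv_lt_iff β h).2 hxy)

variable {β}

/-- The unramified character of a Levi subgroup with parameters `t`. -/
def leviChar (t : Fin d → ℂ) (m : Levi F β) : ℂ :=
  ∏ i, t i ^ ord (Matrix.GeneralLinearGroup.det (m i))

theorem leviChar_of_mem {t : Fin d → ℂ} {m : Levi F β} (hm : ∀ i, m i ∈ maxCompact F (β i)) :
    leviChar t m = 1 :=
  Finset.prod_eq_one fun i _ => by
    rw [ord_eq_ordF, Matrix.GeneralLinearGroup.val_det_apply, ordF_det_of_mem_maxCompact (hm i),
      zpow_zero]

theorem zpow_ordF_prod {ι : Type*} (s : Finset ι) {a : ℂ} (ha : a ≠ 0) {f : ι → F}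
    (hf : ∀ i ∈ s, f i ≠ 0) : a ^ ordF (∏ i ∈ s, f i) = ∏ i ∈ s, a ^ ordF (f i) := by
  classical
  induction s using Finset.induction_on with
  | empty => simp
  | insert i s hi ih =>
    have h1 : ∀ j ∈ s, f j ≠ 0 := fun j hj => hf j (Finset.mem_insert_of_mem hj)
    rw [Finset.prod_insert hi, Finset.prod_insert hi, ordF_mul (hf i (Finset.mem_insert_self _ _))
      (Finset.prod_ne_zero_iff.2 h1), zpow_add₀ ha, ih h1]

theorem leviChar_toLevi {t : Fin d → ℂ} (ht : ∀ i, t i ≠ 0) {p : parabolic F β h}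
    (hp : (p : GL (Fin n) F) ∈ borelOf F 1) :
    leviChar t (toLevi β h p) = diagChar (fun a => t ((blockEquiv β h).symm a).1) (p : GL (Fin n) F) := by
  rw [diagChar, ← (blockEquiv β h).prod_comp, Fintype.prod_sigma, leviChar]
  refine Finset.prod_congr rfl fun i _ => ?_
  have h1 : (toLevi β h p i : Matrix (Fin (β i)) (Fin (β i)) F).BlockTriangular id :=
    toLevi_mem_borelOf β h hp i
  rw [ord_eq_ordF, Matrix.GeneralLinearGroup.val_det_apply, Matrix.det_of_isUpperTriangular h1,
    zpow_ordF_prod (f := fun x => (toLevi β h p i) x x) _ (ht i) fun x _ =>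
      borelOf_apply_self_ne_zero (toLevi_mem_borelOf β h hp i) x]
  refine Finset.prod_congr rfl fun x _ => ?_
  simp only [Equiv.symm_apply_apply]
  rfl

variable (F) in
theorem q_ne_zero : (q F : ℂ) ≠ 0 := by exact_mod_cast NeZero.ne (q F)

variable (F) in
theorem q_cpow_ne_zero (s : ℂ) : (q F : ℂ) ^ s ≠ 0 := by
  simp [Complex.cpow_eq_zero_iff, q_ne_zero F]

variable (F) in
theorem q_cpow_sum {ι : Type*} (s : Finset ι) (f : ι → ℂ) :
    (q F : ℂ) ^ ∑ i ∈ s, f i = ∏ i ∈ s, (q F : ℂ) ^ f i := by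
  classical
  induction s using Finset.induction_on with
  | empty => simp
  | insert i s hi ih =>
    rw [Finset.sum_insert hi, Finset.prod_insert hi, Complex.cpow_add _ _ (q_ne_zero F), ih]

theorem zpow_q_cpow (N : ℤ) (s : ℂ) : (((q F : ℝ) ^ N : ℝ) : ℂ) ^ s = (q F : ℂ) ^ (s * N) := by
  have h0 : (q F : ℝ) ^ N ≠ 0 := (zpow_pos q_pos _).ne'
  rw [Complex.cpow_def_of_ne_zero (by exact_mod_cast h0),
    Complex.cpow_def_of_ne_zero (q_ne_zero F), ← Complex.ofReal_log (zpow_pos q_pos _).le,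
    Real.log_zpow, ← Complex.natCast_log]
  congr 1
  push_cast
  ring

theorem leviChar_cpow (z : Fin d → ℂ) (m : Levi F β) :
    leviChar (fun i => (q F : ℂ) ^ z i) m =
      (q F : ℂ) ^ ∑ i, z i * ord (Matrix.GeneralLinearGroup.det (m i)) := by
  rw [q_cpow_sum]
  refine Finset.prod_congr rfl fun i _ => ?_
  rw [Complex.cpow_mul_int]

theorem absChar_eq (s : ℂ) (x : Fˣ) : absChar s x = ((q F : ℂ) ^ (-s)) ^ ord x := by
  change ((nabs x : ℝ) : ℂ) ^ s = _
  rw [nabs, zpow_q_cpow, ← Complex.cpow_mul_int]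
  congr 1
  push_cast
  ring

theorem modulus_eq (m : Levi F β) :
    modulus β m = (q F : ℝ) ^ ∑ i, ∑ j, if i < j then
      -ord (Matrix.GeneralLinearGroup.det (m i)) * β j +
        ord (Matrix.GeneralLinearGroup.det (m j)) * β i else 0 := by
  have hz : ∀ {ι : Type} (s : Finset ι) (f : ι → ℤ),
      (q F : ℝ) ^ ∑ i ∈ s, f i = ∏ i ∈ s, (q F : ℝ) ^ f i := by
    classical
    intro ι s f
    induction s using Finset.induction_on with
    | empty => simp
    | insert i s hi ih => rw [Finset.sum_insert hi, Finset.prod_insert hi, zpow_add₀ q_pos.ne', ih]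
  rw [hz, modulus]
  refine Finset.prod_congr rfl fun i _ => ?_
  rw [hz]
  refine Finset.prod_congr rfl fun j _ => ?_
  split_ifs
  · rw [zpow_add₀ q_pos.ne', nabs, nabs, ← zpow_mul, ← zpow_mul]
    congr 2
    ring
  · simp

/-- Regroups the product over pairs of blocks by block: block `i` receives the sizes of the later
blocks with one sign and of the earlier ones with the other. -/
theorem modulusPow_eq (s : ℂ) (m : Levi F β) :
    modulusPow β s m = leviChar (fun i => (q F : ℂ) ^
      (-s * ∑ j, ((if i < j then (β j : ℂ) else 0) - if j < i then (β j : ℂ) else 0))) m := by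
  change ((modulus β m : ℝ) : ℂ) ^ s = _
  rw [modulus_eq, zpow_q_cpow, leviChar_cpow]
  congr 1
  push_cast
  have h1 : ∑ i, ∑ j, (if i < j then (ord (Matrix.GeneralLinearGroup.det (m j)) : ℂ) * β i else 0) =
      ∑ i, ∑ j, if j < i then (ord (Matrix.GeneralLinearGroup.det (m i)) : ℂ) * β j else 0 :=
    Finset.sum_comm
  have h2 : ∀ i j, (if i < j then -(ord (Matrix.GeneralLinearGroup.det (m i)) : ℂ) * β j +
        (ord (Matrix.GeneralLinearGroup.det (m j)) : ℂ) * β i else 0) =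
      (if i < j then -(ord (Matrix.GeneralLinearGroup.det (m i)) : ℂ) * β j else 0) +
      (if i < j then (ord (Matrix.GeneralLinearGroup.det (m j)) : ℂ) * β i else 0) := by
    intro i j; split_ifs <;> simp
  simp only [h2, Finset.sum_add_distrib]
  rw [h1, ← Finset.sum_add_distrib, Finset.mul_sum]
  refine Finset.sum_congr rfl fun i _ => ?_
  rw [← Finset.sum_add_distrib, Finset.mul_sum, Finset.mul_sum, Finset.sum_mul]
  refine Finset.sum_congr rfl fun j _ => ?_
  split_ifs <;> ring

theorem leviChar_mul (t t' : Fin d → ℂ) (m : Levi F β) :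
    leviChar t m * leviChar t' m = leviChar (fun i => t i * t' i) m := by
  simp only [leviChar, mul_zpow, Finset.prod_mul_distrib]

theorem ord_zpow (x : Fˣ) (m : ℤ) : ord (x ^ m) = m * ord x := by
  simp [ord, WithZero.log_zpow]

theorem IsUnramified.apply_eq {χ : Fˣ →* ℂˣ} (hχ : IsUnramified χ) {ϖ : Fˣ} (hϖ : ord ϖ = 1)
    (x : Fˣ) : χ x = χ ϖ ^ ord x := by
  have h1 := hχ (ϖ ^ (-ord x) * x) (by rw [ord_mul, ord_zpow, hϖ]; ring)
  rw [map_mul, map_zpow, zpow_neg, inv_mul_eq_one] at h1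
  exact h1.symm

variable {k : ℕ} {τ : Fin k → Fˣ →* ℂˣ} (ζ : Fin k → ℂ)

theorem indChar_eq (hτ : ∀ i, IsUnramified (τ i)) {ϖ : Fˣ} (hϖ : ord ϖ = 1) (c : ℕ)
    (m : Levi F (constComp k c)) :
    indChar τ ζ c m = leviChar (fun i => (q F : ℂ) ^ (-ζ i) * (τ i ϖ : ℂ)) m := by
  simp only [indChar, leviChar, MonoidHom.coe_mk, OneHom.coe_mk]
  refine Finset.prod_congr rfl fun i _ => ?_
  rw [absChar_eq, mul_zpow, (hτ i).apply_eq hϖ (Matrix.GeneralLinearGroup.det (m i))]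
  simp

theorem sum_constComp_signs (c : ℕ) (i : Fin k) :
    ∑ j, ((if i < j then (constComp k c j : ℂ) else 0) -
      if j < i then (constComp k c j : ℂ) else 0) = c * (k - 1 - 2 * (i : ℕ)) := by
  simp only [constComp]
  rw [Finset.sum_sub_distrib, ← Finset.sum_filter, ← Finset.sum_filter, Finset.sum_const,
    Finset.sum_const, Finset.filter_lt_eq_Ioi, Finset.filter_gt_eq_Iio, Fin.card_Ioi, Fin.card_Iio,
    nsmul_eq_mul, nsmul_eq_mul]
  have h1 : ((k - 1 - (i : ℕ) : ℕ) : ℂ) = k - 1 - (i : ℕ) := by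
    have := i.2
    rw [Nat.cast_sub (by omega), Nat.cast_sub (by omega), Nat.cast_one]
  rw [h1]
  ring

/-- The unramified parameter of the `i`-th block in `ρ_c(τ_ζ)`, modulus character included. -/
def blockParam (τ : Fin k → Fˣ →* ℂˣ) (ϖ : Fˣ) (c : ℕ) (ζ : Fin k → ℂ) (i : Fin k) : ℂ :=
  (q F : ℂ) ^ (-(c * (k - 1 - 2 * (i : ℕ)) / 2 : ℂ)) * ((q F : ℂ) ^ (-ζ i) * (τ i ϖ : ℂ))

theorem blockParam_ne_zero (τ : Fin k → Fˣ →* ℂˣ) (ϖ : Fˣ) (c : ℕ) (ζ : Fin k → ℂ) (i : Fin k) :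
    blockParam τ ϖ c ζ i ≠ 0 :=
  mul_ne_zero (q_cpow_ne_zero F _) (mul_ne_zero (q_cpow_ne_zero F _) (Units.ne_zero _))

theorem modulusPow_mul_indChar (hτ : ∀ i, IsUnramified (τ i)) {ϖ : Fˣ} (hϖ : ord ϖ = 1) (c : ℕ)
    (m : Levi F (constComp k c)) :
    modulusPow (constComp k c) (1 / 2) m * indChar τ ζ c m =
      leviChar (blockParam τ ϖ c ζ) m := by
  rw [modulusPow_eq, indChar_eq ζ hτ hϖ, leviChar_mul]
  congr 1
  ext i
  rw [sum_constComp_signs, blockParam]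
  congr 2
  ring

theorem unramifiedSection_mul (hτ : ∀ i, IsUnramified (τ i)) {c : ℕ}
    (p : parabolic F (constComp k c) (sum_constComp k c)) {y : GL (Fin (k * c)) F}
    (hy : y ∈ maxCompact F (k * c)) :
    unramifiedSection τ c ζ (p * y) =
      modulusPow (constComp k c) (1 / 2) (toLevi _ _ p) * indChar τ ζ c (toLevi _ _ p) := by
  obtain ⟨ϖ₀, h0, h1⟩ := exists_ordF_eq_one F
  have hϖ : ord (Units.mk0 ϖ₀ h0) = 1 := h1
  have hg : ∃ p' : parabolic F (constComp k c) (sum_constComp k c),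
      ∃ y' ∈ maxCompact F (k * c), (p * y : GL (Fin (k * c)) F) = p' * y' := ⟨p, y, hy, rfl⟩
  rw [unramifiedSection, dif_pos hg]
  obtain ⟨y', hy', h2⟩ := hg.choose_spec
  set p' := hg.choose
  have h3 : ((p⁻¹ * p' : parabolic F (constComp k c) (sum_constComp k c)) : GL (Fin (k * c)) F) ∈
      maxCompact F (k * c) := by
    have : ((p⁻¹ * p' : parabolic F (constComp k c) (sum_constComp k c)) : GL (Fin (k * c)) F) =
        y * y'⁻¹ := by
      rw [Subgroup.coe_mul, Subgroup.coe_inv, inv_mul_eq_iff_eq_mul, ← mul_assoc, h2]; group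
    rw [this]
    exact mul_mem hy (inv_mem hy')
  have h4 : p' = p * (p⁻¹ * p') := by group
  have h5 := modulusPow_mul_indChar ζ hτ hϖ c (toLevi _ _ (p⁻¹ * p'))
  rw [leviChar_of_mem (toLevi_mem_maxCompact _ _ h3)] at h5
  rw [h4, map_mul (toLevi _ _), map_mul (modulusPow _ _), map_mul (indChar _ _ _), mul_mul_mul_comm,
    h5, mul_one]

theorem exists_parabolic_mul (g : GL (Fin n) F) :
    ∃ p : parabolic F β h, (p : GL (Fin n) F) ∈ borelOf F 1 ∧ ∃ y ∈ maxCompact F n, g = p * y := by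
  obtain ⟨b, hb, y, hy, hg⟩ := exists_iwasawa 1 g
  exact ⟨⟨b, borelOf_one_le_parabolic β h hb⟩, hb, y, hy, hg⟩

theorem charRep_apply {G : Type*} [Monoid G] (χ : G →* ℂ) (g : G) (v : ℂ) :
    charRep χ g v = χ g * v := rfl

theorem isNormalizedUnramifiedVector_unramifiedSection (hτ : ∀ i, IsUnramified (τ i)) (c : ℕ) :
    IsNormalizedUnramifiedVector τ ζ c (unramifiedSection τ c ζ) := by
  have hright : ∀ g, ∀ y ∈ maxCompact F (k * c),
      unramifiedSection τ c ζ (g * y) = unramifiedSection τ c ζ g := by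
    intro g y hy
    obtain ⟨p, -, y', hy', rfl⟩ := exists_parabolic_mul (sum_constComp k c) g
    rw [mul_assoc, unramifiedSection_mul ζ hτ p (mul_mem hy' hy), unramifiedSection_mul ζ hτ p hy']
  refine ⟨⟨fun p g => ?_, maxCompact F (k * c), isOpen_maxCompact, fun g y hy => hright g y hy⟩,
    hright, ?_⟩
  · obtain ⟨p', -, y', hy', rfl⟩ := exists_parabolic_mul (sum_constComp k c) g
    rw [← mul_assoc, ← Subgroup.coe_mul, unramifiedSection_mul ζ hτ _ hy',
      unramifiedSection_mul ζ hτ _ hy', charRep_apply, map_mul (toLevi _ _),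
      map_mul (modulusPow _ _), map_mul (indChar _ _ _), smul_eq_mul]
    ring
  · have := unramifiedSection_mul ζ hτ (c := c) 1 (one_mem (maxCompact F (k * c)))
    rw [Subgroup.coe_one, mul_one, map_one (toLevi _ _), map_one (modulusPow _ _),
      map_one (indChar _ _ _), mul_one] at this
    exact this

/-- By the Iwasawa decomposition the parabolic component may be taken in the Borel subgroup, where
the character of the Levi subgroup is a diagonal character constant on blocks. -/
theorem unramifiedSection_eq_spherical (hτ : ∀ i, IsUnramified (τ i)) {ϖ : Fˣ} (hϖ : ord ϖ = 1)
    (c : ℕ) : unramifiedSection τ c ζ = spherical 1 fun a =>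
      blockParam τ ϖ c ζ ((blockEquiv (constComp k c) (sum_constComp k c)).symm a).1 := by
  ext g
  obtain ⟨p, hp, y, hy, rfl⟩ := exists_parabolic_mul (sum_constComp k c) g
  rw [unramifiedSection_mul ζ hτ p hy, spherical_mul (fun _ => blockParam_ne_zero _ _ _ _ _) hp hy,
    modulusPow_mul_indChar ζ hτ hϖ, leviChar_toLevi _ (blockParam_ne_zero _ _ _ _) hp]

end LeviChar

/-! ### The group `Z` as a product of root subgroups -/

section Shuffle

variable (k l r : ℕ)

/-- The permutation underlying `κ`, from the block order `(l, …, l, r, …, r)` to the block order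
`(l+r, …, l+r)`. -/
def kappaPerm : Equiv.Perm (Fin (k * (l + r))) :=
  (tallIdx k l r).symm.trans
    ((Equiv.prodSumDistrib (Fin k) (Fin l) (Fin r)).symm.trans (wideIdx k l r))

/-- The permutation reversing the order of the blocks of size `l+r`. -/
def blockRev : Equiv.Perm (Fin (k * (l + r))) :=
  (wideIdx k l r).symm.trans ((Fin.revPerm.prodCongr (Equiv.refl _)).trans (wideIdx k l r))

variable {k l r}

theorem wideIdx_inl_val (i : Fin k) (x : Fin l) :
    (wideIdx k l r (i, Sum.inl x) : ℕ) = x + (l + r) * i := rfl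

theorem wideIdx_inr_val (i : Fin k) (x : Fin r) :
    (wideIdx k l r (i, Sum.inr x) : ℕ) = l + x + (l + r) * i := rfl

theorem kappaPerm_symm_wideIdx_inl (i : Fin k) (x : Fin l) :
    (kappaPerm k l r).symm (wideIdx k l r (i, Sum.inl x)) =
      tallIdx k l r (Sum.inl (i, x)) := by
  rw [Equiv.symm_apply_eq]
  simp [kappaPerm]

theorem kappaPerm_symm_wideIdx_inr (i : Fin k) (x : Fin r) :
    (kappaPerm k l r).symm (wideIdx k l r (i, Sum.inr x)) =
      tallIdx k l r (Sum.inr (i, x)) := by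
  rw [Equiv.symm_apply_eq]
  simp [kappaPerm]

theorem tallIdx_inl_val (i : Fin k) (x : Fin l) :
    (tallIdx k l r (Sum.inl (i, x)) : ℕ) = x + l * i := rfl

theorem tallIdx_inr_val (i : Fin k) (x : Fin r) :
    (tallIdx k l r (Sum.inr (i, x)) : ℕ) = k * l + (x + r * i) := rfl

theorem add_mul_lt_iff {c x y i j : ℕ} (hx : x < c) (hy : y < c) :
    x + c * i < y + c * j ↔ i < j ∨ i = j ∧ x < y := by
  rcases lt_trichotomy i j with h | rfl | h
  · have : c * (i + 1) ≤ c * j := Nat.mul_le_mul_left c h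
    rw [mul_add] at this
    constructor
    · intro; exact Or.inl h
    · intro; omega
  · simp
  · have : c * (j + 1) ≤ c * i := Nat.mul_le_mul_left c h
    rw [mul_add] at this
    constructor
    · intro; omega
    · intro; omega

/-- `κ⁻¹` puts all left parts (size `l`) before all right parts (size `r`) and keeps the order
within each kind. Only a right part preceding a left part is reversed, and these lie in different
blocks. -/
theorem mem_inversions_kappaPerm {a b : Fin (k * (l + r))} :
    (a, b) ∈ inversions 1 (kappaPerm k l r).symm ↔
      ((wideIdx k l r).symm a).1 < ((wideIdx k l r).symm b).1 ∧
        ((wideIdx k l r).symm a).2.isRight ∧ ((wideIdx k l r).symm b).2.isLeft := by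
  obtain ⟨⟨i, s⟩, rfl⟩ := (wideIdx k l r).surjective a
  obtain ⟨⟨j, t⟩, rfl⟩ := (wideIdx k l r).surjective b
  rw [mem_inversions, Equiv.symm_apply_apply, Equiv.symm_apply_apply, Equiv.Perm.one_apply,
    Equiv.Perm.one_apply]
  rcases s with x | x <;> rcases t with y | y <;>
    simp only [kappaPerm_symm_wideIdx_inl, kappaPerm_symm_wideIdx_inr, Fin.lt_def,
      wideIdx_inl_val, wideIdx_inr_val, tallIdx_inl_val, tallIdx_inr_val, Sum.isRight_inl,
      Sum.isRight_inr, Sum.isLeft_inl, Sum.isLeft_inr]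
  · rw [add_mul_lt_iff (by omega) (by omega), add_mul_lt_iff y.2 x.2]
    simp only [Bool.false_eq_true, false_and, and_false, iff_false]
    omega
  · have h1 : l * ((i : ℕ) + 1) ≤ l * k := Nat.mul_le_mul_left l i.2
    rw [mul_add, mul_comm l k] at h1
    have := x.2
    simp only [Bool.false_eq_true, and_false, iff_false]
    omega
  · have h1 : l * ((j : ℕ) + 1) ≤ l * k := Nat.mul_le_mul_left l j.2
    rw [mul_add, mul_comm l k] at h1
    have := y.2
    rw [add_mul_lt_iff (by omega) (by omega)]
    simp only [and_true]
    omega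
  · rw [add_mul_lt_iff (by omega) (by omega), Nat.add_lt_add_iff_left, Nat.add_lt_add_iff_left,
      add_mul_lt_iff y.2 x.2]
    simp only [Bool.false_eq_true, and_false, iff_false]
    omega

theorem isV2Position_blockRev {p p' : Fin (k * (l + r))} :
    IsV2Position k l r (blockRev k l r p) (blockRev k l r p') ↔
      (p', p) ∈ inversions 1 (kappaPerm k l r).symm := by
  rw [mem_inversions_kappaPerm, IsV2Position]
  simp only [blockRev, Equiv.trans_apply, Equiv.symm_apply_apply, Equiv.prodCongr_apply,
    Prod.map_fst, Prod.map_snd, Fin.revPerm_apply, Fin.rev_lt_rev, Equiv.refl_apply]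
  tauto

/-- Inversions cannot be chained, since the middle index would lie in both a left and a right part.
Hence products of the corresponding elementary matrices vanish, and `Z` is commutative. -/
theorem inversions_kappaPerm_not_trans {a b c : Fin (k * (l + r))}
    (h : (a, b) ∈ inversions 1 (kappaPerm k l r).symm) :
    (b, c) ∉ inversions 1 (kappaPerm k l r).symm := by
  rw [mem_inversions_kappaPerm] at *
  rintro ⟨-, h2, -⟩
  have h3 := h.2.2
  cases h : ((wideIdx k l r).symm b).2 <;> simp_all

variable {F : Type*} [Field F]

variable (F) in
theorem kappa_eq : kappa F k l r = permGL F (kappaPerm k l r) := rfl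

variable (F) in
-- Moves the antidiagonal elements across `κ`, where they reverse the whole blocks of size `l + r`.
-- Thus `κ⁻¹ Z κ` is `V²` with the order of its blocks reversed, hence lower triangular.
theorem wDiag_mul_kappa :
    wDiag F k l r * kappa F k l r = kappa F k l r * permGL F (blockRev k l r) := by
  rw [kappa_eq, wDiag, permGL_mul_permGL, permGL_mul_permGL]
  congr 1
  ext p
  obtain ⟨s, rfl⟩ := (tallIdx k l r).surjective p
  rcases s with ⟨i, x⟩ | ⟨i, x⟩ <;> simp [kappaPerm, blockRev]

theorem mem_Z_iff {z : GL (Fin (k * (l + r))) F} :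
    z ∈ Z F k l r ↔ ∀ p p', (p', p) ∉ inversions 1 (kappaPerm k l r).symm →
      ((kappa F k l r)⁻¹ * z * kappa F k l r : GL (Fin (k * (l + r))) F) p p' =
        (1 : Matrix (Fin (k * (l + r))) (Fin (k * (l + r))) F) p p' := by
  have h1 : z ∈ Z F k l r ↔ (permGL F (blockRev k l r))⁻¹ *
      ((kappa F k l r)⁻¹ * z * kappa F k l r) * permGL F (blockRev k l r) ∈ V2 F k l r := by
    rw [Z, Subgroup.mem_map]
    constructor
    · rintro ⟨v, hv, rfl⟩
      convert hv using 1
      simp only [MulEquiv.coe_toMonoidHom, MulAut.conj_apply, wDiag_mul_kappa]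
      group
    · intro hv
      refine ⟨_, hv, ?_⟩
      simp only [MulEquiv.coe_toMonoidHom, MulAut.conj_apply, wDiag_mul_kappa]
      group
  rw [h1]
  have h2 : ∀ p p', ((permGL F (blockRev k l r))⁻¹ * ((kappa F k l r)⁻¹ * z * kappa F k l r) *
      permGL F (blockRev k l r) : GL (Fin (k * (l + r))) F) p p' =
      ((kappa F k l r)⁻¹ * z * kappa F k l r : GL (Fin (k * (l + r))) F)
        ((blockRev k l r).symm p) ((blockRev k l r).symm p') := by
    intro p p'
    rw [mul_permGL_apply, inv_permGL, permGL_mul_apply]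
    rfl
  change (∀ p p', ¬ IsV2Position k l r p p' → _) ↔ _
  constructor
  · intro h p p' hp
    have := h (blockRev k l r p) (blockRev k l r p') (by rwa [isV2Position_blockRev])
    rw [h2, Equiv.symm_apply_apply, Equiv.symm_apply_apply] at this
    rw [this]
    simp [Matrix.one_apply]
  · intro h p p' hp
    rw [h2, h _ _ (by rwa [← isV2Position_blockRev, Equiv.apply_symm_apply,
      Equiv.apply_symm_apply])]
    simp [Matrix.one_apply]

end Shuffle

/-! ### Additive coordinates on `Z`. -/

section Coordinates

variable {F : Type*} [Field F] {n : ℕ}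

/-- No column index of a root is a row index of another, so every product of two of the elementary
matrices is zero and the group product expands to a sum. -/
theorem coe_unip {N : ℕ} {α : Fin N → Fin n × Fin n} (hα : ∀ i j, (α i).1 ≠ (α j).2)
    (u : Fin N → F) : (unip α u : Matrix (Fin n) (Fin n) F) =
      1 + ∑ i, Matrix.single (α i).2 (α i).1 (u i) := by
  induction N with
  | zero => simp [unip_zero]
  | succ N ih =>
    have h1 := ih (α := Fin.tail α) (fun i j => hα i.succ j.succ) (Fin.tail u)
    have h2 : (Matrix.single (α 0).2 (α 0).1 (u 0) : Matrix (Fin n) (Fin n) F) *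
        ∑ i, Matrix.single (Fin.tail α i).2 (Fin.tail α i).1 (Fin.tail u i) = 0 := by
      rw [Finset.mul_sum]
      refine Finset.sum_eq_zero fun i _ => ?_
      rw [Matrix.single_mul_single_of_ne]
      exact hα 0 i.succ
    nth_rw 1 [← Fin.cons_self_tail α]
    rw [unip_cons, Units.val_mul, h1, coe_root (hα 0 0).symm, Matrix.transvection, mul_add, add_mul,
      add_mul, h2, Fin.sum_univ_succ, one_mul, one_mul, mul_one, add_zero, add_assoc]
    rfl

theorem unip_apply_of_eq {N : ℕ} {α : Fin N → Fin n × Fin n} (hα : ∀ i j, (α i).1 ≠ (α j).2)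
    (hinj : Function.Injective α) (u : Fin N → F) (i : Fin N) :
    (unip α u) (α i).2 (α i).1 = u i := by
  rw [coe_unip hα, Matrix.add_apply, Matrix.one_apply_ne (hα i i).symm, zero_add,
    Matrix.sum_apply, Finset.sum_eq_single i]
  · simp
  · intro j _ hj
    refine Matrix.single_apply_of_ne _ _ _ _ _ fun h => hj (hinj ?_)
    exact Prod.ext h.2 h.1
  · simp

theorem unip_apply_of_ne {N : ℕ} {α : Fin N → Fin n × Fin n} (hα : ∀ i j, (α i).1 ≠ (α j).2)
    (u : Fin N → F) {p p' : Fin n} (hp : ∀ i, α i ≠ (p', p)) :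
    (unip α u) p p' = (1 : Matrix (Fin n) (Fin n) F) p p' := by
  rw [coe_unip hα, Matrix.add_apply, Matrix.sum_apply, Finset.sum_eq_zero, add_zero]
  intro j _
  exact Matrix.single_apply_of_ne _ _ _ _ _ fun h => hp j (Prod.ext h.2 h.1)

variable [TopologicalSpace F] [IsTopologicalRing F] {k l r : ℕ}

/-- The coordinates on `Z` attached to an enumeration of the inversions of `κ`. -/
def zCoord {N : ℕ} (α : Fin N → Fin (k * (l + r)) × Fin (k * (l + r))) (z : Z F k l r)
    (i : Fin N) : F :=
  ((kappa F k l r)⁻¹ * (z : GL (Fin (k * (l + r))) F) * kappa F k l r :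
    GL (Fin (k * (l + r))) F) (α i).2 (α i).1

variable {N : ℕ} {α : Fin N → Fin (k * (l + r)) × Fin (k * (l + r))}

omit [TopologicalSpace F] [IsTopologicalRing F] in
theorem unip_zCoord (hinj : Function.Injective α)
    (hα : ∀ p, p ∈ inversions 1 (kappaPerm k l r).symm ↔ ∃ i, α i = p) (z : Z F k l r) :
    unip α (zCoord α z) = (kappa F k l r)⁻¹ * z * kappa F k l r := by
  have hne : ∀ i j, (α i).1 ≠ (α j).2 := fun i j h => by
    refine inversions_kappaPerm_not_trans ((hα _).2 ⟨j, rfl⟩ : ((α j).1, (α j).2) ∈ _)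
      (c := (α i).2) ?_
    rw [← h]
    exact (hα _).2 ⟨i, rfl⟩
  ext p p'
  by_cases hp : (p', p) ∈ inversions 1 (kappaPerm k l r).symm
  · obtain ⟨i, hi⟩ := (hα _).1 hp
    have := unip_apply_of_eq hne hinj (zCoord α z) i
    rw [zCoord, hi] at this
    exact this
  · rw [unip_apply_of_ne hne _ fun i hi => hp ((hα _).2 ⟨i, hi⟩), mem_Z_iff.1 z.2 p p' hp]

/-- `Z` is homeomorphic to an affine space through its coordinates. -/
def zHomeomorph (hinj : Function.Injective α)
    (hα : ∀ p, p ∈ inversions 1 (kappaPerm k l r).symm ↔ ∃ i, α i = p) :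
    Z F k l r ≃ₜ (Fin N → F) :=
  have hne : ∀ i j, (α i).1 ≠ (α j).2 := fun i j h => by
    refine inversions_kappaPerm_not_trans ((hα _).2 ⟨j, rfl⟩ : ((α j).1, (α j).2) ∈ _)
      (c := (α i).2) ?_
    rw [← h]
    exact (hα _).2 ⟨i, rfl⟩
  { toFun := zCoord α
    invFun := fun u => ⟨kappa F k l r * unip α u * (kappa F k l r)⁻¹, mem_Z_iff.2 fun p p' hp => by
      have h1 : (kappa F k l r)⁻¹ * (kappa F k l r * unip α u * (kappa F k l r)⁻¹) *
          kappa F k l r = unip α u := by group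
      rw [h1, unip_apply_of_ne hne _ fun i hi => hp ((hα _).2 ⟨i, hi⟩)]⟩
    left_inv := fun z => by
      ext1
      simp only [unip_zCoord hinj hα]
      group
    right_inv := fun u => by
      ext i
      have h1 : (kappa F k l r)⁻¹ * (kappa F k l r * unip α u * (kappa F k l r)⁻¹) *
          kappa F k l r = unip α u := by group
      simp only [zCoord]
      rw [h1, unip_apply_of_eq hne hinj]
    continuous_toFun := by
      refine continuous_pi fun i => ?_
      have h1 : Continuous fun z : Z F k l r => (kappa F k l r)⁻¹ *
        (z : GL (Fin (k * (l + r))) F) * kappa F k l r := by fun_prop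
      exact (Units.continuous_val.comp h1).matrix_elem _ _
    continuous_invFun := by
      refine Continuous.subtype_mk ?_ _
      exact (continuous_const.mul (continuous_unip α)).mul continuous_const }

omit [TopologicalSpace F] [IsTopologicalRing F] in
theorem zCoord_mul (hα : ∀ p, p ∈ inversions 1 (kappaPerm k l r).symm ↔ ∃ i, α i = p)
    (z z' : Z F k l r) : zCoord α (z * z') = zCoord α z + zCoord α z' := by
  ext i
  have h1 : (kappa F k l r)⁻¹ * ((z * z' : Z F k l r) : GL (Fin (k * (l + r))) F) * kappa F k l r =
      ((kappa F k l r)⁻¹ * z * kappa F k l r) * ((kappa F k l r)⁻¹ * z' * kappa F k l r) := by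
    rw [Subgroup.coe_mul]; group
  have h2 : (α i).2 ≠ (α i).1 := by
    have := (mem_inversions.1 ((hα _).2 ⟨i, rfl⟩)).1.ne
    exact fun h => this (by rw [h])
  simp only [zCoord, Pi.add_apply]
  rw [h1, Units.val_mul, off_mul F (P := fun p p' => (p', p) ∈ inversions 1 (kappaPerm k l r).symm)
    (fun x y z h h' => inversions_kappaPerm_not_trans h' h) (mem_Z_iff.1 z.2) (mem_Z_iff.1 z'.2),
    Matrix.sub_apply, Matrix.add_apply, Matrix.one_apply_ne h2, sub_zero]

end Coordinates

/-! ### Haar measure on `Z` in coordinates and the value of the intertwining integral. -/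

section HaarTransport

open MeasureTheory

variable {F : Type*} [Field F] [ValuativeRel F] [TopologicalSpace F]
  [IsNonarchimedeanLocalField F] {k l r : ℕ}
variable [MeasurableSpace F] [BorelSpace F] (ν : Measure F) [ν.IsAddHaarMeasure]

/-- The coordinates form an isomorphism of topological groups onto `F ^ N`, so the image of the Haar
measure is an additive Haar measure, unique up to a positive constant. -/
theorem exists_map_zCoord_eq [MeasurableSpace (Z F k l r)] [BorelSpace (Z F k l r)]
    (μ : Measure (Z F k l r)) [μ.IsHaarMeasure] {N : ℕ}
    {α : Fin N → Fin (k * (l + r)) × Fin (k * (l + r))} (hinj : Function.Injective α)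
    (hα : ∀ p, p ∈ inversions 1 (kappaPerm k l r).symm ↔ ∃ i, α i = p) :
    ∃ C : NNReal, C ≠ 0 ∧
      MeasurePreserving (zCoord α) μ (C • Measure.pi fun _ : Fin N => ν) := by
  let ψ : Z F k l r ≃ₜ (Fin N → F) := zHomeomorph hinj hα
  have hψ : ⇑ψ = zCoord α := rfl
  have hm : Measurable ψ := ψ.continuous.measurable
  have h1 : (μ.map ψ).IsAddHaarMeasure :=
    { lt_top_of_isCompact := fun K hK => by
        rw [Measure.map_apply hm hK.measurableSet]
        exact (ψ.isCompact_preimage.2 hK).measure_lt_top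
      map_add_left_eq_self := fun u => by
        obtain ⟨z, rfl⟩ := ψ.surjective u
        rw [Measure.map_map (measurable_const_add _) hm]
        have : (fun x => ψ z + x) ∘ ψ = ψ ∘ fun z' => z * z' := by
          ext1 z'
          simp only [Function.comp_apply, hψ, zCoord_mul hα]
        rw [this, ← Measure.map_map hm (measurable_const_mul _), map_mul_left_eq_self]
      open_pos := fun U hU hne => by
        rw [Measure.map_apply hm hU.measurableSet]
        exact ((hU.preimage ψ.continuous).measure_pos μ (hne.preimage ψ.surjective)).ne' }
  refine ⟨Measure.addHaarScalarFactor (μ.map ψ) (Measure.pi fun _ : Fin N => ν), ?_, hm, ?_⟩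
  · exact (Measure.addHaarScalarFactor_pos_of_isAddHaarMeasure _ _).ne'
  · rw [← hψ]
    exact Measure.isAddLeftInvariant_eq_smul _ _

theorem intertwining_integral [MeasurableSpace (Z F k l r)] [BorelSpace (Z F k l r)]
    (μ : Measure (Z F k l r)) [μ.IsHaarMeasure] (hν : ν 𝒪[F] = 1) :
    ∃ C : ℝ, C ≠ 0 ∧ ∀ (T : Fin (k * (l + r)) → ℂ) (g : GL (Fin (k * (l + r))) F),
      (∀ i, T i ≠ 0) →
      (∀ p ∈ inversions 1 (kappaPerm k l r).symm, ‖T p.1‖ < ‖T p.2‖) →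
      Integrable (fun z : Z F k l r => spherical 1 (unnormalized F 1 T)
        ((kappa F k l r)⁻¹ * (z : GL (Fin (k * (l + r))) F) * g)) μ ∧
      ∫ z : Z F k l r, spherical 1 (unnormalized F 1 T) ((kappa F k l r)⁻¹ * (z : GL (Fin (k * (l + r))) F) * g) ∂μ =
        C * ((∏ p ∈ inversions 1 (kappaPerm k l r).symm, gkFactor F (T p.1 / T p.2)) *
          spherical (kappaPerm k l r).symm (unnormalized F (kappaPerm k l r).symm T)
            ((kappa F k l r)⁻¹ * g)) := by
  obtain ⟨α, hinj, hα, hint⟩ := gindikin_karpelevich ν hν _ 1 (kappaPerm k l r).symm rfl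
  obtain ⟨C, hC, hmp⟩ := exists_map_zCoord_eq ν μ hinj hα
  have hemb : MeasurableEmbedding (zCoord α : Z F k l r → _) :=
    (zHomeomorph hinj hα).measurableEmbedding
  refine ⟨C, by exact_mod_cast hC, fun T g hT hlt => ?_⟩
  obtain ⟨h1, h2⟩ := hint T ((kappa F k l r)⁻¹ * g) hT hlt
  -- `κ⁻¹ z g = (κ⁻¹ z κ)(κ⁻¹ g)`.
  have hfun : (fun z : Z F k l r => spherical 1 (unnormalized F 1 T)
      ((kappa F k l r)⁻¹ * (z : GL (Fin (k * (l + r))) F) * g)) =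
      (fun u => spherical 1 (unnormalized F 1 T) (unip α u * ((kappa F k l r)⁻¹ * g))) ∘
        zCoord α := by
    ext z
    rw [Function.comp_apply, unip_zCoord hinj hα]
    congr 1
    group
  rw [hfun]
  refine ⟨(hmp.integrable_comp_emb hemb).2 h1.smul_measure_nnreal, ?_⟩
  have h3 := hmp.integral_comp hemb (fun u => spherical 1 (unnormalized F 1 T)
    (unip α u * ((kappa F k l r)⁻¹ * g)))
  refine h3.trans ?_
  rw [integral_smul_nnreal_measure, h2]
  rfl

end HaarTransport

/-! ### Values of rational functions -/

section Values

variable {F : Type*} [Field F] [ValuativeRel F] [TopologicalSpace F]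
  [IsNonarchimedeanLocalField F] {k : ℕ} {R R' : MerFun k} {ζ : Fin k → ℂ} {v v' : ℂ}

theorem HasValueAt.of_polynomial (P : MvPolynomial (Fin k) ℂ) (ζ : Fin k → ℂ) :
    HasValueAt F (algebraMap (MvPolynomial (Fin k) ℂ) (MerFun k) P) ζ (P.eval fun i => (q F : ℂ) ^ (-ζ i)) :=
  ⟨P, 1, by simp, by simp, by simp⟩

theorem HasValueAt.mul (h : HasValueAt F R ζ v) (h' : HasValueAt F R' ζ v') :
    HasValueAt F (R * R') ζ (v * v') := by
  obtain ⟨A, B, h1, h2, h3⟩ := h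
  obtain ⟨A', B', h1', h2', h3'⟩ := h'
  refine ⟨A * A', B * B', ?_, ?_, ?_⟩
  · rw [map_mul, map_mul, ← h1, ← h1']; ring
  · rw [map_mul]; exact mul_ne_zero h2 h2'
  · rw [map_mul, map_mul, ← h3, ← h3']; ring

theorem HasValueAt.sub (h : HasValueAt F R ζ v) (h' : HasValueAt F R' ζ v') :
    HasValueAt F (R - R') ζ (v - v') := by
  obtain ⟨A, B, h1, h2, h3⟩ := h
  obtain ⟨A', B', h1', h2', h3'⟩ := h'
  refine ⟨A * B' - A' * B, B * B', ?_, ?_, ?_⟩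
  · rw [map_sub, map_mul, map_mul, map_mul, ← h1, ← h1']; ring
  · rw [map_mul]; exact mul_ne_zero h2 h2'
  · rw [map_sub, map_mul, map_mul, map_mul, ← h3, ← h3']; ring

theorem HasValueAt.inv (h : HasValueAt F R ζ v) (hv : v ≠ 0) : HasValueAt F R⁻¹ ζ v⁻¹ := by
  obtain ⟨A, B, h1, h2, h3⟩ := h
  have hA : A.eval (fun i => (q F : ℂ) ^ (-ζ i)) ≠ 0 := by
    rw [← h3]; exact mul_ne_zero hv h2
  have hA0 : algebraMap (MvPolynomial (Fin k) ℂ) (MerFun k) A ≠ 0 := by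
    rw [ne_eq, FaithfulSMul.algebraMap_eq_zero_iff]
    rintro rfl
    simp at hA
  have hR : R ≠ 0 := by
    rintro rfl
    rw [zero_mul] at h1
    exact hA0 h1.symm
  refine ⟨B, A, ?_, hA, ?_⟩
  · rw [← h1, inv_mul_cancel_left₀ hR]
  · rw [← h3, inv_mul_cancel_left₀ hv]

variable (F) in
theorem HasValueAt.const (a : ℂ) (ζ : Fin k → ℂ) :
    HasValueAt F (algebraMap (MvPolynomial (Fin k) ℂ) (MerFun k) (MvPolynomial.C a)) ζ a := by
  simpa using HasValueAt.of_polynomial (F := F) (MvPolynomial.C a) ζ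

variable (F) in
theorem HasValueAt.one (ζ : Fin k → ℂ) : HasValueAt F (1 : MerFun k) ζ 1 := by
  simpa using HasValueAt.const F 1 ζ

theorem HasValueAt.pow (h : HasValueAt F R ζ v) (m : ℕ) : HasValueAt F (R ^ m) ζ (v ^ m) := by
  induction m with
  | zero => simpa using HasValueAt.one F ζ
  | succ m ih => rw [pow_succ, pow_succ]; exact ih.mul h

theorem HasValueAt.zpow (h : HasValueAt F R ζ v) (hv : v ≠ 0) (m : ℤ) :
    HasValueAt F (R ^ m) ζ (v ^ m) := by
  cases m with
  | ofNat m => simpa using h.pow m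
  | negSucc m =>
    rw [zpow_negSucc, zpow_negSucc]
    exact (h.pow _).inv (pow_ne_zero _ hv)

theorem HasValueAt.prod {ι : Type*} (s : Finset ι) {R : ι → MerFun k} {v : ι → ℂ}
    (h : ∀ i ∈ s, HasValueAt F (R i) ζ (v i)) :
    HasValueAt F (∏ i ∈ s, R i) ζ (∏ i ∈ s, v i) := by
  classical
  induction s using Finset.induction_on with
  | empty => simpa using HasValueAt.one F ζ
  | insert i s hi ih =>
    rw [Finset.prod_insert hi, Finset.prod_insert hi]
    exact (h i (Finset.mem_insert_self _ _)).mul (ih fun j hj => h j (Finset.mem_insert_of_mem hj))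

end Values

/-! ### The parameters of `ρ_c(τ_ζ)` and the meromorphic continuation -/

section Continuation

variable {F : Type*} [Field F] [ValuativeRel F] [TopologicalSpace F]
  [IsNonarchimedeanLocalField F] {k c l r : ℕ}

theorem blockEquiv_constComp (i : Fin k) (x : Fin c) :
    blockEquiv (constComp k c) (sum_constComp k c) ⟨i, x⟩ = finProdFinEquiv (i, x) := by
  ext
  have h : (blockEquiv (constComp k c) (sum_constComp k c) ⟨i, x⟩ : ℕ) =
    (finSigmaFinEquiv (⟨i, x⟩ : Σ i, Fin (constComp k c i)) : ℕ) := rfl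
  rw [h, finSigmaFinEquiv_apply]
  simp [constComp]
  ring

/-- The block of an index for the composition `(c^k)`. -/
def blockIdx (a : Fin (k * c)) : Fin k :=
  ((blockEquiv (constComp k c) (sum_constComp k c)).symm a).1

theorem blockIdx_finProdFinEquiv (i : Fin k) (x : Fin c) :
    blockIdx (finProdFinEquiv (i, x)) = i := by
  rw [blockIdx, ← blockEquiv_constComp, Equiv.symm_apply_apply]

theorem blockIdx_wideIdx (i : Fin k) (s : Fin l ⊕ Fin r) : blockIdx (wideIdx k l r (i, s)) = i :=
  blockIdx_finProdFinEquiv i (finSumFinEquiv s)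

/-- The normalized parameters of the principal series containing `ρ_c(τ_ζ)`. -/
def normParam (τ : Fin k → Fˣ →* ℂˣ) (ϖ : Fˣ) (c : ℕ) (ζ : Fin k → ℂ) (a : Fin (k * c)) : ℂ :=
  blockParam τ ϖ c ζ (blockIdx a) * ((q F : ℂ) ^ (a : ℕ))⁻¹

variable (τ : Fin k → Fˣ →* ℂˣ) (ϖ : Fˣ) (ζ : Fin k → ℂ)

theorem normParam_ne_zero (a : Fin (k * c)) : normParam τ ϖ c ζ a ≠ 0 :=
  mul_ne_zero (blockParam_ne_zero _ _ _ _ _) (inv_ne_zero (pow_ne_zero _ (q_ne_zero F)))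

theorem unramifiedSection_eq_spherical_normParam {τ : Fin k → Fˣ →* ℂˣ}
    (hτ : ∀ i, IsUnramified (τ i)) {ϖ : Fˣ} (hϖ : ord ϖ = 1) :
    unramifiedSection τ c ζ = spherical 1 (unnormalized F 1 (normParam τ ϖ c ζ)) := by
  rw [unramifiedSection_eq_spherical ζ hτ hϖ]
  congr 1
  ext a
  rw [unnormalized, normParam, Equiv.Perm.one_apply,
    inv_mul_cancel_right₀ (pow_ne_zero _ (q_ne_zero F))]
  rfl

/-- The half-modulus exponents cancel the offsets of the blocks and leave only the positions inside
them: `l + y` in a right part against `x < l` in a left part. Hence `m = l + y - x ≥ 1`,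
independently of `ζ`. -/
theorem normParam_div {p : Fin (k * (l + r)) × Fin (k * (l + r))}
    (hp : p ∈ inversions 1 (kappaPerm k l r).symm) :
    ∃ i j : Fin k, i < j ∧ ∃ m : ℕ, 1 ≤ m ∧ ∀ ζ : Fin k → ℂ,
      normParam τ ϖ (l + r) ζ p.1 / normParam τ ϖ (l + r) ζ p.2 =
        (q F : ℂ) ^ (-(ζ i - ζ j + m)) * (τ i ϖ : ℂ) * ((τ j)⁻¹ ϖ : ℂˣ) := by
  obtain ⟨a, b⟩ := p
  rw [mem_inversions_kappaPerm] at hp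
  obtain ⟨⟨i, s⟩, rfl⟩ := (wideIdx k l r).surjective a
  obtain ⟨⟨j, t⟩, rfl⟩ := (wideIdx k l r).surjective b
  simp only [Equiv.symm_apply_apply] at hp
  obtain ⟨hij, hs, ht⟩ := hp
  obtain ⟨y, rfl⟩ := Sum.isRight_iff.1 hs
  obtain ⟨x, rfl⟩ := Sum.isLeft_iff.1 ht
  refine ⟨i, j, hij, l + y - x, by omega, fun ζ => ?_⟩
  have hm : ((l + y - x : ℕ) : ℂ) = l + (y : ℕ) - (x : ℕ) := by
    rw [Nat.cast_sub (by omega)]; push_cast; ring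
  simp only [normParam, blockIdx_wideIdx, wideIdx_inl_val, wideIdx_inr_val, blockParam]
  have hq := q_ne_zero F
  rw [hm, ← Complex.cpow_natCast, ← Complex.cpow_natCast, ← Complex.cpow_neg, ← Complex.cpow_neg,
    MonoidHom.inv_apply, Units.val_inv_eq_inv_val]
  have e1 : -(ζ i - ζ j + (l + (y : ℕ) - (x : ℕ)) : ℂ) =
      (-(((l + r : ℕ) : ℂ) * (k - 1 - 2 * (i : ℕ)) / 2)) + -ζ i + -((l + y + (l + r) * i : ℕ) : ℂ) -
      ((-(((l + r : ℕ) : ℂ) * (k - 1 - 2 * (j : ℕ)) / 2)) + -ζ j +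
        -((x + (l + r) * j : ℕ) : ℂ)) := by
    push_cast; ring
  rw [e1, Complex.cpow_sub _ _ hq, Complex.cpow_add _ _ hq, Complex.cpow_add _ _ hq,
    Complex.cpow_add _ _ hq, Complex.cpow_add _ _ hq]
  rw [div_mul_eq_mul_div, ← div_eq_mul_inv, div_div]
  congr 1 <;> ring

theorem norm_q_cpow (s : ℂ) : ‖(q F : ℂ) ^ s‖ = (q F : ℝ) ^ s.re := by
  have := Complex.norm_cpow_eq_rpow_re_of_pos (q_pos (F := F)) s
  simpa using this

theorem exists_norm_normParam_lt (l r : ℕ) : ∃ C : ℝ, ∀ ζ : Fin k → ℂ,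
    (∀ i j, i < j → C ≤ (ζ i).re - (ζ j).re) →
    ∀ p ∈ inversions 1 (kappaPerm k l r).symm,
      ‖normParam τ ϖ (l + r) ζ p.1‖ < ‖normParam τ ϖ (l + r) ζ p.2‖ := by
  have hq1 : (1 : ℝ) < q F := by exact_mod_cast one_lt_q
  -- `q ^ C` bounds all the ratios of the `τ_i(ϖ)`; strictness will come from the extra factor `q ^
  -- (-m)` with `m ≥ 1`.
  obtain ⟨C, hC⟩ : ∃ C : ℝ, ∀ i j, ‖(τ i ϖ : ℂ)‖ * ‖(((τ j)⁻¹ ϖ : ℂˣ) : ℂ)‖ ≤ (q F : ℝ) ^ C := by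
    have h1 : ∀ i j, ∀ᶠ C : ℝ in Filter.atTop,
        ‖(τ i ϖ : ℂ)‖ * ‖(((τ j)⁻¹ ϖ : ℂˣ) : ℂ)‖ ≤ (q F : ℝ) ^ C := fun i j =>
      (tendsto_rpow_atTop_of_base_gt_one _ hq1).eventually_ge_atTop _
    exact (Filter.eventually_all.2 fun i => Filter.eventually_all.2 fun j => h1 i j).exists
  refine ⟨C, fun ζ hζ p hp => ?_⟩
  obtain ⟨i, j, hij, m, hm, h⟩ := normParam_div τ ϖ hp
  have hpos : 0 < ‖normParam τ ϖ (l + r) ζ p.2‖ := norm_pos_iff.2 (normParam_ne_zero _ _ _ _)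
  rw [← div_lt_one hpos, ← norm_div, h ζ, norm_mul, norm_mul, norm_q_cpow, mul_assoc]
  calc _ ≤ (q F : ℝ) ^ (-(ζ i - ζ j + m)).re * (q F : ℝ) ^ C := by
        gcongr
        exact hC i j
    _ = (q F : ℝ) ^ ((-(ζ i - ζ j + m)).re + C) := (Real.rpow_add q_pos _ _).symm
    _ < 1 := by
        refine Real.rpow_lt_one_of_one_lt_of_neg hq1 ?_
        have h1 := hζ i j hij
        have h2 : (1 : ℝ) ≤ m := by exact_mod_cast hm
        simp only [Complex.neg_re, Complex.add_re, Complex.sub_re, Complex.natCast_re]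
        linarith

/-- The normalized parameters as meromorphic functions of `ζ`. -/
def merParam (c : ℕ) (a : Fin (k * c)) : MerFun k :=
  algebraMap (MvPolynomial (Fin k) ℂ) (MerFun k) (MvPolynomial.C (normParam τ ϖ c 0 a) * MvPolynomial.X (blockIdx a))

theorem hasValueAt_merParam (a : Fin (k * c)) :
    HasValueAt F (merParam τ ϖ c a) ζ (normParam τ ϖ c ζ a) := by
  have h := HasValueAt.of_polynomial (F := F)
    (MvPolynomial.C (normParam τ ϖ c 0 a) * MvPolynomial.X (blockIdx a)) ζ
  have e : normParam τ ϖ c ζ a = (MvPolynomial.C (normParam τ ϖ c 0 a) *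
      MvPolynomial.X (blockIdx a)).eval fun i => (q F : ℂ) ^ (-ζ i) := by
    simp [normParam, blockParam]
    ring
  rw [e]
  exact h

/-- The meromorphic function `ζ ↦ m(ζ, κ)ξ⁰(ζ, g)`, up to a constant. -/
def merIntertwining (l r : ℕ) (g : GL (Fin (k * (l + r))) F) : MerFun k :=
  (∏ p ∈ inversions 1 (kappaPerm k l r).symm,
    (1 - merParam τ ϖ (l + r) p.1 * (merParam τ ϖ (l + r) p.2)⁻¹ *
      algebraMap (MvPolynomial (Fin k) ℂ) (MerFun k) (MvPolynomial.C ((q F : ℂ)⁻¹))) *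
    (1 - merParam τ ϖ (l + r) p.1 * (merParam τ ϖ (l + r) p.2)⁻¹)⁻¹) *
  ∏ a, (merParam τ ϖ (l + r) a * algebraMap (MvPolynomial (Fin k) ℂ) (MerFun k)
      (MvPolynomial.C ((q F : ℂ) ^ ((kappaPerm k l r).symm a : ℕ)))) ^
    ordF ((exists_iwasawa (kappaPerm k l r).symm ((kappa F k l r)⁻¹ * g)).choose a a)

/-- The value of `ζ ↦ m(ζ, κ)ξ⁰(ζ, g)`, up to a constant. -/
def intertwiningValue (l r : ℕ) (g : GL (Fin (k * (l + r))) F) : ℂ :=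
  (∏ p ∈ inversions 1 (kappaPerm k l r).symm,
    gkFactor F (normParam τ ϖ (l + r) ζ p.1 / normParam τ ϖ (l + r) ζ p.2)) *
  spherical (kappaPerm k l r).symm
    (unnormalized F (kappaPerm k l r).symm (normParam τ ϖ (l + r) ζ)) ((kappa F k l r)⁻¹ * g)

/-- The Iwasawa component of `κ⁻¹ g` does not involve `ζ`, so the spherical function is a Laurent
monomial in the parameters. Poles can come only from the denominators of the rank one factors. -/
theorem hasValueAt_merIntertwining
    (hne : ∀ p ∈ inversions 1 (kappaPerm k l r).symm,
      1 - normParam τ ϖ (l + r) ζ p.1 / normParam τ ϖ (l + r) ζ p.2 ≠ 0)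
    (g : GL (Fin (k * (l + r))) F) :
    HasValueAt F (merIntertwining τ ϖ l r g) ζ (intertwiningValue τ ϖ ζ l r g) := by
  refine HasValueAt.mul (.prod _ fun p hp => ?_) (.prod _ fun a _ => ?_)
  · have h1 : HasValueAt F (merParam τ ϖ (l + r) p.1 * (merParam τ ϖ (l + r) p.2)⁻¹) ζ
        (normParam τ ϖ (l + r) ζ p.1 / normParam τ ϖ (l + r) ζ p.2) := by
      rw [div_eq_mul_inv]
      exact (hasValueAt_merParam τ ϖ ζ _).mul
        ((hasValueAt_merParam τ ϖ ζ _).inv (normParam_ne_zero τ ϖ ζ _))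
    rw [gkFactor, div_eq_mul_inv, div_eq_mul_inv _ (q F : ℂ)]
    exact ((HasValueAt.one F ζ).sub (h1.mul (.const F _ ζ))).mul
      (((HasValueAt.one F ζ).sub h1).inv (hne p hp))
  · exact ((hasValueAt_merParam τ ϖ ζ a).mul (.const F _ ζ)).zpow
      (unnormalized_ne_zero F _ (normParam_ne_zero τ ϖ ζ) a) _

theorem intertwiningValue_kappa_ne_zero
    (hne : ∀ p ∈ inversions 1 (kappaPerm k l r).symm,
      gkFactor F (normParam τ ϖ (l + r) ζ p.1 / normParam τ ϖ (l + r) ζ p.2) ≠ 0) :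
    intertwiningValue τ ϖ ζ l r (kappa F k l r) ≠ 0 := by
  rw [intertwiningValue, inv_mul_cancel,
    spherical_of_mem (unnormalized_ne_zero F _ (normParam_ne_zero τ ϖ ζ)) (one_mem _), mul_one]
  exact Finset.prod_ne_zero_iff.2 hne

end Continuation

/-! ### The target representation -/

section Target

variable {F : Type*} [Field F] [ValuativeRel F] [TopologicalSpace F]
  [IsNonarchimedeanLocalField F] {d n : ℕ} {β : Fin d → ℕ} (h : ∑ i, β i = n)

theorem modulusPow_of_mem (s : ℂ) {m : Levi F β} (hm : ∀ i, m i ∈ maxCompact F (β i)) :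
    modulusPow β s m = 1 := by
  rw [modulusPow_eq, leviChar_of_mem hm]

variable {V : Type*} [AddCommMonoid V] [Module ℂ V] (σ : Representation ℂ (Levi F β) V) {v : V}

/-- The right invariant function in an induced representation taking the value `v` at `1`. -/
def sphericalVector (v : V) (g : GL (Fin n) F) : V :=
  modulusPow β (1 / 2) (toLevi β h (exists_parabolic_mul h g).choose) •
    σ (toLevi β h (exists_parabolic_mul h g).choose) v

/-- Two choices of the parabolic component differ by an element whose Levi part is in the maximal
compact subgroup; it fixes `v` and has trivial modulus. -/
theorem sphericalVector_mul (hv : ∀ m : Levi F β, (∀ i, m i ∈ maxCompact F (β i)) → σ m v = v)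
    (p : parabolic F β h) {y : GL (Fin n) F} (hy : y ∈ maxCompact F n) :
    sphericalVector h σ v ((p : GL (Fin n) F) * y) =
      modulusPow β (1 / 2) (toLevi β h p) • σ (toLevi β h p) v := by
  obtain ⟨-, y', hy', h2⟩ := (exists_parabolic_mul h ((p : GL (Fin n) F) * y)).choose_spec
  rw [sphericalVector]
  set p' := (exists_parabolic_mul h ((p : GL (Fin n) F) * y)).choose
  have h3 : ((p⁻¹ * p' : parabolic F β h) : GL (Fin n) F) ∈ maxCompact F n := by
    have : ((p⁻¹ * p' : parabolic F β h) : GL (Fin n) F) = y * y'⁻¹ := by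
      rw [Subgroup.coe_mul, Subgroup.coe_inv, inv_mul_eq_iff_eq_mul, ← mul_assoc, h2]; group
    rw [this]
    exact mul_mem hy (inv_mem hy')
  have h4 : p' = p * (p⁻¹ * p') := by group
  rw [h4, map_mul (toLevi β h), map_mul (modulusPow β _), map_mul σ, Module.End.mul_apply,
    hv _ (toLevi_mem_maxCompact β h h3), modulusPow_of_mem _ (toLevi_mem_maxCompact β h h3), mul_one]

theorem sphericalVector_mem
    (hv : ∀ m : Levi F β, (∀ i, m i ∈ maxCompact F (β i)) → σ m v = v) :
    sphericalVector h σ v ∈ parabolicInd β h σ := by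
  refine ⟨fun p g => ?_, maxCompact F n, isOpen_maxCompact, fun g y hy => ?_⟩
  · obtain ⟨p', -, y, hy, rfl⟩ := exists_parabolic_mul h g
    rw [← mul_assoc, ← Subgroup.coe_mul, sphericalVector_mul h σ hv _ hy,
      sphericalVector_mul h σ hv _ hy, map_mul (toLevi β h), map_mul (modulusPow β _), map_mul σ,
      Module.End.mul_apply, mul_smul, map_smul]
  · obtain ⟨p, -, y', hy', rfl⟩ := exists_parabolic_mul h g
    rw [mul_assoc, sphericalVector_mul h σ hv _ (mul_mem hy' hy), sphericalVector_mul h σ hv _ hy']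

end Target

/-! ### Identification of the spherical function with the unramified vector of the target
representation. -/

section TargetSpace

variable {F : Type*} [Field F] [ValuativeRel F] [TopologicalSpace F]
  [IsNonarchimedeanLocalField F] {k l r : ℕ} {τ : Fin k → Fˣ →* ℂˣ} (ζ : Fin k → ℂ)

/-- The normalized unramified vector, as an element of the space of `ρ_c(τ_ζ)`. -/
def unramifiedVector (hτ : ∀ i, IsUnramified (τ i)) (c : ℕ) : rhoSpace τ ζ c :=
  ⟨unramifiedSection τ c ζ, (isNormalizedUnramifiedVector_unramifiedSection ζ hτ c).1⟩

theorem rho_unramifiedVector (hτ : ∀ i, IsUnramified (τ i)) (c : ℕ) {y : GL (Fin (k * c)) F}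
    (hy : y ∈ maxCompact F (k * c)) :
    rho τ ζ c y (unramifiedVector ζ hτ c) = unramifiedVector ζ hτ c :=
  Subtype.ext (funext fun g =>
    (isNormalizedUnramifiedVector_unramifiedSection ζ hτ c).2.1 g y hy)

theorem targetLeviRep_tmul (m : Levi F (twoComp k l r)) (v : rhoSpace τ ζ l)
    (v' : rhoSpace τ ζ r) :
    targetLeviRep τ ζ l r m (v ⊗ₜ v') = modulusPow (twoComp k l r) (-(1 / (2 * (k : ℂ)))) m •
      ((rho τ ζ l (m 0) v) ⊗ₜ[ℂ] (rho τ ζ r (m 1) v')) := rfl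

theorem evalOne_tmul (v : rhoSpace τ ζ l) (v' : rhoSpace τ ζ r) :
    evalOne τ ζ l r (v ⊗ₜ v') = v.1 1 * v'.1 1 := rfl

theorem targetLeviRep_unramifiedVector (hτ : ∀ i, IsUnramified (τ i))
    {m : Levi F (twoComp k l r)} (hm : ∀ i, m i ∈ maxCompact F (twoComp k l r i)) :
    targetLeviRep τ ζ l r m (unramifiedVector ζ hτ l ⊗ₜ unramifiedVector ζ hτ r) =
      unramifiedVector ζ hτ l ⊗ₜ unramifiedVector ζ hτ r := by
  rw [targetLeviRep_tmul, modulusPow_of_mem _ hm, one_smul, rho_unramifiedVector ζ hτ l (hm 0),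
    rho_unramifiedVector ζ hτ r (hm 1)]

theorem unramifiedSection_of_mem_borelOf (hτ : ∀ i, IsUnramified (τ i)) {ϖ : Fˣ} (hϖ : ord ϖ = 1)
    {c : ℕ} {b : GL (Fin (k * c)) F} (hb : b ∈ borelOf F 1) :
    unramifiedSection τ c ζ b = diagChar (fun a => blockParam τ ϖ c ζ (blockIdx a)) b := by
  rw [unramifiedSection_eq_spherical ζ hτ hϖ, ← mul_one b,
    spherical_mul (fun _ => blockParam_ne_zero _ _ _ _ _) hb (one_mem _), mul_one]
  rfl

theorem rho_unramifiedVector_one (hτ : ∀ i, IsUnramified (τ i)) {ϖ : Fˣ} (hϖ : ord ϖ = 1)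
    {c : ℕ} {b : GL (Fin (k * c)) F} (hb : b ∈ borelOf F 1) :
    (rho τ ζ c b (unramifiedVector ζ hτ c)).1 1 =
      diagChar (fun a => blockParam τ ϖ c ζ (blockIdx a)) b := by
  rw [← unramifiedSection_of_mem_borelOf ζ hτ hϖ hb]
  exact congrArg (unramifiedSection τ c ζ) (one_mul b)

theorem blockEquiv_twoComp_zero (i : Fin k) (x : Fin l) :
    blockEquiv (twoComp k l r) (sum_twoComp k l r)
      ⟨0, (finProdFinEquiv (i, x) : Fin (k * l))⟩ = tallIdx k l r (Sum.inl (i, x)) := by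
  ext
  change (finSigmaFinEquiv (⟨0, _⟩ : Σ i, Fin (twoComp k l r i)) : ℕ) = _
  rw [finSigmaFinEquiv_apply, tallIdx_inl_val]
  simp

theorem blockEquiv_twoComp_one (i : Fin k) (x : Fin r) :
    blockEquiv (twoComp k l r) (sum_twoComp k l r)
      ⟨1, (finProdFinEquiv (i, x) : Fin (k * r))⟩ = tallIdx k l r (Sum.inr (i, x)) := by
  ext
  change (finSigmaFinEquiv (⟨1, _⟩ : Σ i, Fin (twoComp k l r i)) : ℕ) = _
  rw [finSigmaFinEquiv_apply, tallIdx_inr_val]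
  simp

/-- The parameters of the modulus factor of the target representation. -/
def targetModulusParam (F : Type*) [Field F] [ValuativeRel F] [TopologicalSpace F]
    [IsNonarchimedeanLocalField F] (k l r : ℕ) (i : Fin 2) : ℂ :=
  (q F : ℂ) ^ (![-(r * (k - 1) / 2 : ℂ), (l * (k - 1) / 2 : ℂ)] i)

/-- The product is `δ ^ ((k - 1) / (2k))`. The block sizes `k r` and `k l` occurring in `δ` cancel
the `k`, leaving the exponents `r (k - 1) / 2` and `l (k - 1) / 2`. -/
theorem modulusPow_twoComp (hk : 0 < k) (m : Levi F (twoComp k l r)) :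
    modulusPow (twoComp k l r) (1 / 2) m *
      modulusPow (twoComp k l r) (-(1 / (2 * (k : ℂ)))) m =
      leviChar (targetModulusParam F k l r) m := by
  have hk0 : (k : ℂ) ≠ 0 := by exact_mod_cast hk.ne'
  rw [modulusPow_eq, modulusPow_eq, leviChar_mul]
  congr 1
  ext i
  rw [← Complex.cpow_add _ _ (q_ne_zero F), targetModulusParam]
  congr 1
  fin_cases i <;> simp <;> field_simp <;> ring

/-- Here the twist of the target appears: replacing the position `x + (l + r) i` by `x + l i`
changes the modulus exponent of size `l + r` into that of size `l`, plus a remainder `-r (k - 1) /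
2` independent of `i`. -/
theorem unnormalized_normParam_left (ϖ : Fˣ) (i : Fin k) (x : Fin l) :
    unnormalized F (kappaPerm k l r).symm (normParam τ ϖ (l + r) ζ)
      (wideIdx k l r (i, Sum.inl x)) =
      targetModulusParam F k l r 0 * blockParam τ ϖ l ζ i := by
  have hq := q_ne_zero F
  rw [unnormalized, kappaPerm_symm_wideIdx_inl, tallIdx_inl_val, normParam, blockIdx_wideIdx,
    wideIdx_inl_val, targetModulusParam, blockParam, blockParam, ← Complex.cpow_natCast,
    ← Complex.cpow_natCast, ← Complex.cpow_neg, ← mul_assoc (_ ^ (_ : ℂ)) (_ ^ (_ : ℂ)) (_ * _),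
    ← Complex.cpow_add _ _ hq, mul_assoc, mul_assoc, ← Complex.cpow_add _ _ hq, mul_comm (_ * _),
    ← mul_assoc, ← Complex.cpow_add _ _ hq]
  congr 2
  simp
  ring

/-- As in the left part, but the position changes from `l + x + (l + r) i` to `k l + x + r i`; the
extra `l (k - 1)` turns the remainder into `l (k - 1) / 2`. -/
theorem unnormalized_normParam_right (ϖ : Fˣ) (i : Fin k) (x : Fin r) :
    unnormalized F (kappaPerm k l r).symm (normParam τ ϖ (l + r) ζ)
      (wideIdx k l r (i, Sum.inr x)) =
      targetModulusParam F k l r 1 * blockParam τ ϖ r ζ i := by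
  have hq := q_ne_zero F
  rw [unnormalized, kappaPerm_symm_wideIdx_inr, tallIdx_inr_val, normParam, blockIdx_wideIdx,
    wideIdx_inr_val, targetModulusParam, blockParam, blockParam, ← Complex.cpow_natCast,
    ← Complex.cpow_natCast, ← Complex.cpow_neg, ← mul_assoc (_ ^ (_ : ℂ)) (_ ^ (_ : ℂ)) (_ * _),
    ← Complex.cpow_add _ _ hq, mul_assoc, mul_assoc, ← Complex.cpow_add _ _ hq, mul_comm (_ * _),
    ← mul_assoc, ← Complex.cpow_add _ _ hq]
  congr 2
  simp
  ring

variable (F k l r) in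
theorem kappa_mem_maxCompact : kappa F k l r ∈ maxCompact F (k * (l + r)) :=
  permGL_mem_maxCompact _

/-- Conjugation by `κ` carries the standard Borel subgroup to the one for the order `κ⁻¹`, permuting
the diagonal, and `κ` itself lies in the maximal compact subgroup. -/
theorem spherical_kappa_inv_mul {t : Fin (k * (l + r)) → ℂ} (ht : ∀ i, t i ≠ 0)
    {b y : GL (Fin (k * (l + r))) F} (hb : b ∈ borelOf F 1) (hy : y ∈ maxCompact F (k * (l + r))) :
    spherical (kappaPerm k l r).symm t ((kappa F k l r)⁻¹ * (b * y)) =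
      diagChar (fun x => t (kappaPerm k l r x)) b := by
  have hap : ∀ i j, ((kappa F k l r)⁻¹ * b * kappa F k l r : GL (Fin (k * (l + r))) F) i j =
      b ((kappaPerm k l r).symm i) ((kappaPerm k l r).symm j) := by
    intro i j
    rw [kappa_eq, mul_permGL_apply, inv_permGL, permGL_mul_apply]
    rfl
  have h1 : (kappa F k l r)⁻¹ * (b * y) = ((kappa F k l r)⁻¹ * b * kappa F k l r) *
      ((kappa F k l r)⁻¹ * y) := by group
  have h2 : (kappa F k l r)⁻¹ * b * kappa F k l r ∈ borelOf F (kappaPerm k l r).symm := by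
    rw [mem_borelOf]
    intro i j hij
    rw [hap]
    exact hb hij
  rw [h1, spherical_mul ht h2 (mul_mem (inv_mem (kappa_mem_maxCompact F k l r)) hy),
    diagChar, diagChar,
    ← Equiv.prod_comp (kappaPerm k l r)]
  refine Finset.prod_congr rfl fun x _ => ?_
  rw [hap, Equiv.symm_apply_apply]

/-- Both functions are right invariant under the maximal compact subgroup, so by the Iwasawa
decomposition it suffices to compare their characters on the Borel subgroup, block by block. -/
theorem spherical_mem_targetSpace (hk : 0 < k) (hτ : ∀ i, IsUnramified (τ i)) {ϖ : Fˣ}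
    (hϖ : ord ϖ = 1) :
    (fun g => spherical (kappaPerm k l r).symm
      (unnormalized F (kappaPerm k l r).symm (normParam τ ϖ (l + r) ζ))
      ((kappa F k l r)⁻¹ * g)) ∈ targetSpace τ ζ l r := by
  let v₀ : rhoSpace τ ζ l ⊗[ℂ] rhoSpace τ ζ r := unramifiedVector ζ hτ l ⊗ₜ unramifiedVector ζ hτ r
  have hv : ∀ m : Levi F (twoComp k l r), (∀ i, m i ∈ maxCompact F (twoComp k l r i)) →
      targetLeviRep τ ζ l r m v₀ = v₀ :=
    fun m hm => targetLeviRep_unramifiedVector ζ hτ hm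
  have hmem := sphericalVector_mem (sum_twoComp k l r) (targetLeviRep τ ζ l r) hv
  refine Submodule.mem_map.2 ⟨sphericalVector (sum_twoComp k l r) (targetLeviRep τ ζ l r) v₀, hmem,
    ?_⟩
  ext g
  obtain ⟨p, hp, y, hy, rfl⟩ := exists_parabolic_mul (sum_twoComp k l r) g
  rw [spherical_kappa_inv_mul (unnormalized_ne_zero F _ (normParam_ne_zero τ ϖ ζ)) hp hy]
  change evalOne τ ζ l r (sphericalVector (sum_twoComp k l r) (targetLeviRep τ ζ l r) v₀
      ((p : GL (Fin (k * (l + r))) F) * y)) = _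
  rw [sphericalVector_mul _ _ hv p hy, targetLeviRep_tmul, map_smul, map_smul, evalOne_tmul,
    smul_eq_mul, smul_eq_mul, ← mul_assoc, modulusPow_twoComp hk]
  have e0 : (rho τ ζ l (toLevi (twoComp k l r) (sum_twoComp k l r) p 0)
      (unramifiedVector ζ hτ l)).1 1 =
      diagChar (fun a => blockParam τ ϖ l ζ (blockIdx a))
        (toLevi (twoComp k l r) (sum_twoComp k l r) p 0 : GL (Fin (k * l)) F) :=
    rho_unramifiedVector_one ζ hτ hϖ (toLevi_mem_borelOf (twoComp k l r) (sum_twoComp k l r) hp 0)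
  have e1 : (rho τ ζ r (toLevi (twoComp k l r) (sum_twoComp k l r) p 1)
      (unramifiedVector ζ hτ r)).1 1 =
      diagChar (fun a => blockParam τ ϖ r ζ (blockIdx a))
        (toLevi (twoComp k l r) (sum_twoComp k l r) p 1 : GL (Fin (k * r)) F) :=
    rho_unramifiedVector_one ζ hτ hϖ (toLevi_mem_borelOf (twoComp k l r) (sum_twoComp k l r) hp 1)
  rw [e0, e1, leviChar_toLevi _ (t := targetModulusParam F k l r) (fun i => q_cpow_ne_zero F _) hp]
  simp only [diagChar]
  rw [← (blockEquiv (twoComp k l r) (sum_twoComp k l r)).prod_comp,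
    ← (blockEquiv (twoComp k l r) (sum_twoComp k l r)).prod_comp, Fintype.prod_sigma,
    Fintype.prod_sigma, Fin.prod_univ_two, Fin.prod_univ_two, mul_mul_mul_comm]
  simp only [Equiv.symm_apply_apply]
  have k0 : ∀ x : Fin (k * l), unnormalized F (kappaPerm k l r).symm (normParam τ ϖ (l + r) ζ)
      (kappaPerm k l r (blockEquiv (twoComp k l r) (sum_twoComp k l r) ⟨0, x⟩)) =
      targetModulusParam F k l r 0 * blockParam τ ϖ l ζ (blockIdx x) := by
    intro x
    obtain ⟨⟨i, x⟩, rfl⟩ := finProdFinEquiv.surjective x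
    rw [blockEquiv_twoComp_zero, ← kappaPerm_symm_wideIdx_inl, Equiv.apply_symm_apply,
      unnormalized_normParam_left, blockIdx_finProdFinEquiv]
  have k1 : ∀ x : Fin (k * r), unnormalized F (kappaPerm k l r).symm (normParam τ ϖ (l + r) ζ)
      (kappaPerm k l r (blockEquiv (twoComp k l r) (sum_twoComp k l r) ⟨1, x⟩)) =
      targetModulusParam F k l r 1 * blockParam τ ϖ r ζ (blockIdx x) := by
    intro x
    obtain ⟨⟨i, x⟩, rfl⟩ := finProdFinEquiv.surjective x
    rw [blockEquiv_twoComp_one, ← kappaPerm_symm_wideIdx_inr, Equiv.apply_symm_apply,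
      unnormalized_normParam_right, blockIdx_finProdFinEquiv]
  congr 1
  · refine Finset.prod_mul_distrib.symm.trans (Finset.prod_congr rfl fun x _ => ?_)
    exact (mul_zpow _ _ _).symm.trans (congrArg (fun z : ℂ => z ^ ordF ((p : GL (Fin (k * (l + r))) F)
      (blockEquiv (twoComp k l r) (sum_twoComp k l r) ⟨0, x⟩)
      (blockEquiv (twoComp k l r) (sum_twoComp k l r) ⟨0, x⟩))) (k0 x).symm)
  · refine Finset.prod_mul_distrib.symm.trans (Finset.prod_congr rfl fun x _ => ?_)
    exact (mul_zpow _ _ _).symm.trans (congrArg (fun z : ℂ => z ^ ordF ((p : GL (Fin (k * (l + r))) F)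
      (blockEquiv (twoComp k l r) (sum_twoComp k l r) ⟨1, x⟩)
      (blockEquiv (twoComp k l r) (sum_twoComp k l r) ⟨1, x⟩))) (k1 x).symm)

end TargetSpace

/-! ### Normalization of the measure and nonvanishing of the factors. -/

section Main

open MeasureTheory

variable {F : Type*} [Field F] [ValuativeRel F] [TopologicalSpace F]
  [IsNonarchimedeanLocalField F]

variable (F) in
theorem exists_addHaar_integer_eq_one [MeasurableSpace F] [BorelSpace F] :
    ∃ ν : Measure F, ν.IsAddHaarMeasure ∧ ν 𝒪[F] = 1 := by
  let K : TopologicalSpace.PositiveCompacts F :=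
    { carrier := 𝒪[F]
      isCompact' := isCompact_integer F
      interior_nonempty' := by
        rw [(isOpen_integer F).interior_eq]
        exact ⟨0, zero_mem _⟩ }
  exact ⟨Measure.addHaarMeasure K, inferInstance, Measure.addHaarMeasure_self⟩

theorem normParam_factors_ne_zero {k l r : ℕ} {τ : Fin k → Fˣ →* ℂˣ} {ϖ : Fˣ}
    (hne : ∀ i j, i < j → ∀ s : ℂ, 1 ≤ s.re →
      1 - (q F : ℂ) ^ (-s) * (τ i ϖ : ℂ) * ((τ j)⁻¹ ϖ : ℂˣ) ≠ 0)
    {ζ : Fin k → ℂ} (hζ : ∀ i j, i ≤ j → (ζ j).re ≤ (ζ i).re)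
    {p : Fin (k * (l + r)) × Fin (k * (l + r))}
    (hp : p ∈ inversions 1 (kappaPerm k l r).symm) :
    1 - normParam τ ϖ (l + r) ζ p.1 / normParam τ ϖ (l + r) ζ p.2 ≠ 0 ∧
      gkFactor F (normParam τ ϖ (l + r) ζ p.1 / normParam τ ϖ (l + r) ζ p.2) ≠ 0 := by
  obtain ⟨i, j, hij, m, hm, h⟩ := normParam_div τ ϖ hp
  have hs : 1 ≤ (ζ i - ζ j + m).re := by
    have h1 := hζ i j hij.le
    have h2 : (1 : ℝ) ≤ m := by exact_mod_cast hm
    simp only [Complex.add_re, Complex.sub_re, Complex.natCast_re]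
    linarith
  have h1 := hne i j hij _ hs
  -- The numerator `1 - w / q` is the denominator `1 - w` with `s` replaced by `s + 1`.
  have h2 := hne i j hij (ζ i - ζ j + m + 1) (by
    rw [Complex.add_re, Complex.one_re]
    linarith)
  rw [neg_add, ← sub_eq_add_neg, Complex.cpow_sub _ _ (q_ne_zero F), Complex.cpow_one,
    div_mul_eq_mul_div, div_mul_eq_mul_div] at h2
  rw [gkFactor, h ζ]
  exact ⟨h1, div_ne_zero h2 h1⟩

end Main

end UnramifiedInd

end

theorem mainTheorem7
    {F : Type*} [Field F] [ValuativeRel F] [TopologicalSpace F]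
    [IsNonarchimedeanLocalField F] [CharZero F]
    (k l r : ℕ) (hk : 0 < k) (hl : 0 < l) (hr : 0 < r)
    (τ : Fin k → Fˣ →* ℂˣ) (hτ : ∀ i, IsUnramified (τ i))
    (ϖ : Fˣ) (hϖ : ord ϖ = 1)
    (hne : ∀ i j, i < j → ∀ s : ℂ, 1 ≤ s.re →
      1 - (q F : ℂ) ^ (-s) * (τ i ϖ : ℂ) * ((τ j)⁻¹ ϖ : ℂˣ) ≠ 0)
    [MeasurableSpace (Z F k l r)] [BorelSpace (Z F k l r)]
    (μ : MeasureTheory.Measure (Z F k l r)) [μ.IsHaarMeasure] :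
    (∀ ζ, IsNormalizedUnramifiedVector τ ζ (l + r) (unramifiedSection τ (l + r) ζ)) ∧
    ∃ M : GL (Fin (k * (l + r))) F → MerFun k,
      IsIntertwiningContinuation μ (unramifiedSection τ (l + r)) M ∧
      ∀ ζ : Fin k → ℂ, (∀ i j, i ≤ j → (ζ j).re ≤ (ζ i).re) →
        ∃ f : GL (Fin (k * (l + r))) F → ℂ,
          (∀ g, HasValueAt F (M g) ζ (f g)) ∧ f ≠ 0 ∧ f ∈ targetSpace τ ζ l r := by

  let _ : MeasurableSpace F := borel F
  have : BorelSpace F := ⟨rfl⟩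
  obtain ⟨ν, _, hν⟩ := exists_addHaar_integer_eq_one F
  obtain ⟨C, hC, hint⟩ := intertwining_integral ν μ hν
  refine ⟨fun ζ => isNormalizedUnramifiedVector_unramifiedSection ζ hτ (l + r),
    fun g => algebraMap (MvPolynomial (Fin k) ℂ) (MerFun k) (MvPolynomial.C (C : ℂ)) *
      merIntertwining τ ϖ l r g, ?_, fun ζ hζ => ?_⟩
  · obtain ⟨B, hB⟩ := exists_norm_normParam_lt τ ϖ l r
    refine ⟨B, fun ζ hζ g => ?_⟩
    obtain ⟨h1, h2⟩ := hint (normParam τ ϖ (l + r) ζ) g (normParam_ne_zero τ ϖ ζ) (hB ζ hζ)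
    rw [unramifiedSection_eq_spherical_normParam ζ hτ hϖ]
    refine ⟨h1, ?_⟩
    rw [h2]
    refine (HasValueAt.const F _ ζ).mul (hasValueAt_merIntertwining τ ϖ ζ (fun p hp h0 => ?_) g)
    -- In the cone of convergence all ratios have norm less than `1`, so no denominator vanishes
    -- there.
    have h3 : ‖normParam τ ϖ (l + r) ζ p.1 / normParam τ ϖ (l + r) ζ p.2‖ < 1 := by
      rw [norm_div, div_lt_one (norm_pos_iff.2 (normParam_ne_zero τ ϖ ζ _))]
      exact hB ζ hζ p hp
    rw [← sub_eq_zero.1 h0, norm_one] at h3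
    exact lt_irrefl _ h3
  · have hfac := fun p hp => normParam_factors_ne_zero (p := p) (l := l) (r := r) hne hζ hp
    refine ⟨fun g => C * intertwiningValue τ ϖ ζ l r g, fun g => (HasValueAt.const F _ ζ).mul
      (hasValueAt_merIntertwining τ ϖ ζ (fun p hp => (hfac p hp).1) g), fun h0 => ?_, ?_⟩
    -- Nonvanishing is tested at `g = κ`, where the spherical function is evaluated at `1`.
    · exact mul_ne_zero (Complex.ofReal_ne_zero.2 hC)
        (intertwiningValue_kappa_ne_zero τ ϖ ζ fun p hp => (hfac p hp).2)
        (congrFun h0 (kappa F k l r))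
    · have h := (targetSpace τ ζ l r).smul_mem
        (C * ∏ p ∈ inversions 1 (kappaPerm k l r).symm,
          gkFactor F (normParam τ ϖ (l + r) ζ p.1 / normParam τ ϖ (l + r) ζ p.2))
        (spherical_mem_targetSpace ζ hk hτ hϖ)
      convert h using 1
      ext g
      exact (mul_assoc _ _ _).symm
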